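/- Let $(w_k)_{k\ge0}$ be non-negative real numbers such that $w_k\sim ck^{-\beta}$ as $k\to\infty$, for some $c>0$ and $\beta>2$. Let $\Phi(t)=\sum_{k\ge0}w_kt^k$, let $\rho$ be its radius of convergence, and let $\nu=\Psi(\rho)\in[0,\infty]$, where $\Psi(t)=\sum_k kw_kt^k\big/\sum_k w_kt^k$ (if $\Phi(\rho)=\infty$, $\Psi(\rho)$ means $\lim_{t\uparrow\rho}\Psi(t)$). For $m\ge0$, $n\ge1$ let $$Z(m,n)=\sum_{y\in\mathbb N_0^n:\ y_1+\dots+y_n=m}\ \prod_{i=1}^n w_{y_i},$$ and, when $Z(m,n)>0$, let $B_{m,n}=(Y_1,\dots,Y_n)$ be the random allocation of $m$ balls in $n$ boxes with $\mathbb P(B_{m,n}=y)=\prod_{i}w_{y_i}/Z(m,n)$ for $y\in\mathbb N_0^n$ with $\sum_i y_i=m$. Let $Y_{(1)}\ge Y_{(2)}\ge\dots\ge Y_{(n)}$ be $Y_1,\dots,Y_n$ in decreasing order. Then $\nu<\infty$. Suppose further that $m=m(n)$ satisfies $m/n\to\lambda$ as $n\to\infty$, where $\lambda$ is real and $\lambda>\nu$.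 Let $\alpha=\beta-1>1$, $c'=c/\Phi(1)$, and $\pi_k=w_k\rho^k/\Phi(\rho)$ (here $\rho=1$, so $\pi_k=w_k/\Phi(1)$). Then, as $n\to\infty$: (i) $Y_{(1)}=(\lambda-\nu)n+o_p(n)$ and $Y_{(2)}=o_p(n)$. (ii) $Z(m,n)\sim c(\lambda-\nu)^{-\beta}\,\Phi(1)^{n-1}\,n^{1-\beta}$. (In particular, $Z(m,n)>0$ for all large $n$.) (iii) Let $\xi_1,\dots,\xi_{n-1}$ be i.i.d. with distribution $(\pi_k)_{k\ge0}$, and let $\xi^*_{(1)}\ge\dots\ge\xi^*_{(n-1)}$ be these variables in decreasing order. Then there are couplings of the random vectors $$\bigl(Y_{(1)},Y_{(2)},\dots,Y_{(n)}\bigr)\quad\text{and}\quad\Bigl(m-\sum_{i=1}^{n-1}\xi_i,\ \xi^*_{(1)},\dots,\xi^*_{(n-1)}\Bigr)$$ under which they are equal with probability tending to $1$. (iv) If moreover $\beta<3$, i.e. $1<\alpha<2$, then $Y_{(1)}=m-\nu n+O_p(n^{1/\alpha})$ and $$n^{-1/\alpha}\bigl(m-\nu n-Y_{(1)}\bigr)\xrightarrow{d}X_\alpha,$$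 where $X_\alpha$ is an $\alpha$-stable random variable with Laplace transform $\mathbb E\,e^{-tX_\alpha}=\exp\bigl(c'\Gamma(-\alpha)t^\alpha\bigr)$ for all complex $t$ with $\operatorname{Re}t\ge0$ (the expectation being absolutely convergent). (v) $Y_{(2)}=O_p(n^{1/\alpha})$ and $n^{-1/\alpha}Y_{(2)}\xrightarrow{d}W$, where $W$ has the Fréchet distribution $\mathbb P(W\le x)=\exp\bigl(-\tfrac{c'}{\alpha}x^{-\alpha}\bigr)$ for $x>0$, and $\mathbb P(W\le 0)=0$. (vi) More generally, for each fixed $j\ge2$, $Y_{(j)}=O_p(n^{1/\alpha})$ and $n^{-1/\alpha}Y_{(j)}\xrightarrow{d}W_j$, where $W_j$ has the density $$c'x^{-\alpha-1}\,\frac{\bigl(c'\alpha^{-1}x^{-\alpha}\bigr)^{j-2}}{(j-2)!}\,\exp\bigl(-c'\alpha^{-1}x^{-\alpha}\bigr),\qquad x>0,$$ (and $0$ for $x\le0$), and $c'\alpha^{-1}W_j^{-\alpha}$ has the Gamma distribution $\Gamma(j-1,1)$. -/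

import Mathlib

open MeasureTheory ProbabilityTheory Filter Topology Asymptotics
open scoped ENNReal

noncomputable section

namespace BallsInBoxes

/-- The generating function `Φ(t) = ∑ₖ wₖ tᵏ` of a non-negative weight sequence, for
`t ∈ [0, ∞]`, with values in `[0, ∞]`. -/
def Phi (w : ℕ → ℝ) (t : ℝ≥0∞) : ℝ≥0∞ :=
  ∑' k : ℕ, ENNReal.ofReal (w k) * t ^ k

/-- The radius of convergence `ρ = 1 / limsup wₖ^(1/k)` of `Φ`, in `[0, ∞]`. -/
def radius (w : ℕ → ℝ) : ℝ≥0∞ :=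
  (limsup (fun k : ℕ => ENNReal.ofReal (w k) ^ (1 / (k : ℝ))) atTop)⁻¹

/-- `(∑ₖ k wₖ tᵏ) / (∑ₖ wₖ tᵏ)`, for `t` such that `Φ(t) < ∞`. -/
def Psi (w : ℕ → ℝ) (t : ℝ≥0∞) : ℝ≥0∞ :=
  (∑' k : ℕ, (k : ℝ≥0∞) * (ENNReal.ofReal (w k) * t ^ k)) / Phi w t

open Classical in
/-- `ν = Ψ(ρ) ∈ [0, ∞]`, where `Ψ(ρ)` is given by the quotient of the two series if
`Φ(ρ) < ∞`, and is the limit of `Ψ(t)` as `t ↑ ρ` if `Φ(ρ) = ∞`. -/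
def nu (w : ℕ → ℝ) : ℝ≥0∞ :=
  if Phi w (radius w) < ⊤ then Psi w (radius w)
  else limUnder (𝓝[<] (radius w)) (Psi w)

/-- The partition function `Z(m, n)`: the sum of the weights `∏ᵢ w_{yᵢ}` over all allocations
`y ∈ ℕⁿ` with `∑ᵢ yᵢ = m`. -/
def Z (w : ℕ → ℝ) (m n : ℕ) : ℝ :=
  ∑ y ∈ Finset.Nat.antidiagonalTuple n m, ∏ i, w (y i)

open Classical in
/-- The probability distribution proportional to `f`. (When `f` cannot be normalized, the
distribution is undefined in mathematics, and a point mass here.) -/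
def proportional {E : Type*} [Inhabited E] (f : E → ℝ≥0∞) : PMF E :=
  if h : (∑' x, f x) ≠ 0 ∧ (∑' x, f x) ≠ ⊤ then PMF.normalize f h.1 h.2 else PMF.pure default

/-- The law of the random allocation `B_{m,n} = (Y₁, …, Yₙ)` of `m` balls in `n` boxes:
`ℙ(B_{m,n} = y) = ∏ᵢ w_{yᵢ} / Z(m, n)` for `y ∈ ℕⁿ` with `∑ᵢ yᵢ = m`. -/
def allocation (w : ℕ → ℝ) (m n : ℕ) : Measure (Fin n → ℕ) :=
  (proportional fun y : Fin n → ℕ =>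
    if ∑ i, y i = m then ENNReal.ofReal (∏ i, w (y i)) else 0).toMeasure

instance (w : ℕ → ℝ) (m n : ℕ) : IsProbabilityMeasure (allocation w m n) :=
  PMF.toMeasure.isProbabilityMeasure _

/-- The canonical distribution `πₖ = wₖ ρᵏ / Φ(ρ)` on `ℕ`, in the phase `λ > ν`. -/
def canonical (w : ℕ → ℝ) : Measure ℕ :=
  (proportional fun k : ℕ => ENNReal.ofReal (w k) * radius w ^ k).toMeasure

instance (w : ℕ → ℝ) : IsProbabilityMeasure (canonical w) :=
  PMF.toMeasure.isProbabilityMeasure _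

/-- The `j`-th largest component `y_(j)` of `y ∈ ℕⁿ` (with multiplicity), `1 ≤ j ≤ n`. -/
def ordered {n : ℕ} (y : Fin n → ℕ) (j : ℕ) : ℕ :=
  if h : 1 ≤ j ∧ j ≤ n then y (Tuple.sort y (Fin.rev ⟨j - 1, by omega⟩)) else 0

/-- The vector `(y_(1), …, y_(n))`. -/
def orderedVector {n : ℕ} (y : Fin n → ℕ) : Fin n → ℤ :=
  fun i => (ordered y (i + 1) : ℤ)

/-- The vector `(m - ∑ᵢ xᵢ, x_(1), …, x_(n-1))` of length `n`, for `x ∈ ℕⁿ⁻¹`. -/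
def comparisonVector (m : ℕ) {n : ℕ} (x : Fin (n - 1) → ℕ) : Fin n → ℤ :=
  fun i => if (i : ℕ) = 0 then (m : ℤ) - ∑ l, (x l : ℤ) else (ordered x i : ℤ)

/-- `X = o_p(a)`: for random variables `Xₙ` defined on `(Eₙ, μₙ)`, `Xₙ / aₙ → 0` in
probability. -/
def IsLittleOp {E : ℕ → Type*} [∀ n, MeasurableSpace (E n)] (μ : ∀ n, Measure (E n))
    (X : ∀ n, E n → ℝ) (a : ℕ → ℝ) : Prop :=
  ∀ ε : ℝ, 0 < ε → Tendsto (fun n => μ n {y | ε ≤ |X n y / a n|}) atTop (𝓝 0)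

/-- `X = O_p(a)`: for random variables `Xₙ` defined on `(Eₙ, μₙ)`, the sequence `Xₙ / aₙ` is
stochastically bounded. -/
def IsBigOp {E : ℕ → Type*} [∀ n, MeasurableSpace (E n)] (μ : ∀ n, Measure (E n))
    (X : ∀ n, E n → ℝ) (a : ℕ → ℝ) : Prop :=
  ∀ ε : ℝ≥0∞, 0 < ε → ∃ K : ℝ, ∀ᶠ n in atTop, μ n {y | K < |X n y / a n|} ≤ ε

/-- Two sequences of laws are asymptotically equal: there are couplings `(X'ₙ, X''ₙ)` of `μₙ`
and `νₙ` such that `X'ₙ = X''ₙ` with probability tending to `1`. -/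
def ApproxEqualLaws {E : ℕ → Type*} [∀ n, MeasurableSpace (E n)]
    (μ ν : ∀ n, Measure (E n)) : Prop :=
  ∃ γ : ∀ n, Measure (E n × E n),
    (∀ n, (γ n).map Prod.fst = μ n ∧ (γ n).map Prod.snd = ν n) ∧
    Tendsto (fun n => γ n {p | p.1 = p.2}) atTop (𝓝 1)

/-- A (non-degenerate) `α`-stable law: if `X, X'` are independent with law `σ`, then for all
`a, b > 0` there is a real `d` such that `aX + bX'` has the same law as
`(a^α + b^α)^(1/α) X + d`. -/
def IsStableLaw (α : ℝ) (σ : Measure ℝ) : Prop :=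
  (∀ x : ℝ, σ ≠ Measure.dirac x) ∧
  ∀ a b : ℝ, 0 < a → 0 < b → ∃ d : ℝ,
    (σ.prod σ).map (fun p => a * p.1 + b * p.2) =
      σ.map (fun x => (a ^ α + b ^ α) ^ (1 / α) * x + d)

/-- The density of `W_j` (for `j ≥ 2`) with parameters `c'` and `α`. -/
def densityW (c' α : ℝ) (j : ℕ) (x : ℝ) : ℝ :=
  if 0 < x then
    c' * x ^ (-α - 1) * ((c' * α⁻¹ * x ^ (-α)) ^ (j - 2) / (Nat.factorial (j - 2) : ℝ)) *
      Real.exp (-(c' * α⁻¹ * x ^ (-α)))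
  else 0

end BallsInBoxes

end

/-!
Conditioning `n` independent variables with the canonical law `π` on their sum being `m` gives the
allocation `B_{m,n}`. Since `π` has the power-law tail `c' k^{-β}` and mean `ν < λ`, the cheapest
way for the sum to reach `m ≈ λ n` is a single big jump: truncating all variables at `δ n`, a
Chernoff bound with exponent of order `log n / n` shows that having no jump above `δ n` costs
`o(n^{1-β})`, whereas placing in one of the `n` boxes the difference between `m` and the sum of the
other `n - 1` variables has probability about `n π_{(λ-ν) n} ~ c' (λ-ν)^{-β} n^{1-β}`, and `Z` is
this probability times `Φ(1)^n`. The same computation, restricted to typical values of the other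
`n - 1` variables, shows that removing the big box leaves a sample from `π^{n-1}` up to an error
`o(1)` in total variation, which is the coupling. Through it, the largest component
inherits the stable limit of the sum (proved by convergence of Laplace transforms on the closed
half-plane) and the `j`-th one inherits the Poisson limit for exceedances of the `(j-1)`-th
largest of `n - 1` independent variables.
-/

namespace BallsInBoxes

section PowerTail

variable {E : Type*} [NormedAddCommGroup E]

theorem integrable_iff_summable_measureReal_singleton {Ω : Type*} [MeasurableSpace Ω] [Countable Ω]
    [MeasurableSingletonClass Ω] {P : Measure Ω} [IsFiniteMeasure P] {f : Ω → E} :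
    Integrable f P ↔ Summable fun k => P.real {k} * ‖f k‖ := by
  have hterm (k : Ω) : ‖f k‖ₑ * P {k} = ENNReal.ofReal (P.real {k} * ‖f k‖) := by
    rw [ENNReal.ofReal_mul measureReal_nonneg, ofReal_measureReal, ofReal_norm, mul_comm]
  have hnonneg (k : Ω) : 0 ≤ P.real {k} * ‖f k‖ := by positivity
  have hmeas : AEStronglyMeasurable f P := StronglyMeasurable.of_discrete.aestronglyMeasurable
  rw [Integrable, and_iff_right hmeas, hasFiniteIntegral_iff_enorm, lintegral_countable']
  simp_rw [hterm]
  exact ⟨fun h => (ENNReal.summable_toReal h.ne).congr fun k => ENNReal.toReal_ofReal (hnonneg k),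
    fun h => h.tsum_ofReal_lt_top⟩

theorem exists_forall_abs_le_mul_rpow {p : ℕ → ℝ} {c β : ℝ}
    (h : p ~[atTop] fun k : ℕ => c * (k : ℝ) ^ (-β)) :
    ∃ C : ℝ, 0 < C ∧ ∀ k : ℕ, 0 < k → |p k| ≤ C * (k : ℝ) ^ (-β) := by
  obtain ⟨C, hC, hle⟩ :=
    bound_of_isBigO_nat_atTop (h.isBigO.trans (isBigO_const_mul_self c _ _))
  refine ⟨C, hC, fun k hk => ?_⟩
  have hpow : 0 < (k : ℝ) ^ (-β) := Real.rpow_pos_of_pos (mod_cast hk) _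
  simpa only [Real.norm_eq_abs, abs_of_pos hpow] using hle hpow.ne'

theorem integrable_rpow {P : Measure ℕ} [IsFiniteMeasure P] {c β γ : ℝ}
    (h : (fun k => P.real {k}) ~[atTop] fun k : ℕ => c * (k : ℝ) ^ (-β)) (hγ : γ < β - 1) :
    Integrable (fun k : ℕ => (k : ℝ) ^ γ) P := by
  rw [integrable_iff_summable_measureReal_singleton]
  have hO : (fun k => P.real {k} * ‖(k : ℝ) ^ γ‖) =O[atTop] fun k : ℕ => (k : ℝ) ^ (γ - β) := by
    refine ((h.isBigO.trans (isBigO_const_mul_self c _ _)).mul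
      (isBigO_refl (fun k : ℕ => (k : ℝ) ^ γ) atTop).norm_left).congr' .rfl ?_
    filter_upwards [eventually_gt_atTop 0] with k hk
    rw [← Real.rpow_add (mod_cast hk), neg_add_eq_sub]
  exact summable_of_isBigO_nat (Real.summable_nat_rpow.2 (by linarith)) hO

theorem ceil_mul_eq_succ_iff {N : ℝ} (hN : 0 < N) (k : ℕ) (y : ℝ) :
    ⌈N * y⌉₊ = k + 1 ↔ y ∈ Set.Ioc (k / N) ((k + 1) / N) := by
  rw [Set.mem_Ioc, Nat.ceil_eq_iff k.succ_ne_zero, div_lt_iff₀ hN, le_div_iff₀ hN, mul_comm y N,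
    Nat.succ_sub_one, Nat.cast_succ]

theorem iUnion_Ioc_div_eq_Ioi {N : ℝ} (hN : 0 < N) :
    ⋃ k : ℕ, Set.Ioc (k / N) ((k + 1) / N) = Set.Ioi 0 := by
  ext y
  simp only [Set.mem_iUnion, ← ceil_mul_eq_succ_iff hN, Set.mem_Ioi]
  constructor
  · rintro ⟨k, hk⟩
    exact pos_of_mul_pos_right (Nat.ceil_pos.1 (hk ▸ k.succ_pos)) hN.le
  · intro hy
    have : 0 < ⌈N * y⌉₊ := Nat.ceil_pos.2 (by positivity)
    exact ⟨⌈N * y⌉₊ - 1, by lia⟩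

theorem hasSum_integral_ceil [NormedSpace ℝ E] [CompleteSpace E] {N : ℝ} (hN : 0 < N) {F : ℕ → E}
    (hF0 : F 0 = 0) (hF : IntegrableOn (fun y => F ⌈N * y⌉₊) (Set.Ioi 0)) :
    HasSum F (N • ∫ y in Set.Ioi 0, F ⌈N * y⌉₊) := by
  have hdisj : Pairwise (Function.onFun Disjoint fun k : ℕ => Set.Ioc (k / N) ((k + 1) / N)) := by
    refine fun i j hij => Set.disjoint_left.2 fun y hi hj => hij ?_
    rw [← ceil_mul_eq_succ_iff hN] at hi hj
    lia
  have hpiece (k : ℕ) :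
      ∫ y in Set.Ioc (k / N) ((k + 1) / N), F ⌈N * y⌉₊ = N⁻¹ • F (k + 1) := by
    have hconst : Set.EqOn (fun y => F ⌈N * y⌉₊) (fun _ => F (k + 1))
        (Set.Ioc (k / N) ((k + 1) / N)) := fun y hy => by
      simp only [(ceil_mul_eq_succ_iff hN k y).2 hy]
    have hlen : (k + 1) / N - k / N = N⁻¹ := by ring
    rw [setIntegral_congr_fun measurableSet_Ioc hconst, setIntegral_const, measureReal_def,
      Real.volume_Ioc, hlen, ENNReal.toReal_ofReal (inv_nonneg.2 hN.le)]
  have hsum := hasSum_integral_iUnion (fun k => measurableSet_Ioc) hdisj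
    (iUnion_Ioc_div_eq_Ioi hN ▸ hF)
  simp_rw [iUnion_Ioc_div_eq_Ioi hN, hpiece] at hsum
  have hshift := hsum.const_smul N
  simp_rw [smul_smul, mul_inv_cancel₀ hN.ne', one_smul] at hshift
  simpa only [Finset.range_one, Finset.sum_singleton, hF0, add_zero] using
    (hasSum_nat_add_iff (f := F) 1).1 hshift

theorem tendsto_ceil_mul_div {y : ℝ} (hy : 0 ≤ y) :
    Tendsto (fun N : ℝ => (⌈N * y⌉₊ : ℝ) / N) atTop (𝓝 y) := by
  simpa only [mul_comm] using tendsto_nat_ceil_mul_div_atTop hy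

theorem tendsto_rpow_mul_ceil {p : ℕ → ℝ} {c β y : ℝ} (hy : 0 < y)
    (h : p ~[atTop] fun k : ℕ => c * (k : ℝ) ^ (-β)) :
    Tendsto (fun N : ℝ => N ^ β * p ⌈N * y⌉₊) atTop (𝓝 (c * y ^ (-β))) := by
  have hceil : Tendsto (fun N : ℝ => ⌈N * y⌉₊) atTop atTop :=
    tendsto_nat_ceil_atTop.comp (tendsto_id.atTop_mul_const hy)
  have hequiv : (fun N : ℝ => N ^ β * p ⌈N * y⌉₊) ~[atTop]
      fun N => N ^ β * (c * (⌈N * y⌉₊ : ℝ) ^ (-β)) := IsEquivalent.refl.mul (h.comp_tendsto hceil)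
  refine hequiv.symm.tendsto_nhds ?_
  refine (((tendsto_ceil_mul_div hy.le).rpow_const (Or.inl hy.ne')).const_mul c).congr' ?_
  filter_upwards [eventually_gt_atTop 0] with N hN
  rw [Real.div_rpow (by positivity) hN.le, Real.rpow_neg hN.le]
  field_simp

section RiemannSum

variable [NormedSpace ℝ E] {P : Measure ℕ} {c C β : ℝ} {g : ℝ → E} {D : ℝ → ℝ}

theorem norm_measureReal_ceil_smul_le (hC : 0 ≤ C)
    (hP : ∀ k : ℕ, 0 < k → P.real {k} ≤ C * (k : ℝ) ^ (-β)) (hD : AntitoneOn D (Set.Ioi 0))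
    (hgD : ∀ y, 0 < y → y ^ (-β) * ‖g y‖ ≤ D y) {N y : ℝ} (hN : 0 < N) (hy : 0 < y) :
    ‖N ^ β • P.real {⌈N * y⌉₊} • g (⌈N * y⌉₊ / N)‖ ≤ C * D y := by
  set z : ℝ := ⌈N * y⌉₊ / N with hz
  have hyz : y ≤ z := by rw [hz, le_div_iff₀ hN, mul_comm]; exact Nat.le_ceil _
  have hz0 : 0 < z := hy.trans_le hyz
  have hceil : (⌈N * y⌉₊ : ℝ) = N * z := by rw [hz]; field_simp
  have hle := hP _ (Nat.ceil_pos.2 (mul_pos hN hy))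
  rw [hceil, Real.mul_rpow hN.le hz0.le] at hle
  rw [norm_smul, norm_smul, Real.norm_of_nonneg measureReal_nonneg,
    Real.norm_of_nonneg (Real.rpow_nonneg hN.le β)]
  calc N ^ β * (P.real {⌈N * y⌉₊} * ‖g z‖)
      ≤ N ^ β * (C * (N ^ (-β) * z ^ (-β)) * ‖g z‖) := by gcongr
    _ = N ^ β * N ^ (-β) * (C * (z ^ (-β) * ‖g z‖)) := by ring
    _ = C * (z ^ (-β) * ‖g z‖) := by
        rw [← Real.rpow_add hN, add_neg_cancel, Real.rpow_zero, one_mul]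
    _ ≤ C * D y := mul_le_mul_of_nonneg_left ((hgD z hz0).trans (hD hy hz0 hyz)) hC

theorem aestronglyMeasurable_measureReal_ceil_smul (N : ℝ) (μ : Measure ℝ) :
    AEStronglyMeasurable (fun y => N ^ β • P.real {⌈N * y⌉₊} • g (⌈N * y⌉₊ / N)) μ := by
  have hmeas : StronglyMeasurable fun k : ℕ => P.real {k} • g (k / N) :=
    StronglyMeasurable.of_discrete
  exact ((hmeas.comp_measurable (g := fun y : ℝ => ⌈N * y⌉₊) (by fun_prop)).const_smul
    _).aestronglyMeasurable

theorem integral_div_eq_setIntegral_ceil [CompleteSpace E] [IsFiniteMeasure P] (hg0 : g 0 = 0)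
    {N : ℝ} (hN : 0 < N)
    (hint : IntegrableOn (fun y => N ^ β • P.real {⌈N * y⌉₊} • g (⌈N * y⌉₊ / N)) (Set.Ioi 0)) :
    N ^ (β - 1) • ∫ k : ℕ, g (k / N) ∂P =
      ∫ y in Set.Ioi 0, N ^ β • P.real {⌈N * y⌉₊} • g (⌈N * y⌉₊ / N) := by
  have hNβ : N ^ β ≠ 0 := (Real.rpow_pos_of_pos hN _).ne'
  have hint' : IntegrableOn (fun y => P.real {⌈N * y⌉₊} • g (⌈N * y⌉₊ / N)) (Set.Ioi 0) := by
    refine (hint.smul (N ^ β)⁻¹).congr (ae_of_all _ fun y => ?_)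
    simp only [Pi.smul_apply, smul_smul, inv_mul_cancel_left₀ hNβ]
  have hzero : P.real {0} • g ((0 : ℕ) / N) = 0 := by rw [Nat.cast_zero, zero_div, hg0, smul_zero]
  have hsum := hasSum_integral_ceil hN (F := fun k => P.real {k} • g (k / N)) hzero hint'
  have hnorm := hasSum_integral_ceil hN (F := fun k => ‖P.real {k} • g (k / N)‖)
    (by rw [hzero, norm_zero]) hint'.norm
  have hgint : Integrable (fun k : ℕ => g (k / N)) P := by
    rw [integrable_iff_summable_measureReal_singleton]
    refine hnorm.summable.congr fun k => ?_
    rw [norm_smul, Real.norm_of_nonneg measureReal_nonneg]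
  rw [integral_countable hgint, hsum.tsum_eq, smul_smul, Real.rpow_sub_one hN.ne',
    div_mul_cancel₀ _ hN.ne', ← integral_smul]

/-- The sum is rewritten as an integral over `y` with `k = ⌈N y⌉`; monotonicity of `D` makes
`C D` a dominating function, as `⌈N y⌉ / N` lies to the right of `y`. -/
theorem tendsto_rpow_smul_integral_div [CompleteSpace E] [IsFiniteMeasure P]
    (h : (fun k => P.real {k}) ~[atTop] fun k : ℕ => c * (k : ℝ) ^ (-β)) (hg0 : g 0 = 0)
    (hD : AntitoneOn D (Set.Ioi 0)) (hDint : IntegrableOn D (Set.Ioi 0))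
    (hgD : ∀ y, 0 < y → y ^ (-β) * ‖g y‖ ≤ D y)
    (hcont : ∀ᵐ y ∂volume.restrict (Set.Ioi 0), ContinuousAt g y) :
    Tendsto (fun N : ℝ => N ^ (β - 1) • ∫ k : ℕ, g (k / N) ∂P) atTop
      (𝓝 (∫ y in Set.Ioi 0, (c * y ^ (-β)) • g y)) := by
  obtain ⟨C, hC, hPabs⟩ := exists_forall_abs_le_mul_rpow h
  have hP (k : ℕ) (hk : 0 < k) : P.real {k} ≤ C * (k : ℝ) ^ (-β) :=
    (le_abs_self _).trans (hPabs k hk)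
  have hdom (N : ℝ) (hN : 0 < N) : ∀ᵐ y ∂volume.restrict (Set.Ioi 0),
      ‖N ^ β • P.real {⌈N * y⌉₊} • g (⌈N * y⌉₊ / N)‖ ≤ C * D y :=
    (ae_restrict_iff' measurableSet_Ioi).2
      (ae_of_all _ fun y hy => norm_measureReal_ceil_smul_le hC.le hP hD hgD hN hy)
  have hlim : Tendsto
      (fun N : ℝ => ∫ y in Set.Ioi 0, N ^ β • P.real {⌈N * y⌉₊} • g (⌈N * y⌉₊ / N)) atTop
      (𝓝 (∫ y in Set.Ioi 0, (c * y ^ (-β)) • g y)) := by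
    refine tendsto_integral_filter_of_dominated_convergence (fun y => C * D y)
      (Eventually.of_forall fun N => aestronglyMeasurable_measureReal_ceil_smul N _) ?_
      (hDint.const_mul C) ?_
    · filter_upwards [eventually_gt_atTop 0] with N hN using hdom N hN
    · filter_upwards [hcont, self_mem_ae_restrict measurableSet_Ioi] with y hgy hy
      simpa only [smul_smul, Function.comp_def] using (tendsto_rpow_mul_ceil hy h).smul
        (hgy.tendsto.comp (tendsto_ceil_mul_div (le_of_lt hy)))
  refine hlim.congr' ?_
  filter_upwards [eventually_gt_atTop 0] with N hN
  exact (integral_div_eq_setIntegral_ceil hg0 hN ((hDint.const_mul C).mono'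
    (aestronglyMeasurable_measureReal_ceil_smul N _) (hdom N hN))).symm

theorem tendsto_natCast_smul_integral_rpow_mul [CompleteSpace E] [IsFiniteMeasure P] (hβ : 1 < β)
    (h : (fun k => P.real {k}) ~[atTop] fun k : ℕ => c * (k : ℝ) ^ (-β)) (hg0 : g 0 = 0)
    (hD : AntitoneOn D (Set.Ioi 0)) (hDint : IntegrableOn D (Set.Ioi 0))
    (hgD : ∀ y, 0 < y → y ^ (-β) * ‖g y‖ ≤ D y)
    (hcont : ∀ᵐ y ∂volume.restrict (Set.Ioi 0), ContinuousAt g y) :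
    Tendsto (fun n : ℕ => (n : ℝ) • ∫ k, g ((n : ℝ) ^ (-(1 / (β - 1))) * k) ∂P) atTop
      (𝓝 (∫ y in Set.Ioi 0, (c * y ^ (-β)) • g y)) := by
  have hscale : Tendsto (fun n : ℕ => (n : ℝ) ^ (1 / (β - 1))) atTop atTop :=
    (tendsto_rpow_atTop (one_div_pos.2 (sub_pos.2 hβ))).comp tendsto_natCast_atTop_atTop
  refine ((tendsto_rpow_smul_integral_div h hg0 hD hDint hgD hcont).comp hscale).congr fun n => ?_
  have hn : (0 : ℝ) ≤ n := n.cast_nonneg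
  have hpow : ((n : ℝ) ^ (1 / (β - 1))) ^ (β - 1) = n := by
    rw [← Real.rpow_mul hn, one_div_mul_cancel (sub_pos.2 hβ).ne', Real.rpow_one]
  rw [Function.comp_apply, hpow, Real.rpow_neg hn]
  simp_rw [inv_mul_eq_div]

end RiemannSum

theorem integrableOn_Ioi_min_rpow {a b : ℝ} (ha : -1 < a) (hb : b < -1) :
    IntegrableOn (fun y : ℝ => min (y ^ a) (y ^ b)) (Set.Ioi 0) := by
  have hmeas (s : Set ℝ) : AEStronglyMeasurable (fun y : ℝ => min (y ^ a) (y ^ b))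
      (volume.restrict s) := Measurable.aestronglyMeasurable (by fun_prop)
  have hnorm (y : ℝ) (hy : 0 < y) : ‖min (y ^ a) (y ^ b)‖ = min (y ^ a) (y ^ b) :=
    Real.norm_of_nonneg (le_min (Real.rpow_nonneg hy.le a) (Real.rpow_nonneg hy.le b))
  rw [← Set.Ioc_union_Ioi_eq_Ioi zero_le_one]
  refine IntegrableOn.union ?_ ?_
  · refine Integrable.mono' ((intervalIntegrable_iff_integrableOn_Ioc_of_le zero_le_one).1
      (intervalIntegral.intervalIntegrable_rpow' ha)) (hmeas _) ?_
    filter_upwards [self_mem_ae_restrict measurableSet_Ioc] with y hy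
    exact (hnorm y hy.1).trans_le (min_le_left _ _)
  · refine Integrable.mono' (integrableOn_Ioi_rpow_of_lt hb one_pos) (hmeas _) ?_
    filter_upwards [self_mem_ae_restrict measurableSet_Ioi] with y hy
    exact (hnorm y (one_pos.trans hy)).trans_le (min_le_right _ _)

theorem antitoneOn_Ioi_min_rpow {a b : ℝ} (ha : a ≤ 0) (hb : b ≤ 0) :
    AntitoneOn (fun y : ℝ => min (y ^ a) (y ^ b)) (Set.Ioi 0) := fun _ hx _ _ hxy =>
  min_le_min (Real.rpow_le_rpow_of_nonpos hx hxy ha) (Real.rpow_le_rpow_of_nonpos hx hxy hb)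

theorem ae_continuousAt_indicator_Ioi (a : ℝ) :
    ∀ᵐ y : ℝ, ContinuousAt ((Set.Ioi a).indicator fun _ => (1 : ℝ)) y := by
  filter_upwards [compl_mem_ae_iff.2 (measure_singleton (μ := volume) a)] with y hy
  rcases lt_or_gt_of_ne hy with hlt | hgt
  · refine (continuousAt_const (y := (0 : ℝ))).congr ?_
    filter_upwards [Iio_mem_nhds hlt] with z hz
    exact (Set.indicator_of_notMem (fun h => lt_asymm hz (Set.mem_Ioi.1 h)) _).symm
  · refine (continuousAt_const (y := (1 : ℝ))).congr ?_
    filter_upwards [Ioi_mem_nhds hgt] with z hz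
    exact (Set.indicator_of_mem hz fun _ => (1 : ℝ)).symm

theorem setIntegral_mul_rpow_smul_indicator_Ioi_one (c : ℝ) {β : ℝ} (hβ : 1 < β) :
    ∫ y in Set.Ioi 0, (c * y ^ (-β)) • (Set.Ioi 1).indicator (fun _ => (1 : ℝ)) y =
      c / (β - 1) := by
  have hind (y : ℝ) : (c * y ^ (-β)) • (Set.Ioi 1).indicator (fun _ => (1 : ℝ)) y =
      (Set.Ioi 1).indicator (fun y => c * y ^ (-β)) y := by
    by_cases hy : y ∈ Set.Ioi 1 <;> simp [hy]
  simp_rw [hind]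
  rw [setIntegral_indicator measurableSet_Ioi, Set.Ioi_inter_Ioi, max_eq_right zero_le_one,
    integral_const_mul, integral_Ioi_rpow_of_lt (by linarith) one_pos, Real.one_rpow,
    ← neg_div_neg_eq (-1), neg_neg, neg_add, neg_neg, ← sub_eq_add_neg, mul_one_div]

theorem tendsto_rpow_mul_measureReal_tail {P : Measure ℕ} [IsFiniteMeasure P] {c β : ℝ}
    (hβ : 1 < β) (h : (fun k => P.real {k}) ~[atTop] fun k : ℕ => c * (k : ℝ) ^ (-β)) :
    Tendsto (fun N : ℝ => N ^ (β - 1) * P.real {k : ℕ | N < k}) atTop (𝓝 (c / (β - 1))) := by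
  have hdom (y : ℝ) (hy : 0 < y) :
      y ^ (-β) * ‖(Set.Ioi 1).indicator (fun _ => (1 : ℝ)) y‖ ≤ min (y ^ (0 : ℝ)) (y ^ (-β)) := by
    by_cases hy1 : y ∈ Set.Ioi 1
    · rw [Set.indicator_of_mem hy1, norm_one, mul_one]
      exact le_min (Real.rpow_le_rpow_of_exponent_le (le_of_lt hy1) (by linarith)) le_rfl
    · rw [Set.indicator_of_notMem hy1, norm_zero, mul_zero]
      exact le_min (Real.rpow_nonneg hy.le _) (Real.rpow_nonneg hy.le _)
  have hlim := tendsto_rpow_smul_integral_div h (g := (Set.Ioi 1).indicator fun _ => (1 : ℝ))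
    (by simp) (antitoneOn_Ioi_min_rpow le_rfl (by linarith))
    (integrableOn_Ioi_min_rpow (by norm_num) (by linarith)) hdom
    (ae_restrict_of_ae (ae_continuousAt_indicator_Ioi 1))
  rw [setIntegral_mul_rpow_smul_indicator_Ioi_one c hβ] at hlim
  refine hlim.congr' ?_
  filter_upwards [eventually_gt_atTop 0] with N hN
  have hind : (fun k : ℕ => (Set.Ioi 1).indicator (fun _ => (1 : ℝ)) (k / N)) =
      {k : ℕ | N < k}.indicator 1 := by
    ext k
    simp [Set.indicator_apply, one_lt_div hN]
  rw [hind, integral_indicator_one MeasurableSet.of_discrete, smul_eq_mul]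

theorem tendsto_natCast_mul_measureReal_tail {P : Measure ℕ} [IsFiniteMeasure P] {c β : ℝ}
    (hβ : 1 < β) (h : (fun k => P.real {k}) ~[atTop] fun k : ℕ => c * (k : ℝ) ^ (-β)) {x : ℝ}
    (hx : 0 < x) :
    Tendsto (fun n : ℕ => (n : ℝ) * P.real {k | (n : ℝ) ^ (1 / (β - 1)) * x < (k : ℝ)}) atTop
      (𝓝 (c / (β - 1) * x ^ (-(β - 1)))) := by
  have hα : 0 < β - 1 := sub_pos.2 hβ
  have hscale : Tendsto (fun n : ℕ => (n : ℝ) ^ (1 / (β - 1)) * x) atTop atTop :=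
    ((tendsto_rpow_atTop (one_div_pos.2 hα)).comp tendsto_natCast_atTop_atTop).atTop_mul_const hx
  refine (((tendsto_rpow_mul_measureReal_tail hβ h).comp hscale).mul_const _).congr fun n => ?_
  have hpow : ((n : ℝ) ^ (1 / (β - 1)) * x) ^ (β - 1) * x ^ (-(β - 1)) = n := by
    rw [Real.mul_rpow (by positivity) hx.le, ← Real.rpow_mul n.cast_nonneg,
      one_div_mul_cancel hα.ne', Real.rpow_one, mul_assoc, ← Real.rpow_add hx, add_neg_cancel,
      Real.rpow_zero, mul_one]
  rw [Function.comp_apply, mul_right_comm, hpow]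

end PowerTail

section OrderStatistics

theorem le_ordered_iff {n : ℕ} (y : Fin n → ℕ) {j : ℕ} (hj : 1 ≤ j) (hjn : j ≤ n) (t : ℕ) :
    t ≤ ordered y j ↔ j ≤ (Finset.univ.filter fun i => t ≤ y i).card := by
  have hanti : Antitone fun i : Fin n => y (Tuple.sort y (Fin.rev i)) := fun a b hab =>
    Tuple.monotone_sort y (Fin.rev_le_rev.2 hab)
  have hsorted :=
    Tuple.lt_card_ge_iff_apply_ge_of_antitone (a := t) (j := ⟨j - 1, by lia⟩) hanti
  have hcard : (Finset.univ.filter fun i : Fin n => t ≤ y (Tuple.sort y (Fin.rev i))).card =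
      (Finset.univ.filter fun i => t ≤ y i).card :=
    Finset.card_equiv (Fin.revPerm.trans (Tuple.sort y)) (by simp)
  rw [ordered, dif_pos ⟨hj, hjn⟩, ← hsorted, hcard]
  lia

section Binomial

theorem setOf_forall_mem_iff_eq_pi {ι Ω : Type*} [DecidableEq ι] (A : Set Ω) (s : Finset ι) :
    {x : ι → Ω | ∀ i, x i ∈ A ↔ i ∈ s} = Set.univ.pi fun i => if i ∈ s then A else Aᶜ := by
  ext x
  simp only [Set.mem_ofPred_eq, Set.mem_univ_pi]
  refine forall_congr' fun i => ?_
  by_cases hi : i ∈ s <;> simp [hi]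

variable {ι Ω : Type*} [Fintype ι] [MeasurableSpace Ω] (P : Measure Ω) [IsProbabilityMeasure P]
  {A : Set Ω}

theorem measureReal_pi_forall_mem_iff (hA : MeasurableSet A) (s : Finset ι) :
    (Measure.pi fun _ : ι => P).real {x | ∀ i, x i ∈ A ↔ i ∈ s} =
      P.real A ^ s.card * (1 - P.real A) ^ (Fintype.card ι - s.card) := by
  classical
  have hfactor (i : ι) : (P (if i ∈ s then A else Aᶜ)).toReal =
      if i ∈ s then P.real A else 1 - P.real A := by
    split_ifs
    · rfl
    · exact probReal_compl_eq_one_sub hA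
  rw [setOf_forall_mem_iff_eq_pi, measureReal_def, Measure.pi_pi, ENNReal.toReal_prod,
    Finset.prod_congr rfl fun i _ => hfactor i, Finset.prod_ite, Finset.prod_const,
    Finset.prod_const, Finset.filter_univ_mem, Finset.filter_not, Finset.filter_univ_mem,
    Finset.card_univ_sdiff]

variable [DecidablePred (· ∈ A)]

theorem measureReal_pi_card_filter_mem_eq (hA : MeasurableSet A) (k : ℕ) :
    (Measure.pi fun _ : ι => P).real {x | (Finset.univ.filter fun i => x i ∈ A).card = k} =
      (Fintype.card ι).choose k * P.real A ^ k * (1 - P.real A) ^ (Fintype.card ι - k) := by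
  classical
  have hset : {x : ι → Ω | (Finset.univ.filter fun i => x i ∈ A).card = k} =
      ⋃ s ∈ Finset.powersetCard k (Finset.univ : Finset ι), {x | ∀ i, x i ∈ A ↔ i ∈ s} := by
    ext x
    simp only [Set.mem_ofPred_eq, Set.mem_iUnion, Finset.mem_powersetCard_univ, exists_prop]
    constructor
    · exact fun h => ⟨Finset.univ.filter fun i => x i ∈ A, h, by simp⟩
    · rintro ⟨s, rfl, hs⟩
      simp [hs]
  have hmeas (s : Finset ι) : MeasurableSet {x : ι → Ω | ∀ i, x i ∈ A ↔ i ∈ s} := by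
    rw [setOf_forall_mem_iff_eq_pi]
    exact MeasurableSet.univ_pi fun i => by split_ifs; exacts [hA, hA.compl]
  rw [hset, measureReal_biUnion_finset _ fun s _ => hmeas s]
  · rw [Finset.sum_congr rfl fun s hs => by
      rw [measureReal_pi_forall_mem_iff P hA s, (Finset.mem_powersetCard.1 hs).2],
      Finset.sum_const, Finset.card_powersetCard, Finset.card_univ, nsmul_eq_mul, mul_assoc]
  · refine fun s _ s' _ hss => Set.disjoint_left.2 fun x hx hx' => hss ?_
    ext i
    rw [← hx i, hx' i]

theorem measurable_card_filter_mem (hA : MeasurableSet A) :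
    Measurable fun x : ι → Ω => (Finset.univ.filter fun i => x i ∈ A).card := by
  simp_rw [Finset.card_filter]
  exact Finset.measurable_sum _ fun i _ =>
    Measurable.ite (measurable_pi_apply i hA) measurable_const measurable_const

theorem measureReal_pi_card_filter_mem_lt (hA : MeasurableSet A) (k : ℕ) :
    (Measure.pi fun _ : ι => P).real {x | (Finset.univ.filter fun i => x i ∈ A).card < k} =
      ∑ j ∈ Finset.range k,
        (Fintype.card ι).choose j * P.real A ^ j * (1 - P.real A) ^ (Fintype.card ι - j) := by
  have hset : {x : ι → Ω | (Finset.univ.filter fun i => x i ∈ A).card < k} =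
      ⋃ j ∈ Finset.range k, {x | (Finset.univ.filter fun i => x i ∈ A).card = j} := by
    ext x
    simp
  rw [hset, measureReal_biUnion_finset]
  · exact Finset.sum_congr rfl fun j _ => measureReal_pi_card_filter_mem_eq P hA j
  · exact fun i _ j _ hij => Set.disjoint_left.2 fun x hx hx' => hij (hx.symm.trans hx')
  · exact fun j _ => measurable_card_filter_mem hA (measurableSet_singleton j)

end Binomial

theorem ordered_le_iff {n : ℕ} (y : Fin n → ℕ) {j : ℕ} (hj : 1 ≤ j) (hjn : j ≤ n) {t : ℝ}
    (ht : 0 ≤ t) : (ordered y j : ℝ) ≤ t ↔ (Finset.univ.filter fun i => t < y i).card < j := by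
  simp_rw [← not_lt, ← Nat.floor_lt ht, ← Nat.succ_le_iff (m := ⌊t⌋₊), le_ordered_iff y hj hjn,
    not_le]

/-- `ℙ(Poisson(τ) < k)` with `τ = (c / α) x^{-α}`: the limiting distribution function of the
`k`-th largest of `n` variables with tail `ℙ(ξ > x) ~ (c / α) x^{-α}`, on the scale `n^{1/α}`. -/
noncomputable def limitCdf (c α : ℝ) (k : ℕ) (x : ℝ) : ℝ :=
  ∑ i ∈ Finset.range k,
    Real.exp (-(c / α * x ^ (-α))) * (c / α * x ^ (-α)) ^ i / (i.factorial : ℝ)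

theorem tendsto_natCast_mul_succ {q : ℕ → ℝ} {τ : ℝ}
    (h : Tendsto (fun n : ℕ => (n : ℝ) * q n) atTop (𝓝 τ)) :
    Tendsto (fun n : ℕ => (n : ℝ) * q (n + 1)) atTop (𝓝 τ) := by
  have hshift := (h.sub (tendsto_zero_of_tendsto_mul_atTop h)).comp (tendsto_add_atTop_nat 1)
  rw [sub_zero] at hshift
  refine hshift.congr fun n => ?_
  simp only [Function.comp_apply, Nat.cast_add_one]
  ring

theorem tendsto_measureReal_ordered_le {P : Measure ℕ} [IsProbabilityMeasure P] {c β : ℝ}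
    (hβ : 1 < β) (h : (fun k => P.real {k}) ~[atTop] fun k : ℕ => c * (k : ℝ) ^ (-β))
    {k : ℕ} (hk : 1 ≤ k) {x : ℝ} (hx : 0 < x) :
    Tendsto (fun n : ℕ => (Measure.pi fun _ : Fin (n - 1) => P).real
      {v | (n : ℝ) ^ (-(1 / (β - 1))) * (ordered v k : ℝ) ≤ x}) atTop
      (𝓝 (limitCdf c (β - 1) k x)) := by
  classical
  set A : ℕ → Set ℕ := fun n => {l | (n : ℝ) ^ (1 / (β - 1)) * x < l}
  have hbinomial : Tendsto (fun n : ℕ => ∑ i ∈ Finset.range k,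
      (n.choose i : ℝ) * P.real (A (n + 1)) ^ i * (1 - P.real (A (n + 1))) ^ (n - i)) atTop
      (𝓝 (limitCdf c (β - 1) k x)) :=
    tendsto_finsetSum _ fun i _ => tendsto_choose_mul_pow_of_tendsto_mul_atTop i
      (tendsto_natCast_mul_succ (tendsto_natCast_mul_measureReal_tail hβ h hx))
  rw [← tendsto_add_atTop_iff_nat 1]
  refine hbinomial.congr' ?_
  filter_upwards [eventually_ge_atTop k] with n hn
  have hset : {v : Fin n → ℕ | ((n + 1 : ℕ) : ℝ) ^ (-(1 / (β - 1))) * (ordered v k : ℝ) ≤ x} =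
      {v | (Finset.univ.filter fun i => v i ∈ A (n + 1)).card < k} := by
    ext v
    rw [Set.mem_ofPred_eq, Real.rpow_neg (by positivity), inv_mul_le_iff₀ (by positivity),
      ordered_le_iff v hk hn (by positivity)]
    simp only [Set.mem_ofPred_eq, A]
  have hprob := measureReal_pi_card_filter_mem_lt (ι := Fin n) P (A := A (n + 1))
    MeasurableSet.of_discrete k
  rw [Fintype.card_fin] at hprob
  rw [← hprob, ← hset, Nat.add_sub_cancel]

end OrderStatistics

section LawOfLargeNumbers

variable {Ω : Type*} [MeasurableSpace Ω] {P : Measure Ω} {f : Ω → ℝ}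

theorem tendsto_natCast_mul_measureReal_le [IsFiniteMeasure P] (hfm : Measurable f)
    (hf : Integrable f P) {δ : ℝ} (hδ : 0 < δ) :
    Tendsto (fun n : ℕ => n * P.real {ω | δ * n ≤ f ω}) atTop (𝓝 0) := by
  have hmeas (n : ℕ) : MeasurableSet {ω | δ * n ≤ f ω} := measurableSet_le measurable_const hfm
  have hlim : Tendsto (fun n : ℕ => ∫ ω, {ω | δ * n ≤ f ω}.indicator (fun _ => (n : ℝ)) ω ∂P)
      atTop (𝓝 (∫ _, 0 ∂P)) := by
    refine tendsto_integral_of_dominated_convergence (fun ω => |f ω| / δ)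
      (fun n => (measurable_const.indicator (hmeas n)).aestronglyMeasurable)
      (hf.abs.div_const δ) (fun n => ae_of_all _ fun ω => ?_) (ae_of_all _ fun ω => ?_)
    · by_cases hω : δ * n ≤ f ω
      · rw [Set.indicator_of_mem (s := {ω | δ * n ≤ f ω}) hω, Real.norm_natCast, le_div_iff₀' hδ]
        exact hω.trans (le_abs_self _)
      · rw [Set.indicator_of_notMem (s := {ω | δ * n ≤ f ω}) hω, norm_zero]
        positivity
    · refine tendsto_const_nhds.congr' ?_
      filter_upwards [(tendsto_natCast_atTop_atTop.const_mul_atTop hδ).eventually_gt_atTop (f ω)]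
        with n hn
      exact (Set.indicator_of_notMem (s := {ω | δ * n ≤ f ω}) hn.not_ge _).symm
  rw [integral_zero] at hlim
  refine hlim.congr fun n => ?_
  rw [integral_indicator_const _ (hmeas n), smul_eq_mul, mul_comm]

theorem measureReal_pi_exists_mem_le {ι : Type*} [Fintype ι] [IsProbabilityMeasure P] {A : Set Ω}
    (hA : MeasurableSet A) :
    (Measure.pi fun _ : ι => P).real {x | ∃ i, x i ∈ A} ≤ Fintype.card ι * P.real A := by
  have hset : {x : ι → Ω | ∃ i, x i ∈ A} = ⋃ i ∈ Finset.univ, Function.eval i ⁻¹' A := by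
    ext x
    simp
  refine hset ▸ (measureReal_biUnion_finset_le _ _).trans_eq ?_
  rw [Finset.sum_congr rfl fun i _ => (measurePreserving_eval (fun _ : ι => P)
    i).measureReal_preimage hA.nullMeasurableSet, Finset.sum_const, Finset.card_univ, nsmul_eq_mul]

theorem map_infinitePi_prefix (P : Measure Ω) [IsProbabilityMeasure P] (n : ℕ) :
    (Measure.infinitePi fun _ : ℕ => P).map (fun ω (i : Fin n) => ω i) =
      Measure.pi fun _ : Fin n => P := by
  rw [Measure.map_infinitePi_infinitePi_of_inj (P := fun _ : ℕ => P)
    (f := fun i : Fin n => (i : ℕ)) Fin.val_injective, Measure.infinitePi_eq_pi]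

theorem ae_tendsto_sum_div_infinitePi [IsProbabilityMeasure P] (hfm : Measurable f)
    (hf : Integrable f P) :
    ∀ᵐ ω ∂Measure.infinitePi fun _ : ℕ => P,
      Tendsto (fun n : ℕ => (∑ i ∈ Finset.range n, f (ω i)) / n) atTop (𝓝 (∫ x, f x ∂P)) := by
  have heval (i : ℕ) : MeasurePreserving (Function.eval i) (Measure.infinitePi fun _ : ℕ => P) P :=
    measurePreserving_eval_infinitePi _ i
  have hident (i : ℕ) : IdentDistrib (fun ω : ℕ → Ω => f (ω i)) f
      (Measure.infinitePi fun _ : ℕ => P) P :=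
    ⟨(hfm.comp (measurable_pi_apply i)).aemeasurable, hfm.aemeasurable, by
      conv_rhs => rw [← (heval i).map_eq, Measure.map_map hfm (heval i).measurable]
      rfl⟩
  have hindep : iIndepFun (fun i (ω : ℕ → Ω) => f (ω i)) (Measure.infinitePi fun _ : ℕ => P) :=
    iIndepFun_infinitePi (X := fun _ => f) fun _ => hfm
  have hlaw := strong_law_ae_real (fun i (ω : ℕ → Ω) => f (ω i))
    ((heval 0).integrable_comp_of_integrable hf) (fun i j hij => hindep.indepFun hij)
    fun i => (hident i).trans (hident 0).symm
  rwa [(hident 0).integral_eq] at hlaw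

theorem tendsto_measureReal_pi_sum_deviation [IsProbabilityMeasure P] (hfm : Measurable f)
    (hf : Integrable f P) {δ : ℝ} (hδ : 0 < δ) :
    Tendsto (fun n : ℕ => (Measure.pi fun _ : Fin n => P).real
      {x | δ * n ≤ |∑ i, f (x i) - (∫ ω, f ω ∂P) * n|}) atTop (𝓝 0) := by
  have hmeasure := tendstoInMeasure_of_tendsto_ae
    (fun n => Measurable.aestronglyMeasurable (by fun_prop)) (ae_tendsto_sum_div_infinitePi hfm hf)
    (ENNReal.ofReal δ) (ENNReal.ofReal_pos.2 hδ)
  have hreal := (ENNReal.tendsto_toReal ENNReal.zero_ne_top).comp hmeasure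
  rw [ENNReal.toReal_zero] at hreal
  refine hreal.congr' ?_
  filter_upwards [eventually_gt_atTop 0] with n hn
  have hn0 : (0 : ℝ) < n := mod_cast hn
  rw [Function.comp_apply, measureReal_def, ← map_infinitePi_prefix,
    Measure.map_apply (by fun_prop) (measurableSet_le (by fun_prop) (by fun_prop))]
  congr 2
  ext ω
  rw [Set.mem_ofPred_eq, Set.mem_preimage, Set.mem_ofPred_eq, edist_dist,
    ENNReal.ofReal_le_ofReal_iff dist_nonneg, Real.dist_eq, Finset.sum_range,
    div_sub' hn0.ne', abs_div, abs_of_pos hn0, le_div_iff₀ hn0, mul_comm (n : ℝ) (∫ ω, f ω ∂P)]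

theorem tendsto_measureReal_pi_pred_sum_deviation [IsProbabilityMeasure P] (hfm : Measurable f)
    (hf : Integrable f P) {δ : ℝ} (hδ : 0 < δ) :
    Tendsto (fun n : ℕ => (Measure.pi fun _ : Fin (n - 1) => P).real
      {x | δ * n ≤ |∑ i, f (x i) - (∫ ω, f ω ∂P) * n|}) atTop (𝓝 0) := by
  rw [← tendsto_add_atTop_iff_nat 1]
  refine squeeze_zero' (Eventually.of_forall fun n => measureReal_nonneg) ?_
    (tendsto_measureReal_pi_sum_deviation hfm hf (half_pos hδ))
  filter_upwards [(tendsto_natCast_atTop_atTop.const_mul_atTop (half_pos hδ)).eventually_ge_atTop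
    |∫ ω, f ω ∂P|] with n hn
  refine measureReal_mono fun (x : Fin n → Ω) (hx : δ * _ ≤ |∑ i, f (x i) - _|) => ?_
  rw [Nat.cast_add_one] at hx
  have habs := abs_sub_abs_le_abs_sub (∑ i, f (x i) - (∫ ω, f ω ∂P) * (n + 1)) (- ∫ ω, f ω ∂P)
  rw [abs_neg, sub_neg_eq_add, mul_add_one, ← sub_sub, sub_add_cancel] at habs
  rw [mul_add_one, mul_add_one, ← sub_sub] at hx
  exact Set.mem_ofPred.2 (by linarith)

theorem tendsto_measureReal_pi_pred_exists_le [IsProbabilityMeasure P] (hfm : Measurable f)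
    (hf : Integrable f P) {δ : ℝ} (hδ : 0 < δ) :
    Tendsto (fun n : ℕ => (Measure.pi fun _ : Fin (n - 1) => P).real
      {x | ∃ i, δ * n ≤ f (x i)}) atTop (𝓝 0) := by
  refine squeeze_zero (fun n => measureReal_nonneg) (fun n => ?_)
    (tendsto_natCast_mul_measureReal_le hfm hf hδ)
  refine (measureReal_pi_exists_mem_le (A := {ω | δ * n ≤ f ω})
    (measurableSet_le measurable_const hfm)).trans ?_
  rw [Fintype.card_fin]
  gcongr
  exact n.sub_le 1

end LawOfLargeNumbers

section Chernoff

theorem exp_le_one_add_add_rpow_mul_exp {x γ : ℝ} (hx : 0 ≤ x) (hγ0 : 0 ≤ γ) (hγ2 : γ ≤ 2) :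
    Real.exp x ≤ 1 + x + x ^ γ * Real.exp x := by
  have hexp := Real.exp_pos x
  rcases le_or_gt x 1 with hx1 | hx1
  · have hsub : (1 - x) * Real.exp x ≤ 1 := by
      rw [← le_div_iff₀ hexp, one_div, ← Real.exp_neg]
      exact Real.one_sub_le_exp_neg x
    have hsq : x ^ 2 ≤ x ^ γ := by
      rcases hx.eq_or_lt with rfl | hx0
      · simpa using Real.rpow_nonneg le_rfl γ
      · rw [← Real.rpow_two]
        exact Real.rpow_le_rpow_of_exponent_ge hx0 hx1 hγ2
    nlinarith [mul_le_mul_of_nonneg_right hsq hexp.le]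
  · nlinarith [mul_le_mul_of_nonneg_right (Real.one_le_rpow hx1.le hγ0) hexp.le]

variable {Ω : Type*} [MeasurableSpace Ω] {P : Measure Ω} {f : Ω → ℝ}

theorem measureReal_pi_forall_mem_and_le_sum_le {ι : Type*} [Fintype ι] [IsFiniteMeasure P]
    {T : Set Ω} {s : ℝ} (hs : 0 ≤ s) (hexp : IntegrableOn (fun ω => Real.exp (s * f ω)) T P)
    (a : ℝ) :
    (Measure.pi fun _ : ι => P).real {y | (∀ i, y i ∈ T) ∧ a ≤ ∑ i, f (y i)} ≤
      Real.exp (-s * a) * (∫ ω in T, Real.exp (s * f ω) ∂P) ^ Fintype.card ι := by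
  have hprod (y : ι → Ω) : Real.exp (s * ∑ i, f (y i)) = ∏ i, Real.exp (s * f (y i)) := by
    rw [Finset.mul_sum, Real.exp_sum]
  have hint : Integrable (fun y : ι → Ω => Real.exp (s * ∑ i, f (y i)))
      (Measure.pi fun _ => P.restrict T) := by
    simp only [hprod]
    exact Integrable.fintype_prod fun _ => hexp
  have hchernoff := measure_ge_le_exp_mul_mgf a hs hint
  simp only [mgf, hprod, integral_fintype_prod_eq_pow (μ := P.restrict T)
    fun ω => Real.exp (s * f ω)] at hchernoff
  refine le_trans ?_ hchernoff
  rw [← Measure.restrict_pi_pi, measureReal_def, measureReal_def]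
  refine ENNReal.toReal_mono (measure_ne_top _ _) ((measure_mono ?_).trans
    (Measure.le_restrict_apply (Set.univ.pi fun _ => T) {y : ι → Ω | a ≤ ∑ i, f (y i)}))
  exact fun y hy => ⟨hy.2, fun i _ => hy.1 i⟩

theorem integrableOn_exp_mul_of_le [IsFiniteMeasure P] (hfm : Measurable f) {s : ℝ} (hs : 0 ≤ s)
    (K : ℝ) : IntegrableOn (fun ω => Real.exp (s * f ω)) {ω | f ω ≤ K} P := by
  refine Integrable.of_bound (by fun_prop) (Real.exp (s * K))
    (ae_restrict_of_forall_mem (measurableSet_le hfm measurable_const) fun ω hω => ?_)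
  rw [Real.norm_of_nonneg (Real.exp_pos _).le]
  exact Real.exp_le_exp.2 (mul_le_mul_of_nonneg_left hω hs)

theorem setIntegral_exp_mul_le [IsProbabilityMeasure P] (hfm : Measurable f) (hf0 : ∀ ω, 0 ≤ f ω)
    (hf : Integrable f P) {γ : ℝ} (hγ0 : 0 ≤ γ) (hγ2 : γ ≤ 2)
    (hfγ : Integrable (fun ω => f ω ^ γ) P) {s : ℝ} (hs : 0 ≤ s) (K : ℝ) :
    ∫ ω in {ω | f ω ≤ K}, Real.exp (s * f ω) ∂P ≤
      Real.exp (s * ∫ ω, f ω ∂P + s ^ γ * Real.exp (s * K) * ∫ ω, f ω ^ γ ∂P) := by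
  have hbound {ω : Ω} (hω : f ω ≤ K) : Real.exp (s * f ω) ≤
      1 + s * f ω + s ^ γ * Real.exp (s * K) * f ω ^ γ := by
    refine (exp_le_one_add_add_rpow_mul_exp (mul_nonneg hs (hf0 ω)) hγ0 hγ2).trans ?_
    rw [Real.mul_rpow hs (hf0 ω), mul_right_comm]
    have := Real.rpow_nonneg (hf0 ω) γ
    gcongr
  have hlin : Integrable (fun ω => 1 + s * f ω) P := (integrable_const 1).add (hf.const_mul s)
  have hpow : Integrable (fun ω => s ^ γ * Real.exp (s * K) * f ω ^ γ) P := hfγ.const_mul _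
  calc ∫ ω in {ω | f ω ≤ K}, Real.exp (s * f ω) ∂P
      ≤ ∫ ω in {ω | f ω ≤ K}, (1 + s * f ω + s ^ γ * Real.exp (s * K) * f ω ^ γ) ∂P :=
        setIntegral_mono_on (integrableOn_exp_mul_of_le hfm hs K) (hlin.add hpow).integrableOn
          (measurableSet_le hfm measurable_const) fun ω hω => hbound hω
    _ ≤ ∫ ω, (1 + s * f ω + s ^ γ * Real.exp (s * K) * f ω ^ γ) ∂P :=
        setIntegral_le_integral (hlin.add hpow) (ae_of_all _ fun ω => by
          have := hf0 ω
          rw [Pi.zero_apply]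
          positivity)
    _ = s * ∫ ω, f ω ∂P + s ^ γ * Real.exp (s * K) * (∫ ω, f ω ^ γ ∂P) + 1 := by
        rw [integral_add hlin hpow, integral_add (integrable_const 1) (hf.const_mul s),
          integral_const_mul, integral_const_mul, integral_const, probReal_univ, one_smul]
        ring
    _ ≤ _ := Real.add_one_le_exp _

theorem measureReal_pi_forall_le_and_le_sum_le {ι : Type*} [Fintype ι] [IsProbabilityMeasure P]
    (hfm : Measurable f) (hf0 : ∀ ω, 0 ≤ f ω) (hf : Integrable f P) {γ : ℝ}
    (hγ0 : 0 ≤ γ) (hγ2 : γ ≤ 2) (hfγ : Integrable (fun ω => f ω ^ γ) P) {s : ℝ} (hs : 0 ≤ s)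
    (K a : ℝ) :
    (Measure.pi fun _ : ι => P).real {y | (∀ i, f (y i) ≤ K) ∧ a ≤ ∑ i, f (y i)} ≤
      Real.exp (-s * a + Fintype.card ι *
        (s * ∫ ω, f ω ∂P + s ^ γ * Real.exp (s * K) * ∫ ω, f ω ^ γ ∂P)) := by
  refine (measureReal_pi_forall_mem_and_le_sum_le hs
    (integrableOn_exp_mul_of_le hfm hs K) a).trans ?_
  rw [Real.exp_add, Real.exp_nat_mul]
  gcongr
  exact setIntegral_exp_mul_le hfm hf0 hf hγ0 hγ2 hfγ hs K

theorem tendsto_natCast_mul_log_div_rpow_mul {γ : ℝ} (hγ : 1 < γ) {A : ℝ} (hA : 0 ≤ A) :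
    Tendsto (fun n : ℕ => n * ((A * Real.log n / n) ^ γ * (n : ℝ) ^ ((γ - 1) / 2))) atTop
      (𝓝 0) := by
  have hlog := (((isLittleO_log_rpow_rpow_atTop γ
    (half_pos (sub_pos.2 hγ))).tendsto_div_nhds_zero).comp
    tendsto_natCast_atTop_atTop).const_mul (A ^ γ)
  rw [mul_zero] at hlog
  refine hlog.congr' ?_
  filter_upwards [eventually_ge_atTop 1] with n hn
  have hn0 : (0 : ℝ) < n := mod_cast hn
  have hsplit : (n : ℝ) ^ γ = n * (n : ℝ) ^ ((γ - 1) / 2) * (n : ℝ) ^ ((γ - 1) / 2) := by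
    rw [← Real.rpow_one_add' hn0.le (by linarith), ← Real.rpow_add hn0]
    congr 1
    ring
  have hlog0 : 0 ≤ Real.log n := Real.log_nonneg (mod_cast hn)
  rw [Function.comp_apply, Real.div_rpow (by positivity) hn0.le, Real.mul_rpow hA hlog0, hsplit]
  field_simp

/-- The Chernoff bound with parameter `s = A log n / n` gains the factor `n ^ (-A (λ - ν))`, while
truncation at `δ n` makes `exp (s δ n) = n ^ (A δ)` a small enough power of `n` for the
`γ`-moment term to vanish. -/
theorem exists_tendsto_measureReal_forall_le_and_le_sum [IsProbabilityMeasure P]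
    (hfm : Measurable f) (hf0 : ∀ ω, 0 ≤ f ω) (hf : Integrable f P) {γ : ℝ}
    (hγ1 : 1 < γ) (hγ2 : γ ≤ 2) (hfγ : Integrable (fun ω => f ω ^ γ) P) {lam : ℝ} {m : ℕ → ℝ}
    (hm : Tendsto (fun n : ℕ => m n / n) atTop (𝓝 lam)) (hlam : ∫ ω, f ω ∂P < lam) (b : ℝ) :
    ∃ δ : ℝ, 0 < δ ∧ Tendsto (fun n : ℕ => (n : ℝ) ^ b * (Measure.pi fun _ : Fin n => P).real
      {y | (∀ i, f (y i) ≤ δ * n) ∧ m n ≤ ∑ i, f (y i)}) atTop (𝓝 0) := by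
  obtain ⟨A, hA, hAb⟩ : ∃ A : ℝ, 0 < A ∧ b < A * (lam - ∫ ω, f ω ∂P) :=
    ((eventually_gt_atTop 0).and
      ((tendsto_id.atTop_mul_const (sub_pos.2 hlam)).eventually_gt_atTop b)).exists
  refine ⟨(γ - 1) / 2 / A, by have := sub_pos.2 hγ1; positivity, ?_⟩
  have hexponent : Tendsto (fun n : ℕ => Real.log n * (b - A * (m n / n - ∫ ω, f ω ∂P)) +
      n * ((A * Real.log n / n) ^ γ * (n : ℝ) ^ ((γ - 1) / 2)) * ∫ ω, f ω ^ γ ∂P) atTop atBot :=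
    ((Real.tendsto_log_atTop.comp tendsto_natCast_atTop_atTop).atTop_mul_neg
      (sub_neg.2 hAb) (tendsto_const_nhds.sub ((hm.sub_const _).const_mul A))).atBot_add
      ((tendsto_natCast_mul_log_div_rpow_mul hγ1 hA.le).mul_const _)
  refine squeeze_zero' (Eventually.of_forall fun n => by positivity) ?_
    (Real.tendsto_exp_atBot.comp hexponent)
  filter_upwards [eventually_ge_atTop 1] with n hn
  have hn0 : (0 : ℝ) < n := mod_cast hn
  have : 0 ≤ Real.log n := Real.log_nonneg (mod_cast hn)
  have hpow : Real.exp (A * Real.log n / n * ((γ - 1) / 2 / A * n)) = (n : ℝ) ^ ((γ - 1) / 2) := by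
    rw [Real.rpow_def_of_pos hn0]
    congr 1
    field_simp
  refine (mul_le_mul_of_nonneg_left (measureReal_pi_forall_le_and_le_sum_le hfm hf0 hf
    (by linarith) hγ2 hfγ (by positivity : 0 ≤ A * Real.log n / n) _ (m n))
    (by positivity)).trans_eq ?_
  rw [hpow, Real.rpow_def_of_pos hn0, ← Real.exp_add, Fintype.card_fin, Function.comp_apply]
  congr 1
  field_simp
  ring

end Chernoff

section Insertion

variable {N : ℕ}

theorem card_filter_le_eq_add_removeNth (y : Fin (N + 1) → ℕ) (i : Fin (N + 1)) (t : ℕ) :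
    (Finset.univ.filter fun l => t ≤ y l).card =
      (if t ≤ y i then 1 else 0) + (Finset.univ.filter fun l => t ≤ i.removeNth y l).card := by
  rw [Finset.card_filter, Fin.sum_univ_succAbove _ i, Finset.card_filter]
  rfl

theorem ordered_one_of_forall_le {y : Fin (N + 1) → ℕ} {i : Fin (N + 1)}
    (hi : ∀ l, y l ≤ y i) : ordered y 1 = y i := by
  refine eq_of_forall_le_iff fun t => ?_
  rw [le_ordered_iff y le_rfl (by omega), Finset.one_le_card]
  exact ⟨fun ⟨l, hl⟩ => (Finset.mem_filter.1 hl).2.trans (hi l),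
    fun ht => ⟨i, Finset.mem_filter.2 ⟨Finset.mem_univ i, ht⟩⟩⟩

theorem ordered_succ_of_forall_le {y : Fin (N + 1) → ℕ} {i : Fin (N + 1)}
    (hi : ∀ l, y l ≤ y i) {j : ℕ} (hj : 1 ≤ j) (hjN : j ≤ N) :
    ordered y (j + 1) = ordered (i.removeNth y) j := by
  refine eq_of_forall_le_iff fun t => ?_
  rw [le_ordered_iff y (by omega) (by omega), le_ordered_iff (i.removeNth y) hj hjN,
    card_filter_le_eq_add_removeNth y i]
  by_cases ht : t ≤ y i
  · rw [if_pos ht]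
    omega
  · have hempty : (Finset.univ.filter fun l => t ≤ i.removeNth y l).card = 0 := by
      rw [Finset.card_eq_zero, Finset.filter_eq_empty_iff]
      exact fun l _ hl => ht (hl.trans (hi _))
    rw [if_neg ht, hempty]
    omega

theorem orderedVector_eq_comparisonVector_removeNth {y : Fin (N + 1) → ℕ} {i : Fin (N + 1)}
    (hi : ∀ l, y l ≤ y i) :
    orderedVector y = comparisonVector (n := N + 1) (∑ l, y l) (i.removeNth y) := by
  funext l
  rw [orderedVector, comparisonVector]
  split_ifs with hl
  · rw [hl, zero_add, ordered_one_of_forall_le hi, Fin.sum_univ_succAbove _ i]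
    push_cast
    exact (add_sub_cancel_right _ _).symm
  · rw [ordered_succ_of_forall_le hi (by omega) (by omega)]

end Insertion

section OneCoordinate

variable {P : Measure ℕ} [IsFiniteMeasure P] {N : ℕ}

theorem measure_pi_sum_eq_and_removeNth_mem (i : Fin (N + 1)) (m : ℕ) (T : Set ℕ)
    (S : Set (Fin N → ℕ)) :
    (Measure.pi fun _ : Fin (N + 1) => P) {y | ∑ l, y l = m ∧ y i ∈ T ∧ i.removeNth y ∈ S} =
      ∫⁻ x in S, P {k | k + ∑ l, x l = m ∧ k ∈ T} ∂(Measure.pi fun _ : Fin N => P) := by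
  have hset : {y : Fin (N + 1) → ℕ | ∑ l, y l = m ∧ y i ∈ T ∧ i.removeNth y ∈ S} =
      (MeasurableEquiv.piFinSuccAbove (fun _ : Fin (N + 1) => ℕ) i) ⁻¹'
        {q : ℕ × (Fin N → ℕ) | q.1 + ∑ l, q.2 l = m ∧ q.1 ∈ T ∧ q.2 ∈ S} := by
    ext y
    simp only [Set.mem_ofPred_eq, Set.mem_preimage, Fin.sum_univ_succAbove _ i]
    rfl
  rw [hset, (measurePreserving_piFinSuccAbove (fun _ : Fin (N + 1) => P) i).measure_preimage
    MeasurableSet.of_discrete.nullMeasurableSet, Measure.prod_apply_symm MeasurableSet.of_discrete,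
    ← lintegral_indicator MeasurableSet.of_discrete]
  refine lintegral_congr fun x => ?_
  by_cases hx : x ∈ S <;> simp [hx]

theorem measureReal_pi_sum_eq_and_removeNth_mem_le (i : Fin (N + 1)) (m : ℕ) (T : Set ℕ)
    (S : Set (Fin N → ℕ)) {u : ℝ} (hu : 0 ≤ u)
    (hle : ∀ x ∈ S, ∀ k ∈ T, k + ∑ l, x l = m → P.real {k} ≤ u) :
    (Measure.pi fun _ : Fin (N + 1) => P).real {y | ∑ l, y l = m ∧ y i ∈ T ∧ i.removeNth y ∈ S} ≤
      u * (Measure.pi fun _ : Fin N => P).real S := by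
  rw [measureReal_def, measure_pi_sum_eq_and_removeNth_mem]
  refine ENNReal.toReal_le_of_le_ofReal (by positivity) ?_
  rw [ENNReal.ofReal_mul hu, ofReal_measureReal, ← setLIntegral_const]
  refine setLIntegral_mono' MeasurableSet.of_discrete fun x hx => ?_
  rcases Set.eq_empty_or_nonempty {k | k + ∑ l, x l = m ∧ k ∈ T} with hempty | ⟨k, hk, hkT⟩
  · rw [hempty, measure_empty]
    exact zero_le
  · have hsub : {k | k + ∑ l, x l = m ∧ k ∈ T} ⊆ {k} := fun k' hk' => by
      rw [Set.mem_singleton_iff]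
      exact Nat.add_right_cancel (hk'.1.trans hk.symm)
    refine (measure_mono hsub).trans ?_
    rw [← ofReal_measureReal]
    exact ENNReal.ofReal_le_ofReal (hle x hx k hkT hk)

theorem le_measureReal_pi_sum_eq_and_removeNth_mem (i : Fin (N + 1)) (m : ℕ) (T : Set ℕ)
    (S : Set (Fin N → ℕ)) {u : ℝ}
    (hle : ∀ x ∈ S, ∃ k ∈ T, k + ∑ l, x l = m ∧ u ≤ P.real {k}) :
    u * (Measure.pi fun _ : Fin N => P).real S ≤
      (Measure.pi fun _ : Fin (N + 1) => P).real
        {y | ∑ l, y l = m ∧ y i ∈ T ∧ i.removeNth y ∈ S} := by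
  rcases lt_or_ge u 0 with hu | hu
  · exact (mul_nonpos_of_nonpos_of_nonneg hu.le measureReal_nonneg).trans measureReal_nonneg
  rw [measureReal_def (Measure.pi fun _ : Fin (N + 1) => P),
    ← ENNReal.ofReal_le_iff_le_toReal (measure_ne_top _ _), measure_pi_sum_eq_and_removeNth_mem,
    ENNReal.ofReal_mul hu, ofReal_measureReal, ← setLIntegral_const]
  refine setLIntegral_mono' MeasurableSet.of_discrete fun x hx => ?_
  obtain ⟨k, hkT, hk, hle⟩ := hle x hx
  refine (ENNReal.ofReal_le_ofReal hle).trans ?_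
  rw [ofReal_measureReal]
  exact measure_mono (Set.singleton_subset_iff.2 ⟨hk, hkT⟩)

end OneCoordinate

section OneBigJump

theorem tendsto_rpow_mul_of_isEquivalent {ι : Type*} {l : Filter ι} {p : ℕ → ℝ} {c β a : ℝ}
    (h : p ~[atTop] fun k : ℕ => c * (k : ℝ) ^ (-β)) (ha : 0 < a) {n k : ι → ℕ}
    (hn : Tendsto n l atTop) (hk : Tendsto (fun i => (k i : ℝ) / n i) l (𝓝 a)) :
    Tendsto (fun i => (n i : ℝ) ^ β * p (k i)) l (𝓝 (c * a ^ (-β))) := by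
  have hn0 : ∀ᶠ i in l, (0 : ℝ) < n i :=
    (tendsto_natCast_atTop_atTop.comp hn).eventually_gt_atTop 0
  have hk_top : Tendsto k l atTop := by
    rw [← tendsto_natCast_atTop_iff (R := ℝ)]
    refine (hk.pos_mul_atTop ha (tendsto_natCast_atTop_atTop.comp hn)).congr' ?_
    filter_upwards [hn0] with i hi
    exact div_mul_cancel₀ _ hi.ne'
  have hequiv : (fun i => (n i : ℝ) ^ β * p (k i)) ~[l]
      fun i => (n i : ℝ) ^ β * (c * (k i : ℝ) ^ (-β)) :=
    IsEquivalent.refl.mul (h.comp_tendsto hk_top)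
  refine hequiv.symm.tendsto_nhds
    (((hk.rpow_const (p := -β) (Or.inl ha.ne')).const_mul c).congr' ?_)
  filter_upwards [hn0] with i hi
  rw [Real.div_rpow (k i).cast_nonneg hi.le, Real.rpow_neg hi.le, div_inv_eq_mul]
  ring

theorem exists_forall_abs_sub_lt_exists_add_eq {p : ℕ → ℝ} {c β : ℝ}
    (h : p ~[atTop] fun k : ℕ => c * (k : ℝ) ^ (-β)) {ν lam : ℝ} {m : ℕ → ℕ}
    (hm : Tendsto (fun n : ℕ => (m n : ℝ) / n) atTop (𝓝 lam)) (hlam : ν < lam) {η : ℝ}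
    (hη : 0 < η) :
    ∃ δ : ℝ, 0 < δ ∧ ∀ᶠ n : ℕ in atTop, ∀ S : ℕ, |(S : ℝ) - ν * n| < δ * n →
      ∃ k : ℕ, k + S = m n ∧ δ * n < k ∧ |(n : ℝ) ^ β * p k - c * (lam - ν) ^ (-β)| < η := by
  have ha : 0 < lam - ν := sub_pos.2 hlam
  let l : Filter (ℕ × ℕ) := comap Prod.fst atTop ⊓ comap (fun q => (q.2 : ℝ) / q.1) (𝓝 ν)
  have hn : Tendsto Prod.fst l atTop := tendsto_comap.mono_left inf_le_left
  have hsub : Tendsto (fun q : ℕ × ℕ => ((m q.1 : ℝ) - q.2) / q.1) l (𝓝 (lam - ν)) := by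
    simp only [sub_div]
    exact (hm.comp hn).sub (tendsto_comap.mono_left inf_le_right)
  have hle : ∀ᶠ q in l, q.2 ≤ m q.1 := by
    filter_upwards [hsub.eventually_const_lt ha, hn.eventually_gt_atTop 0] with q hq hq0
    rw [div_pos_iff_of_pos_right (mod_cast hq0), sub_pos, Nat.cast_lt] at hq
    exact hq.le
  have hk : Tendsto (fun q : ℕ × ℕ => ((m q.1 - q.2 : ℕ) : ℝ) / q.1) l (𝓝 (lam - ν)) :=
    hsub.congr' (hle.mono fun q hq => by simp only [Nat.cast_sub hq])
  have hall := (hle.and (hk.eventually_const_lt (half_lt_self ha))).and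
    (Metric.tendsto_nhds.1 (tendsto_rpow_mul_of_isEquivalent h ha hn hk) η hη)
  obtain ⟨⟨n₀, ε⟩, ⟨-, hε⟩, hnear⟩ :=
    ((atTop_basis.comap Prod.fst).inf (Metric.nhds_basis_ball.comap _)).eventually_iff.1 hall
  refine ⟨min ε ((lam - ν) / 2), by positivity, ?_⟩
  filter_upwards [eventually_ge_atTop n₀, eventually_gt_atTop 0] with n hnn₀ hn0 S hS
  have hn0' : (0 : ℝ) < n := mod_cast hn0
  have hball : dist ((S : ℝ) / n) ν < ε := by
    rw [Real.dist_eq, div_sub' hn0'.ne', abs_div, abs_of_pos hn0', div_lt_iff₀ hn0', mul_comm _ ν]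
    exact hS.trans_le (mul_le_mul_of_nonneg_right (min_le_left _ _) hn0'.le)
  obtain ⟨⟨hSm, hbig⟩, hlim⟩ := hnear (x := (n, S)) ⟨hnn₀, hball⟩
  refine ⟨m n - S, Nat.sub_add_cancel hSm, ?_, hlim⟩
  exact (mul_le_mul_of_nonneg_right (min_le_right _ _) hn0'.le).trans_lt ((lt_div_iff₀ hn0').1 hbig)

variable {P : Measure ℕ}

/-- The configurations `x` of the `n - 1` boxes other than the biggest one which are typical for
i.i.d. variables with mean `ν`: their sum is within `δ n` of `ν n`, and no box has `δ n` balls. -/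
def typicalSet (ν δ : ℝ) (n : ℕ) : Set (Fin (n - 1) → ℕ) :=
  {x | |∑ i, (x i : ℝ) - ν * n| < δ * n ∧ ∀ i, (x i : ℝ) < δ * n}

theorem tendsto_measureReal_typicalSet [IsProbabilityMeasure P]
    (hint : Integrable (fun k : ℕ => (k : ℝ)) P) {δ : ℝ} (hδ : 0 < δ) :
    Tendsto (fun n : ℕ => (Measure.pi fun _ : Fin (n - 1) => P).real
      (typicalSet (∫ k : ℕ, (k : ℝ) ∂P) δ n)) atTop (𝓝 1) := by
  have hbad := (tendsto_measureReal_pi_pred_sum_deviation .of_discrete hint hδ).add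
    (tendsto_measureReal_pi_pred_exists_le .of_discrete hint hδ)
  rw [add_zero] at hbad
  have hgood := hbad.const_sub 1
  rw [sub_zero] at hgood
  refine tendsto_of_tendsto_of_tendsto_of_le_of_le hgood tendsto_const_nhds (fun n => ?_)
    fun n => measureReal_le_one
  rw [sub_le_comm, ← probReal_compl_eq_one_sub .of_discrete]
  refine (measureReal_mono fun x hx => ?_).trans (measureReal_union_le _ _)
  rcases not_and_or.1 hx with hsum | hlarge
  · exact Or.inl (not_lt.1 hsum)
  · push Not at hlarge
    exact Or.inr hlarge

theorem mul_measureReal_le_measureReal_sum_eq_and_orderedVector_mem [IsFiniteMeasure P] {N m : ℕ}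
    {B : Set (Fin (N + 1) → ℤ)} {S : Set (Fin N → ℕ)} {t u : ℝ}
    (hlt : ∀ x ∈ S, ∀ l, (x l : ℝ) < t) (hB : ∀ x ∈ S, comparisonVector (n := N + 1) m x ∈ B)
    (hbig : ∀ x ∈ S, ∃ k : ℕ, t < k ∧ k + ∑ l, x l = m ∧ u ≤ P.real {k}) :
    ((N + 1 : ℕ) : ℝ) * (u * (Measure.pi fun _ : Fin N => P).real S) ≤
      (Measure.pi fun _ : Fin (N + 1) => P).real {y | ∑ l, y l = m ∧ orderedVector y ∈ B} := by
  let E (i : Fin (N + 1)) : Set (Fin (N + 1) → ℕ) :=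
    {y | ∑ l, y l = m ∧ y i ∈ {k : ℕ | t < k} ∧ i.removeNth y ∈ S}
  have hlt' {i : Fin (N + 1)} {y : Fin (N + 1) → ℕ} (hy : y ∈ E i) (l : Fin N) :
      y (i.succAbove l) < y i := by
    exact_mod_cast (hlt _ hy.2.2 l).trans hy.2.1
  have hdisj : Pairwise (Function.onFun Disjoint E) := fun i j hij =>
    Set.disjoint_left.2 fun y hi hj => by
      obtain ⟨l, rfl⟩ := Fin.exists_succAbove_eq hij.symm
      exact lt_asymm (hlt _ hi.2.2 l) hj.2.1
  have hsub : ⋃ i, E i ⊆ {y | ∑ l, y l = m ∧ orderedVector y ∈ B} := by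
    refine Set.iUnion_subset fun i y hy => ⟨hy.1, ?_⟩
    rw [orderedVector_eq_comparisonVector_removeNth (i := i), hy.1]
    · exact hB _ hy.2.2
    · exact i.forall_iff_succAbove.2 ⟨le_rfl, fun l => (hlt' hy l).le⟩
  calc ((N + 1 : ℕ) : ℝ) * (u * (Measure.pi fun _ : Fin N => P).real S)
      = ∑ _ : Fin (N + 1), u * (Measure.pi fun _ : Fin N => P).real S := by
        rw [Finset.sum_const, Finset.card_univ, Fintype.card_fin, nsmul_eq_mul]
    _ ≤ ∑ i, (Measure.pi fun _ : Fin (N + 1) => P).real (E i) :=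
        Finset.sum_le_sum fun i _ => le_measureReal_pi_sum_eq_and_removeNth_mem i m _ S hbig
    _ = (Measure.pi fun _ : Fin (N + 1) => P).real (⋃ i, E i) :=
        (measureReal_iUnion_fintype hdisj fun _ => .of_discrete).symm
    _ ≤ _ := measureReal_mono hsub

theorem exists_forall_le_measureReal_orderedVector_mem [IsFiniteMeasure P] {c β : ℝ}
    (h : (fun k => P.real {k}) ~[atTop] fun k : ℕ => c * (k : ℝ) ^ (-β))
    {ν lam : ℝ} {m : ℕ → ℕ} (hm : Tendsto (fun n : ℕ => (m n : ℝ) / n) atTop (𝓝 lam))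
    (hlam : ν < lam) {η : ℝ} (hη : 0 < η) :
    ∃ δ : ℝ, 0 < δ ∧ ∀ᶠ n : ℕ in atTop, ∀ B : Set (Fin n → ℤ),
      (c * (lam - ν) ^ (-β) - η) * (Measure.pi fun _ : Fin (n - 1) => P).real
          (typicalSet ν δ n ∩ comparisonVector (m n) ⁻¹' B) ≤
        (n : ℝ) ^ (β - 1) *
          (Measure.pi fun _ : Fin n => P).real {y | ∑ l, y l = m n ∧ orderedVector y ∈ B} := by
  obtain ⟨δ, hδ, hlocal⟩ := exists_forall_abs_sub_lt_exists_add_eq h hm hlam hη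
  refine ⟨δ, hδ, ?_⟩
  filter_upwards [hlocal, eventually_ge_atTop 1] with n hn hn1 B
  obtain ⟨N, rfl⟩ : ∃ N, n = N + 1 := ⟨n - 1, by omega⟩
  have hn0 : (0 : ℝ) < (N + 1 : ℕ) := by positivity
  have hjump := mul_measureReal_le_measureReal_sum_eq_and_orderedVector_mem (P := P) (B := B)
    (S := typicalSet ν δ (N + 1) ∩ comparisonVector (n := N + 1) (m (N + 1)) ⁻¹' B)
    (u := (c * (lam - ν) ^ (-β) - η) / ((N + 1 : ℕ) : ℝ) ^ β) (fun x hx => hx.1.2)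
    (fun x hx => hx.2) fun x hx => by
      obtain ⟨k, hk, hlarge, hp⟩ := hn (∑ l, x l) (by rw [Nat.cast_sum]; exact hx.1.1)
      refine ⟨k, hlarge, hk, (div_le_iff₀' (by positivity)).2 ?_⟩
      linarith [(abs_lt.1 hp).1]
  refine le_trans (le_of_eq ?_) (mul_le_mul_of_nonneg_left hjump (by positivity))
  rw [Real.rpow_sub_one hn0.ne']
  field_simp
  rfl

theorem measureReal_pi_sum_eq_and_mem_le [IsProbabilityMeasure P] {N m : ℕ} (i : Fin (N + 1))
    {T : Set ℕ} {S : Set (Fin N → ℕ)} {U V : ℝ} (hU0 : 0 ≤ U) (hV0 : 0 ≤ V)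
    (hU : ∀ x ∉ S, ∀ k, k + ∑ l, x l = m → P.real {k} ≤ U) (hV : ∀ k ∈ T, P.real {k} ≤ V) :
    (Measure.pi fun _ : Fin (N + 1) => P).real {y | ∑ l, y l = m ∧ y i ∈ T} ≤
      U + V * (Measure.pi fun _ : Fin N => P).real S := by
  have hsub : {y : Fin (N + 1) → ℕ | ∑ l, y l = m ∧ y i ∈ T} ⊆
      {y | ∑ l, y l = m ∧ y i ∈ T ∧ i.removeNth y ∈ Sᶜ} ∪
      {y | ∑ l, y l = m ∧ y i ∈ T ∧ i.removeNth y ∈ S} := fun y hy => by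
    by_cases hyS : i.removeNth y ∈ S
    · exact Or.inr ⟨hy.1, hy.2, hyS⟩
    · exact Or.inl ⟨hy.1, hy.2, hyS⟩
  refine (measureReal_mono hsub).trans ((measureReal_union_le _ _).trans (add_le_add ?_ ?_))
  · exact (measureReal_pi_sum_eq_and_removeNth_mem_le i m T Sᶜ hU0
      fun x hx k _ hk => hU x hx k hk).trans (mul_le_of_le_one_right hU0 measureReal_le_one)
  · exact measureReal_pi_sum_eq_and_removeNth_mem_le i m T S hV0 fun x _ k hkT _ => hV k hkT

theorem measureReal_pi_sum_eq_le [IsProbabilityMeasure P] {N m : ℕ} (T : Set ℕ)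
    {S : Set (Fin N → ℕ)} {U V : ℝ} (hU0 : 0 ≤ U) (hV0 : 0 ≤ V)
    (hU : ∀ x ∉ S, ∀ k, k + ∑ l, x l = m → P.real {k} ≤ U) (hV : ∀ k ∈ T, P.real {k} ≤ V) :
    (Measure.pi fun _ : Fin (N + 1) => P).real {y | ∑ l, y l = m} ≤
      (Measure.pi fun _ : Fin (N + 1) => P).real {y | (∀ i, y i ∉ T) ∧ ∑ l, y l = m} +
        ((N + 1 : ℕ) : ℝ) * (U + V * (Measure.pi fun _ : Fin N => P).real S) := by
  have hsub : {y : Fin (N + 1) → ℕ | ∑ l, y l = m} ⊆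
      {y | (∀ i, y i ∉ T) ∧ ∑ l, y l = m} ∪
        ⋃ i ∈ Finset.univ, {y | ∑ l, y l = m ∧ y i ∈ T} := fun y hy => by
    by_cases hT : ∃ i, y i ∈ T
    · obtain ⟨i, hi⟩ := hT
      exact Or.inr (Set.mem_biUnion (Finset.mem_coe.2 (Finset.mem_univ i)) ⟨hy, hi⟩)
    · exact Or.inl ⟨not_exists.1 hT, hy⟩
  refine (measureReal_mono hsub).trans ((measureReal_union_le _ _).trans ?_)
  gcongr
  refine (measureReal_biUnion_finset_le _ _).trans ((Finset.sum_le_sum fun i _ =>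
    measureReal_pi_sum_eq_and_mem_le i hU0 hV0 hU hV).trans_eq ?_)
  rw [Finset.sum_const, Finset.card_univ, Fintype.card_fin, nsmul_eq_mul]

theorem rpow_sub_one_mul_self_mul_rpow_neg {x : ℝ} (hx : 0 < x) (β : ℝ) :
    x ^ (β - 1) * x * x ^ (-β) = 1 := by
  rw [Real.rpow_sub_one hx.ne', div_mul_cancel₀ _ hx.ne', ← Real.rpow_add hx, add_neg_cancel,
    Real.rpow_zero]

theorem rpow_mul_measureReal_sum_eq_le [IsProbabilityMeasure P] {C L β ν δ ε : ℝ} {m n : ℕ}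
    (hn : 0 < n) (hβ : 0 ≤ β) (hL : 0 ≤ L) (hC : 0 ≤ C) (hε : 0 < ε)
    (hP : ∀ k : ℕ, 0 < k → |P.real {k}| ≤ C * (k : ℝ) ^ (-β))
    (hlocal : ∀ S : ℕ, |(S : ℝ) - ν * n| < δ * n → ∀ k : ℕ, k + S = m →
      (n : ℝ) ^ β * P.real {k} ≤ L) :
    (n : ℝ) ^ (β - 1) * (Measure.pi fun _ : Fin n => P).real {y | ∑ l, y l = m} ≤
      (n : ℝ) ^ (β - 1) * (Measure.pi fun _ : Fin n => P).real
        {y | (∀ i, (y i : ℝ) ≤ ε * n) ∧ (m : ℝ) ≤ ∑ i, (y i : ℝ)} +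
      (L + C * ε ^ (-β) * (Measure.pi fun _ : Fin (n - 1) => P).real
        {x | δ * n ≤ |∑ i, (x i : ℝ) - ν * n|}) := by
  obtain ⟨N, rfl⟩ : ∃ N, n = N + 1 := ⟨n - 1, by omega⟩
  have hn0 : (0 : ℝ) < (N + 1 : ℕ) := by positivity
  have hsum := measureReal_pi_sum_eq_le (P := P) (m := m) {k : ℕ | ε * (N + 1 : ℕ) < k}
    (S := {x : Fin N → ℕ | δ * (N + 1 : ℕ) ≤ |∑ i, (x i : ℝ) - ν * (N + 1 : ℕ)|})
    (U := L * ((N + 1 : ℕ) : ℝ) ^ (-β)) (V := C * (ε * (N + 1 : ℕ)) ^ (-β))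
    (by positivity) (by positivity)
    (fun x hx k hk => by
      rw [Real.rpow_neg hn0.le, ← div_eq_mul_inv, le_div_iff₀' (by positivity)]
      exact hlocal (∑ l, x l) (by rw [Nat.cast_sum]; exact not_le.1 hx) k hk)
    fun k (hk : ε * (N + 1 : ℕ) < k) => (le_abs_self _).trans <|
      (hP k (by exact_mod_cast (by positivity : 0 < ε * (N + 1 : ℕ)).trans hk)).trans <|
        mul_le_mul_of_nonneg_left (Real.rpow_le_rpow_of_nonpos (by positivity) hk.le
          (neg_nonpos.2 hβ)) hC
  have hsmall : (Measure.pi fun _ : Fin (N + 1) => P).real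
      {y | (∀ i, y i ∉ {k : ℕ | ε * (N + 1 : ℕ) < k}) ∧ ∑ l, y l = m} ≤
      (Measure.pi fun _ : Fin (N + 1) => P).real
        {y | (∀ i, (y i : ℝ) ≤ ε * (N + 1 : ℕ)) ∧ (m : ℝ) ≤ ∑ i, (y i : ℝ)} :=
    measureReal_mono fun y hy => ⟨fun i => not_lt.1 (hy.1 i), by rw [← hy.2, Nat.cast_sum]⟩
  refine (mul_le_mul_of_nonneg_left (hsum.trans (add_le_add_left hsmall _))
    (by positivity)).trans_eq ?_
  rw [mul_add, Real.mul_rpow hε.le hn0.le, add_tsub_cancel_right]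
  linear_combination (L + C * ε ^ (-β) * (Measure.pi fun _ : Fin N => P).real
    {x | δ * (N + 1 : ℕ) ≤ |∑ i, (x i : ℝ) - ν * (N + 1 : ℕ)|}) *
      rpow_sub_one_mul_self_mul_rpow_neg hn0 β

theorem eventually_rpow_mul_measureReal_sum_eq_le [IsProbabilityMeasure P] {c β γ : ℝ}
    (hc : 0 ≤ c) (hβ : 0 ≤ β) (h : (fun k => P.real {k}) ~[atTop] fun k : ℕ => c * (k : ℝ) ^ (-β))
    (hγ1 : 1 < γ) (hγ2 : γ ≤ 2) (hint : Integrable (fun k : ℕ => (k : ℝ)) P)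
    (hintγ : Integrable (fun k : ℕ => (k : ℝ) ^ γ) P) {lam : ℝ} {m : ℕ → ℕ}
    (hm : Tendsto (fun n : ℕ => (m n : ℝ) / n) atTop (𝓝 lam))
    (hlam : ∫ k : ℕ, (k : ℝ) ∂P < lam) {η : ℝ} (hη : 0 < η) :
    ∀ᶠ n : ℕ in atTop, (n : ℝ) ^ (β - 1) *
      (Measure.pi fun _ : Fin n => P).real {y | ∑ l, y l = m n} ≤
        c * (lam - ∫ k : ℕ, (k : ℝ) ∂P) ^ (-β) + η := by
  have : 0 ≤ c * (lam - ∫ k : ℕ, (k : ℝ) ∂P) ^ (-β) :=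
    mul_nonneg hc (Real.rpow_nonneg (sub_pos.2 hlam).le _)
  obtain ⟨C, hC, hCp⟩ := exists_forall_abs_le_mul_rpow h
  obtain ⟨ε, hε, hsmall⟩ := exists_tendsto_measureReal_forall_le_and_le_sum .of_discrete
    (fun k => k.cast_nonneg) hint hγ1 hγ2 hintγ hm hlam (β - 1)
  obtain ⟨δ, hδ, hlocal⟩ := exists_forall_abs_sub_lt_exists_add_eq h hm hlam (half_pos hη)
  have hrest := hsmall.add ((tendsto_measureReal_pi_pred_sum_deviation .of_discrete hint
    hδ).const_mul (C * ε ^ (-β)))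
  rw [mul_zero, add_zero] at hrest
  filter_upwards [hlocal, hrest.eventually_lt_const (half_pos hη), eventually_gt_atTop 0]
    with n hn hrest_n hn0
  have hsum := rpow_mul_measureReal_sum_eq_le (P := P) (m := m n) (δ := δ)
    (ν := ∫ k : ℕ, (k : ℝ) ∂P) (L := c * (lam - ∫ k : ℕ, (k : ℝ) ∂P) ^ (-β) + η / 2)
    hn0 hβ (by positivity) hC.le hε hCp fun S hS k hk => by
      obtain ⟨k', hk', -, hp⟩ := hn S hS
      rw [Nat.add_right_cancel (hk.trans hk'.symm)]
      linarith [(abs_lt.1 hp).2]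
  linarith

end OneBigJump

section Coupling

section

variable {E F : Type*} [MeasurableSpace E] [MeasurableSpace F]

theorem map_fst_inv_smul_prod (μ : Measure E) [IsFiniteMeasure μ] {ν : Measure F} [SFinite ν]
    (h : ν Set.univ = μ Set.univ) : ((μ Set.univ)⁻¹ • μ.prod ν).map Prod.fst = μ := by
  rw [Measure.map_smul, Measure.map_fst_prod, h, smul_smul]
  rcases eq_or_ne (μ Set.univ) 0 with hμ | hμ
  · rw [Measure.measure_univ_eq_zero.1 hμ, smul_zero]
  · rw [ENNReal.inv_mul_cancel hμ (measure_ne_top μ _), one_smul]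

theorem map_snd_inv_smul_prod (μ : Measure E) [SFinite μ] {ν : Measure F} [IsFiniteMeasure ν]
    (h : ν Set.univ = μ Set.univ) : ((μ Set.univ)⁻¹ • μ.prod ν).map Prod.snd = ν := by
  rw [← Measure.prod_swap, ← Measure.map_smul, Measure.map_map measurable_snd measurable_swap, ← h]
  exact map_fst_inv_smul_prod ν h.symm

theorem measure_preimage_le_add_measure_ne {G : Type*} (γ : Measure E) (f g : E → G) (S : Set G) :
    γ (f ⁻¹' S) ≤ γ (g ⁻¹' S) + γ {x | f x ≠ g x} := by
  refine (measure_mono fun x hx => ?_).trans (measure_union_le _ _)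
  by_cases hfg : f x = g x
  · exact .inl (hfg ▸ hx : g x ∈ S)
  · exact .inr hfg

/-- The diagonal carries `μ ⊓ ν`; the excesses of `μ` and `ν` over it are coupled independently. -/
theorem exists_coupling_inf [Countable E] [MeasurableSingletonClass E] (μ ν : Measure E)
    [IsProbabilityMeasure μ] [IsProbabilityMeasure ν] :
    ∃ γ : Measure (E × E), γ.map Prod.fst = μ ∧ γ.map Prod.snd = ν ∧
      (μ ⊓ ν) Set.univ ≤ γ {p | p.1 = p.2} := by
  have hμ : μ ⊓ ν ≤ μ := inf_le_left
  have hν : μ ⊓ ν ≤ ν := inf_le_right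
  have : IsFiniteMeasure (μ ⊓ ν) := ⟨(hμ Set.univ).trans_lt (measure_lt_top μ _)⟩
  have hmass : (ν - μ ⊓ ν) Set.univ = (μ - μ ⊓ ν) Set.univ := by
    rw [Measure.sub_apply .univ hν, Measure.sub_apply .univ hμ, measure_univ (μ := μ),
      measure_univ (μ := ν)]
  refine ⟨(μ ⊓ ν).map (fun x => (x, x)) +
    ((μ - μ ⊓ ν) Set.univ)⁻¹ • (μ - μ ⊓ ν).prod (ν - μ ⊓ ν), ?_, ?_, ?_⟩
  · rw [Measure.map_add _ _ measurable_fst, Measure.map_map measurable_fst (by fun_prop),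
      map_fst_inv_smul_prod _ hmass, add_comm]
    exact Measure.map_id.symm ▸ Measure.sub_add_cancel_of_le hμ
  · rw [Measure.map_add _ _ measurable_snd, Measure.map_map measurable_snd (by fun_prop),
      map_snd_inv_smul_prod _ hmass, add_comm]
    exact Measure.map_id.symm ▸ Measure.sub_add_cancel_of_le hν
  · rw [Measure.add_apply, Measure.map_apply (by fun_prop) .of_discrete,
      Set.eq_univ_of_forall (s := (fun x : E => (x, x)) ⁻¹' {p | p.1 = p.2}) fun _ => rfl]
    exact le_self_add

end

variable {E : ℕ → Type*} [∀ n, MeasurableSpace (E n)] [∀ n, Countable (E n)]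
  [∀ n, MeasurableSingletonClass (E n)]

theorem approxEqualLaws_of_tendsto_inf (μ ν : ∀ n, Measure (E n))
    [∀ n, IsProbabilityMeasure (μ n)] [∀ n, IsProbabilityMeasure (ν n)]
    (h : Tendsto (fun n => (μ n ⊓ ν n) Set.univ) atTop (𝓝 1)) : ApproxEqualLaws μ ν := by
  choose γ hfst hsnd hdiag using fun n => exists_coupling_inf (μ n) (ν n)
  refine ⟨γ, fun n => ⟨hfst n, hsnd n⟩,
    tendsto_of_tendsto_of_tendsto_of_le_of_le h tendsto_const_nhds hdiag fun n => ?_⟩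
  have : IsProbabilityMeasure ((γ n).map Prod.fst) := hfst n ▸ inferInstance
  have := Measure.isProbabilityMeasure_of_map (μ := γ n) Prod.fst
  exact prob_le_one

theorem approxEqualLaws_of_forall_mul_le (μ ν : ∀ n, Measure (E n))
    [∀ n, IsProbabilityMeasure (μ n)] [∀ n, IsProbabilityMeasure (ν n)]
    (h : ∀ ε : ℝ, 0 < ε → ∀ᶠ n in atTop, ∃ κ ≤ ν n, 1 - ε ≤ κ.real Set.univ ∧
      ∀ B, (1 - ε) * κ.real B ≤ (μ n).real B) :
    ApproxEqualLaws μ ν := by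
  refine approxEqualLaws_of_tendsto_inf μ ν (tendsto_order.2 ⟨fun a ha => ?_, fun a ha =>
    .of_forall fun n => ((inf_le_left (a := μ n) (b := ν n) Set.univ).trans prob_le_one).trans_lt
      ha⟩)
  have ha1 : a.toReal < 1 := ENNReal.toReal_strict_mono ENNReal.one_ne_top ha
  filter_upwards [h ((1 - a.toReal) / 2) (by linarith)] with n ⟨κ, hκν, hmass, hκμ⟩
  set ε := (1 - a.toReal) / 2 with hε
  have hε1 : 0 ≤ 1 - ε := by linarith [a.toReal_nonneg]
  have : IsFiniteMeasure κ := ⟨(hκν Set.univ).trans_lt (measure_lt_top _ _)⟩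
  have hinf : ENNReal.ofReal (1 - ε) • κ ≤ μ n ⊓ ν n := by
    refine le_inf (Measure.le_iff.2 fun B _ => ?_) (Measure.le_iff.2 fun B _ => ?_) <;>
      rw [Measure.smul_apply, smul_eq_mul]
    · rw [← ofReal_measureReal, ← ofReal_measureReal (μ := μ n), ← ENNReal.ofReal_mul hε1]
      exact ENNReal.ofReal_le_ofReal (hκμ B)
    · refine (mul_le_mul_left (ENNReal.ofReal_le_one.2 (by linarith)) _).trans ?_
      rw [one_mul]
      exact hκν B
  refine lt_of_lt_of_le ?_ (hinf Set.univ)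
  rw [Measure.smul_apply, smul_eq_mul, ← ofReal_measureReal, ← ENNReal.ofReal_mul hε1,
    ENNReal.lt_ofReal_iff_toReal_lt ha.ne_top]
  calc a.toReal < (1 - ε) * (1 - ε) := by nlinarith
    _ ≤ (1 - ε) * κ.real Set.univ := by gcongr

theorem ApproxEqualLaws.exists_error {μ ν : ∀ n, Measure (E n)}
    [∀ n, IsProbabilityMeasure (μ n)] (h : ApproxEqualLaws μ ν) :
    ∃ e : ℕ → ℝ≥0∞, Tendsto e atTop (𝓝 0) ∧
      ∀ n (S : Set (E n)), μ n S ≤ ν n S + e n ∧ ν n S ≤ μ n S + e n := by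
  obtain ⟨γ, hγ, hlim⟩ := h
  have (n : ℕ) : IsProbabilityMeasure (γ n) :=
    have : IsProbabilityMeasure ((γ n).map Prod.fst) := (hγ n).1 ▸ inferInstance
    Measure.isProbabilityMeasure_of_map (μ := γ n) Prod.fst
  refine ⟨fun n => γ n {p | p.1 = p.2}ᶜ, ?_, fun n S => ?_⟩
  · have hsub := ENNReal.Tendsto.sub tendsto_const_nhds hlim (.inl ENNReal.one_ne_top)
    rw [tsub_self] at hsub
    exact hsub.congr fun n => (prob_compl_eq_one_sub .of_discrete).symm
  · rw [← (hγ n).1, ← (hγ n).2, Measure.map_apply measurable_fst .of_discrete,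
      Measure.map_apply measurable_snd .of_discrete]
    refine ⟨measure_preimage_le_add_measure_ne _ _ _ _, ?_⟩
    convert measure_preimage_le_add_measure_ne (γ n) Prod.snd Prod.fst S using 3
    ext p
    exact not_congr eq_comm

end Coupling

section Transfer

theorem tendsto_probabilityMeasure_of_le_add {Ω : Type*} [MeasurableSpace Ω]
    [PseudoEMetricSpace Ω] [OpensMeasurableSpace Ω]
    {μs νs : ℕ → ProbabilityMeasure Ω} {μ : ProbabilityMeasure Ω} {e : ℕ → ℝ≥0∞}
    (he : Tendsto e atTop (𝓝 0))
    (hle : ∀ᶠ n in atTop, ∀ G : Set Ω, IsOpen G →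
      (νs n : Measure Ω) G ≤ (μs n : Measure Ω) G + e n)
    (h : Tendsto νs atTop (𝓝 μ)) : Tendsto μs atTop (𝓝 μ) := by
  refine tendsto_of_forall_isOpen_le_liminf' fun G hG =>
    (ProbabilityMeasure.le_liminf_measure_open_of_tendsto h hG).trans
      (ENNReal.le_of_forall_pos_le_add fun ε hε _ => ?_)
  calc liminf (fun n => (νs n : Measure Ω) G) atTop
      ≤ liminf (fun n => (μs n : Measure Ω) G + ε) atTop := by
        refine liminf_le_liminf ?_
        filter_upwards [hle, he.eventually (Iic_mem_nhds (ENNReal.coe_pos.2 hε))] with n hn hen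
        exact (hn G hG).trans (add_le_add_right hen _)
    _ = liminf (fun n => (μs n : Measure Ω) G) atTop + ε :=
        liminf_add_const _ _ _ isCobounded_ge_of_top isBounded_ge_of_bot

theorem exists_measure_le_abs_lt (W : Measure ℝ) [IsFiniteMeasure W] {ε : ℝ≥0∞} (hε : 0 < ε) :
    ∃ K : ℝ, W {x | K ≤ |x|} < ε := by
  have hanti : Antitone fun K : ℕ => {x : ℝ | (K : ℝ) ≤ |x|} := fun _ _ hK x hx =>
    show _ ≤ |x| from (Nat.cast_le.2 hK).trans hx
  have hlim := tendsto_measure_iInter_atTop (μ := W)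
    (fun K => (measurableSet_le measurable_const (by fun_prop)).nullMeasurableSet) hanti
    ⟨0, measure_ne_top _ _⟩
  have hempty : ⋂ K : ℕ, {x : ℝ | (K : ℝ) ≤ |x|} = ∅ := by
    refine Set.eq_empty_iff_forall_notMem.2 fun x hx => ?_
    obtain ⟨K, hK⟩ := exists_nat_gt |x|
    exact hK.not_ge (Set.mem_iInter.1 hx K)
  rw [hempty, measure_empty] at hlim
  obtain ⟨K, hK⟩ := (hlim.eventually (Iio_mem_nhds hε)).exists
  exact ⟨K, hK⟩

section AsympEqualInLaw

variable {E F : ℕ → Type*} [∀ n, MeasurableSpace (E n)] [∀ n, MeasurableSpace (F n)]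

/-- The laws of the random variables `X n` on `(E n, A n)` and `Y n` on `(F n, B n)` are equal up
to an error tending to `0`. The error is uniform over all sets, measurable or not: in the
applications the probability spaces are discrete. -/
def AsympEqualInLaw {S : Type*} (A : ∀ n, Measure (E n)) (X : ∀ n, E n → S)
    (B : ∀ n, Measure (F n)) (Y : ∀ n, F n → S) : Prop :=
  ∃ e : ℕ → ℝ≥0∞, Tendsto e atTop (𝓝 0) ∧ ∀ᶠ n in atTop, ∀ T : Set S,
    A n (X n ⁻¹' T) ≤ B n (Y n ⁻¹' T) + e n ∧ B n (Y n ⁻¹' T) ≤ A n (X n ⁻¹' T) + e n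

namespace AsympEqualInLaw

variable {A : ∀ n, Measure (E n)} {B : ∀ n, Measure (F n)}

theorem comp {S S' : Type*} {X : ∀ n, E n → S} {Y : ∀ n, F n → S} (h : AsympEqualInLaw A X B Y)
    (f : ℕ → S → S') :
    AsympEqualInLaw A (fun n y => f n (X n y)) B (fun n x => f n (Y n x)) := by
  obtain ⟨e, he, hle⟩ := h
  exact ⟨e, he, hle.mono fun n hn T => hn (f n ⁻¹' T)⟩

variable {X : ∀ n, E n → ℝ} {Y : ∀ n, F n → ℝ}

theorem isLittleOp {a : ℕ → ℝ} (h : AsympEqualInLaw A X B Y) (hY : IsLittleOp B Y a) :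
    IsLittleOp A X a := by
  obtain ⟨e, he, hle⟩ := h
  intro ε hε
  have hlim := (hY ε hε).add he
  rw [add_zero] at hlim
  exact tendsto_of_tendsto_of_tendsto_of_le_of_le' tendsto_const_nhds hlim
    (.of_forall fun n => zero_le) (hle.mono fun n hn => (hn {x | ε ≤ |x / a n|}).1)

theorem tendstoInDistribution [∀ n, IsProbabilityMeasure (A n)] (h : AsympEqualInLaw A X B Y)
    (hX : ∀ n, Measurable (X n)) (hY : ∀ n, Measurable (Y n)) {νs : ℕ → ProbabilityMeasure ℝ}
    (hνs : ∀ n, (νs n : Measure ℝ) = (B n).map (Y n)) {W : ProbabilityMeasure ℝ}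
    (hlim : Tendsto νs atTop (𝓝 W)) :
    TendstoInDistribution X atTop (fun x : ℝ => x) A (W : Measure ℝ) := by
  obtain ⟨e, he, hle⟩ := h
  refine ⟨fun n => (hX n).aemeasurable, by fun_prop, ?_⟩
  convert! tendsto_probabilityMeasure_of_le_add (Ω := ℝ) he ?_ hlim
  · exact congrArg 𝓝 (Subtype.ext Measure.map_id)
  · filter_upwards [hle] with n hn G hG
    rw [hνs, ProbabilityMeasure.coe_mk, Measure.map_apply (hY n) hG.measurableSet,
      Measure.map_apply (hX n) hG.measurableSet]
    exact (hn G).2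

end AsympEqualInLaw

theorem ApproxEqualLaws.asympEqualInLaw {G : ℕ → Type*} [∀ n, MeasurableSpace (G n)]
    [∀ n, Countable (G n)] [∀ n, DiscreteMeasurableSpace (G n)] {S : Type*}
    {A : ∀ n, Measure (E n)} [∀ n, IsProbabilityMeasure (A n)] {B : ∀ n, Measure (F n)}
    {f : ∀ n, E n → G n} {g : ∀ n, F n → G n} {X : ∀ n, E n → S} {Y : ∀ n, F n → S}
    (h : ApproxEqualLaws (fun n => (A n).map (f n)) (fun n => (B n).map (g n)))
    (hf : ∀ n, Measurable (f n)) (hg : ∀ n, Measurable (g n))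
    (hXY : ∀ᶠ n in atTop, ∃ φ : G n → S, X n = φ ∘ f n ∧ Y n = φ ∘ g n) :
    AsympEqualInLaw A X B Y := by
  have (n : ℕ) : IsProbabilityMeasure ((A n).map (f n)) :=
    Measure.isProbabilityMeasure_map (hf n).aemeasurable
  obtain ⟨e, he, hle⟩ := h.exists_error
  refine ⟨e, he, hXY.mono fun n hn T => ?_⟩
  obtain ⟨φ, hX, hY⟩ := hn
  have hn := hle n (φ ⁻¹' T)
  rwa [Measure.map_apply (hf n) .of_discrete, Measure.map_apply (hg n) .of_discrete,
    ← Set.preimage_comp, ← Set.preimage_comp, ← hX, ← hY] at hn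

end AsympEqualInLaw

theorem isBigOp_of_tendstoInDistribution {E : ℕ → Type*} [∀ n, MeasurableSpace (E n)]
    {A : ∀ n, Measure (E n)} [∀ n, IsProbabilityMeasure (A n)] {X Y : ∀ n, E n → ℝ} {a : ℕ → ℝ}
    {W : ProbabilityMeasure ℝ} (hX : ∀ n, Measurable (X n))
    (h : TendstoInDistribution X atTop (fun x : ℝ => x) A (W : Measure ℝ))
    (hXY : ∀ᶠ n in atTop, ∀ y, |Y n y / a n| = |X n y|) : IsBigOp A Y a := by
  intro ε hε
  obtain ⟨K, hK⟩ := exists_measure_le_abs_lt (W : Measure ℝ) hε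
  have hclosed : IsClosed {x : ℝ | K ≤ |x|} := isClosed_le continuous_const continuous_abs
  have hlimsup := ProbabilityMeasure.limsup_measure_closed_le_of_tendsto h.tendsto hclosed
  rw [ProbabilityMeasure.coe_mk, show (W : Measure ℝ).map (fun x : ℝ => x) = W from
    Measure.map_id] at hlimsup
  refine ⟨K, ?_⟩
  filter_upwards [eventually_lt_of_limsup_lt (hlimsup.trans_lt hK), hXY] with n hn hn'
  rw [ProbabilityMeasure.coe_mk, Measure.map_apply (hX n) hclosed.measurableSet] at hn
  refine (measure_mono fun y (hy : K < |Y n y / a n|) => ?_).trans hn.le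
  exact (hn' y ▸ hy).le

end Transfer

section ConditionedLaw

variable {P : Measure ℕ} [IsProbabilityMeasure P] {c β : ℝ}

theorem exists_integrable_rpow (hβ : 2 < β)
    (h : (fun k => P.real {k}) ~[atTop] fun k : ℕ => c * (k : ℝ) ^ (-β)) :
    ∃ γ : ℝ, 1 < γ ∧ γ ≤ 2 ∧ Integrable (fun k : ℕ => (k : ℝ) ^ γ) P := by
  obtain ⟨γ, hγ1, hγ⟩ := exists_between (lt_min (by linarith) one_lt_two : 1 < min (β - 1) 2)
  exact ⟨γ, hγ1, (hγ.trans_le (min_le_right _ _)).le,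
    integrable_rpow h (hγ.trans_le (min_le_left _ _))⟩

theorem integrable_natCast (hβ : 2 < β)
    (h : (fun k => P.real {k}) ~[atTop] fun k : ℕ => c * (k : ℝ) ^ (-β)) :
    Integrable (fun k : ℕ => (k : ℝ)) P := by
  simpa only [Real.rpow_one] using integrable_rpow (γ := 1) h (by linarith)

variable {lam : ℝ} {m : ℕ → ℕ}

theorem tendsto_measureReal_sum_eq (hc : 0 ≤ c) (hβ : 2 < β)
    (h : (fun k => P.real {k}) ~[atTop] fun k : ℕ => c * (k : ℝ) ^ (-β))
    (hm : Tendsto (fun n : ℕ => (m n : ℝ) / n) atTop (𝓝 lam))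
    (hlam : ∫ k : ℕ, (k : ℝ) ∂P < lam) :
    Tendsto (fun n : ℕ => (n : ℝ) ^ (β - 1) *
      (Measure.pi fun _ : Fin n => P).real {y | ∑ l, y l = m n}) atTop
      (𝓝 (c * (lam - ∫ k : ℕ, (k : ℝ) ∂P) ^ (-β))) := by
  have hint := integrable_natCast hβ h
  obtain ⟨γ, hγ1, hγ2, hintγ⟩ := exists_integrable_rpow hβ h
  refine tendsto_order.2 ⟨fun a ha => ?_, fun a ha => ?_⟩
  · obtain ⟨δ, hδ, hlower⟩ :=
      exists_forall_le_measureReal_orderedVector_mem h hm hlam (half_pos (sub_pos.2 ha))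
    have htypical := (tendsto_measureReal_typicalSet hint hδ).const_mul
      (c * (lam - ∫ k : ℕ, (k : ℝ) ∂P) ^ (-β) - (c * (lam - ∫ k : ℕ, (k : ℝ) ∂P) ^ (-β) - a) / 2)
    filter_upwards [hlower, htypical.eventually (Ioi_mem_nhds (by linarith : a < _))]
      with n hn hna
    simpa only [Set.preimage_univ, Set.inter_univ, Set.mem_univ, and_true] using
      lt_of_lt_of_le hna (by simpa using hn Set.univ)
  · filter_upwards [eventually_rpow_mul_measureReal_sum_eq_le hc (by linarith) h hγ1 hγ2 hint hintγ
      hm hlam (half_pos (sub_pos.2 ha))] with n hn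
    linarith

theorem approxEqualLaws_orderedVector (hc : 0 < c) (hβ : 2 < β)
    (h : (fun k => P.real {k}) ~[atTop] fun k : ℕ => c * (k : ℝ) ^ (-β))
    (hm : Tendsto (fun n : ℕ => (m n : ℝ) / n) atTop (𝓝 lam))
    (hlam : ∫ k : ℕ, (k : ℝ) ∂P < lam)
    (A : ∀ n, Measure (Fin n → ℕ)) [∀ n, IsProbabilityMeasure (A n)]
    (hA : ∀ᶠ n in atTop,
      A n = ProbabilityTheory.cond (Measure.pi fun _ : Fin n => P) {y | ∑ l, y l = m n}) :
    ApproxEqualLaws (fun n => (A n).map orderedVector)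
      (fun n => (Measure.pi fun _ : Fin (n - 1) => P).map (comparisonVector (m n))) := by
  have hL : 0 < c * (lam - ∫ k : ℕ, (k : ℝ) ∂P) ^ (-β) :=
    mul_pos hc (Real.rpow_pos_of_pos (sub_pos.2 hlam) _)
  set L := c * (lam - ∫ k : ℕ, (k : ℝ) ∂P) ^ (-β)
  have hsum := tendsto_measureReal_sum_eq hc.le hβ h hm hlam
  have (n : ℕ) : IsProbabilityMeasure ((A n).map orderedVector) :=
    Measure.isProbabilityMeasure_map Measurable.of_discrete.aemeasurable
  have (n : ℕ) : IsProbabilityMeasure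
      ((Measure.pi fun _ : Fin (n - 1) => P).map (comparisonVector (n := n) (m n))) :=
    Measure.isProbabilityMeasure_map Measurable.of_discrete.aemeasurable
  refine approxEqualLaws_of_forall_mul_le _ _ fun ε hε => ?_
  obtain ⟨δ, hδ, hlower⟩ := exists_forall_le_measureReal_orderedVector_mem h hm hlam
    (show 0 < ε * L / 2 by positivity)
  filter_upwards [hA, hlower, hsum.eventually (Ioi_mem_nhds hL),
    (hsum.const_mul (1 - ε)).eventually
      (Iic_mem_nhds (show (1 - ε) * L < L - ε * L / 2 by nlinarith [mul_pos hε hL])),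
    (tendsto_measureReal_typicalSet (integrable_natCast hβ h) hδ).eventually
      (Ici_mem_nhds (show 1 - ε < 1 by linarith))] with n hAn hn hpos hle htypical
  have hpow : 0 ≤ (n : ℝ) ^ (β - 1) := Real.rpow_nonneg n.cast_nonneg _
  have hmeas : Measurable (comparisonVector (n := n) (m n)) := .of_discrete
  refine ⟨((Measure.pi fun _ : Fin (n - 1) => P).restrict
    (typicalSet (∫ k : ℕ, (k : ℝ) ∂P) δ n)).map (comparisonVector (m n)),
    Measure.map_mono Measure.restrict_le_self hmeas, ?_, fun B => ?_⟩
  · rwa [map_measureReal_apply hmeas .univ, Set.preimage_univ, measureReal_restrict_apply .univ,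
      Set.univ_inter]
  · rw [map_measureReal_apply hmeas .of_discrete, measureReal_restrict_apply .of_discrete,
      map_measureReal_apply .of_discrete .of_discrete, hAn, Set.inter_comm,
      measureReal_def (ProbabilityTheory.cond _ _), cond_apply .of_discrete, ENNReal.toReal_mul,
      ENNReal.toReal_inv, inv_mul_eq_div, ← measureReal_def, ← measureReal_def,
      le_div_iff₀ (pos_of_mul_pos_right hpos hpow)]
    refine le_of_mul_le_mul_left ?_ (pos_of_mul_pos_left hpos measureReal_nonneg)
    refine le_trans ?_ (hn B)
    refine le_of_eq_of_le ?_ (mul_le_mul_of_nonneg_right hle measureReal_nonneg)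
    ring

end ConditionedLaw

section StableKernel

/-- The compensated exponential `e^{-ty} - 1 + ty`, whose integral against the jump measure
`y^{-(α+1)} dy` is the exponent of the `α`-stable Laplace transform. -/
noncomputable def stableKernel (t : ℂ) (y : ℝ) : ℂ := Complex.exp (-(t * y)) - 1 + t * y

theorem norm_exp_neg_le_one {z : ℂ} (hz : 0 ≤ z.re) : ‖Complex.exp (-z)‖ ≤ 1 := by
  rw [Complex.norm_exp, Real.exp_le_one_iff, Complex.neg_re]
  linarith

theorem norm_one_sub_exp_neg_le {z : ℂ} (hz : 0 ≤ z.re) :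
    ‖1 - Complex.exp (-z)‖ ≤ 2 * min ‖z‖ 1 := by
  rw [norm_sub_rev]
  rcases le_or_gt ‖z‖ 1 with h | h
  · rw [min_eq_left h]
    simpa only [norm_neg] using Complex.norm_exp_sub_one_le (x := -z) (by rwa [norm_neg])
  · rw [min_eq_right h.le]
    linarith [norm_sub_le (Complex.exp (-z)) 1, norm_exp_neg_le_one hz, norm_one (α := ℂ)]

theorem norm_exp_neg_sub_one_add_le {z : ℂ} (hz : 0 ≤ z.re) :
    ‖Complex.exp (-z) - 1 + z‖ ≤ 3 * min (‖z‖ ^ 2) ‖z‖ := by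
  rcases le_or_gt ‖z‖ 1 with h | h
  · have hsq : ‖z‖ ^ 2 ≤ ‖z‖ := by nlinarith [norm_nonneg z]
    have htaylor := Complex.norm_exp_sub_one_sub_id_le (x := -z) (by rwa [norm_neg])
    rw [norm_neg, sub_neg_eq_add] at htaylor
    rw [min_eq_left hsq]
    linarith [sq_nonneg ‖z‖]
  · rw [min_eq_right (by nlinarith)]
    linarith [norm_add_le (Complex.exp (-z) - 1) z, norm_sub_le (Complex.exp (-z)) 1,
      norm_exp_neg_le_one hz, norm_one (α := ℂ)]

variable {t : ℂ}

theorem re_mul_ofReal_nonneg (ht : 0 ≤ t.re) {y : ℝ} (hy : 0 ≤ y) : 0 ≤ (t * y).re := by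
  rw [Complex.re_mul_ofReal]
  exact mul_nonneg ht hy

theorem norm_mul_ofReal {y : ℝ} (hy : 0 ≤ y) : ‖t * (y : ℂ)‖ = ‖t‖ * y := by
  rw [norm_mul, Complex.norm_real, Real.norm_of_nonneg hy]

theorem norm_stableKernel_le (ht : 0 ≤ t.re) {y : ℝ} (hy : 0 ≤ y) :
    ‖stableKernel t y‖ ≤ 3 * (‖t‖ + ‖t‖ ^ 2) * min (y ^ (2 : ℝ)) (y ^ (1 : ℝ)) := by
  rw [Real.rpow_two, Real.rpow_one, mul_assoc]
  refine (norm_exp_neg_sub_one_add_le (re_mul_ofReal_nonneg ht hy)).trans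
    (mul_le_mul_of_nonneg_left ?_ zero_le_three)
  rw [norm_mul_ofReal hy, mul_min_of_nonneg _ _ (by positivity : 0 ≤ ‖t‖ + ‖t‖ ^ 2)]
  refine min_le_min ?_ ?_
  · nlinarith [mul_nonneg (norm_nonneg t) (sq_nonneg y)]
  · nlinarith [mul_nonneg (sq_nonneg ‖t‖) hy]

theorem norm_mul_one_sub_exp_neg_le (ht : 0 ≤ t.re) {y : ℝ} (hy : 0 ≤ y) :
    ‖t * (1 - Complex.exp (-(t * y)))‖ ≤
      2 * (‖t‖ + ‖t‖ ^ 2) * min (y ^ (1 : ℝ)) (y ^ (0 : ℝ)) := by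
  rw [Real.rpow_zero, Real.rpow_one, norm_mul]
  calc ‖t‖ * ‖1 - Complex.exp (-(t * y))‖ ≤ ‖t‖ * (2 * min (‖t‖ * y) 1) := by
        rw [← norm_mul_ofReal hy]
        gcongr
        exact norm_one_sub_exp_neg_le (re_mul_ofReal_nonneg ht hy)
    _ = 2 * min (‖t‖ ^ 2 * y) ‖t‖ := by
        rw [mul_left_comm, mul_min_of_nonneg _ _ (norm_nonneg t), mul_one, ← mul_assoc, ← sq]
    _ ≤ 2 * ((‖t‖ + ‖t‖ ^ 2) * min y 1) := by
        rw [mul_min_of_nonneg _ _ (by positivity : 0 ≤ ‖t‖ + ‖t‖ ^ 2)]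
        gcongr
        · linarith [norm_nonneg t]
        · linarith [sq_nonneg ‖t‖]
    _ = 2 * (‖t‖ + ‖t‖ ^ 2) * min y 1 := (mul_assoc _ _ _).symm

theorem continuous_stableKernel (t : ℂ) : Continuous (stableKernel t) := by
  unfold stableKernel
  fun_prop

theorem hasDerivAt_mul_one_sub_exp_neg (t : ℂ) (y : ℝ) :
    HasDerivAt (fun y : ℝ => t * (1 - Complex.exp (-(t * y))))
      (t ^ 2 * Complex.exp (-(t * y))) y := by
  have hlin : HasDerivAt (fun y : ℝ => t * (y : ℂ)) t y := by
    simpa only [Complex.ofRealCLM_apply, Complex.ofReal_one, mul_one] using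
      (Complex.ofRealCLM.hasDerivAt (x := y)).const_mul t
  exact ((hlin.fun_neg.cexp.const_sub 1).const_mul t).congr_deriv (by ring)

theorem hasDerivAt_stableKernel (t : ℂ) (y : ℝ) :
    HasDerivAt (stableKernel t) (t * (1 - Complex.exp (-(t * y)))) y := by
  have hlin : HasDerivAt (fun y : ℝ => t * (y : ℂ)) t y := by
    simpa only [Complex.ofRealCLM_apply, Complex.ofReal_one, mul_one] using
      (Complex.ofRealCLM.hasDerivAt (x := y)).const_mul t
  exact ((hlin.fun_neg.cexp.sub_const 1).add hlin).congr_deriv (by ring)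

section PowerWeight

variable {E : Type*} [NormedAddCommGroup E] {f f' : ℝ → E} {s a b C : ℝ}

theorem rpow_neg_mul_norm_le (hf : ∀ y, 0 < y → ‖f y‖ ≤ C * min (y ^ a) (y ^ b)) (s : ℝ) {y : ℝ}
    (hy : 0 < y) : y ^ (-s) * ‖f y‖ ≤ C * min (y ^ (a - s)) (y ^ (b - s)) := by
  rw [sub_eq_neg_add, sub_eq_neg_add, Real.rpow_add hy, Real.rpow_add hy,
    ← mul_min_of_nonneg _ _ (Real.rpow_nonneg hy.le _), mul_left_comm]
  exact mul_le_mul_of_nonneg_left (hf y hy) (Real.rpow_nonneg hy.le _)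

variable [NormedSpace ℝ E]

theorem norm_rpow_neg_smul_le (hf : ∀ y, 0 < y → ‖f y‖ ≤ C * min (y ^ a) (y ^ b)) (s : ℝ) {y : ℝ}
    (hy : 0 < y) : ‖y ^ (-s) • f y‖ ≤ C * min (y ^ (a - s)) (y ^ (b - s)) := by
  rw [norm_smul, Real.norm_of_nonneg (Real.rpow_nonneg hy.le _)]
  exact rpow_neg_mul_norm_le hf s hy

theorem integrableOn_rpow_neg_smul (ha : s < a + 1) (hb : b + 1 < s)
    (hfm : AEStronglyMeasurable f (volume.restrict (Set.Ioi 0)))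
    (hf : ∀ y, 0 < y → ‖f y‖ ≤ C * min (y ^ a) (y ^ b)) :
    IntegrableOn (fun y => y ^ (-s) • f y) (Set.Ioi 0) :=
  Integrable.mono'
    ((integrableOn_Ioi_min_rpow (a := a - s) (b := b - s) (by linarith) (by linarith)).const_mul C)
    ((Measurable.aestronglyMeasurable (by fun_prop)).smul hfm)
    (ae_restrict_of_forall_mem measurableSet_Ioi fun _ hy => norm_rpow_neg_smul_le hf s hy)

theorem tendsto_rpow_neg_smul_nhdsGT_zero (ha : s < a) (hC : 0 ≤ C)
    (hf : ∀ y, 0 < y → ‖f y‖ ≤ C * min (y ^ a) (y ^ b)) :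
    Tendsto (fun y => y ^ (-s) • f y) (𝓝[>] 0) (𝓝 0) := by
  have hlim : Tendsto (fun y : ℝ => C * y ^ (a - s)) (𝓝[>] 0) (𝓝 0) := by
    have hcont := (Real.continuousAt_rpow_const 0 (a - s) (.inr (sub_pos.2 ha).le)).tendsto
    rw [Real.zero_rpow (sub_pos.2 ha).ne'] at hcont
    simpa only [mul_zero] using (hcont.mono_left nhdsWithin_le_nhds).const_mul C
  refine squeeze_zero_norm' ?_ hlim
  filter_upwards [self_mem_nhdsWithin] with y hy
  exact (norm_rpow_neg_smul_le hf s hy).trans (by gcongr; exact min_le_left _ _)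

theorem tendsto_rpow_neg_smul_atTop (hb : b < s) (hC : 0 ≤ C)
    (hf : ∀ y, 0 < y → ‖f y‖ ≤ C * min (y ^ a) (y ^ b)) :
    Tendsto (fun y => y ^ (-s) • f y) atTop (𝓝 0) := by
  have hlim : Tendsto (fun y : ℝ => C * y ^ (b - s)) atTop (𝓝 0) := by
    simpa only [neg_sub, mul_zero] using (tendsto_rpow_neg_atTop (sub_pos.2 hb)).const_mul C
  refine squeeze_zero_norm' ?_ hlim
  filter_upwards [eventually_gt_atTop 0] with y hy
  exact (norm_rpow_neg_smul_le hf s hy).trans (by gcongr; exact min_le_right _ _)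

theorem integral_rpow_neg_smul_of_hasDerivAt [CompleteSpace E] (hs : s ≠ 0) (ha : s < a)
    (hb : b < s) (hC : 0 ≤ C) (hderiv : ∀ y, 0 < y → HasDerivAt f (f' y) y)
    (hf : ∀ y, 0 < y → ‖f y‖ ≤ C * min (y ^ a) (y ^ b))
    (hf' : IntegrableOn (fun y => y ^ (-s) • f' y) (Set.Ioi 0)) :
    ∫ y in Set.Ioi 0, y ^ (-(s + 1)) • f y = s⁻¹ • ∫ y in Set.Ioi 0, y ^ (-s) • f' y := by
  have hcont : ContinuousOn f (Set.Ioi 0) := fun y hy =>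
    (hderiv y hy).continuousAt.continuousWithinAt
  have hint : IntegrableOn (fun y => y ^ (-(s + 1)) • f y) (Set.Ioi 0) :=
    integrableOn_rpow_neg_smul (by linarith) (by linarith)
      (hcont.aestronglyMeasurable measurableSet_Ioi) hf
  have hsmul : IntegrableOn (fun y => (-s) • y ^ (-(s + 1)) • f y) (Set.Ioi 0) := hint.smul (-s)
  have hderiv' (y : ℝ) (hy : y ∈ Set.Ioi 0) : HasDerivAt (fun y => y ^ (-s) • f y)
      (y ^ (-s) • f' y + (-s) • y ^ (-(s + 1)) • f y) y := by
    rw [smul_smul, neg_add']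
    exact (Real.hasDerivAt_rpow_const (.inl hy.ne')).smul (hderiv y hy)
  have hzero : ContinuousWithinAt (Function.update (fun y => y ^ (-s) • f y) 0 0) (Set.Ici 0) 0 :=
    continuousWithinAt_update_same.2
      (by simpa only [Set.Ici_sdiff_left] using tendsto_rpow_neg_smul_nhdsGT_zero ha hC hf)
  have hftc := integral_Ioi_of_hasDerivAt_of_tendsto hzero
    (fun y hy => (hderiv' y hy).congr_of_eventuallyEq <|
      (eventually_ne_nhds hy.ne').mono fun _ hne => Function.update_of_ne hne _ _)
    (hf'.add hsmul)
    ((tendsto_rpow_neg_smul_atTop hb hC hf).congr' <|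
      (eventually_ne_atTop 0).mono fun _ hne => (Function.update_of_ne hne _ _).symm)
  rw [Function.update_self, sub_zero, integral_add hf' hsmul, integral_smul, neg_smul,
    ← sub_eq_add_neg, sub_eq_zero] at hftc
  rw [hftc, smul_smul, inv_mul_cancel₀ hs, one_smul]

end PowerWeight

theorem eqOn_re_pos_of_forall_ofReal {f g : ℂ → ℂ} (hf : AnalyticOnNhd ℂ f {z | 0 < z.re})
    (hg : AnalyticOnNhd ℂ g {z | 0 < z.re}) (h : ∀ r : ℝ, 0 < r → f r = g r) :
    Set.EqOn f g {z | 0 < z.re} := by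
  refine hf.eqOn_of_preconnected_of_frequently_eq hg (convex_halfSpace_re_gt 0).isPreconnected
    (show 0 < ((1 : ℝ) : ℂ).re from one_pos) ?_
  have hofReal : Tendsto ((↑) : ℝ → ℂ) (𝓝[≠] 1) (𝓝[≠] ((1 : ℝ) : ℂ)) :=
    Complex.continuous_ofReal.continuousWithinAt.tendsto_nhdsWithin fun _ hr =>
      Complex.ofReal_injective.ne hr
  exact hofReal.frequently (((eventually_gt_nhds one_pos).filter_mono nhdsWithin_le_nhds).mono
    h).frequently

theorem integrableOn_rpow_smul_cexp {s : ℝ} (hs : 0 < s) (ht : 0 < t.re) :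
    IntegrableOn (fun x : ℝ => x ^ (s - 1) • Complex.exp (-(t * x))) (Set.Ioi 0) := by
  have hreal := integrableOn_rpow_mul_exp_neg_mul_rpow (s := s - 1) (p := 1) (b := t.re)
    (by linarith) one_pos ht
  refine Integrable.mono' hreal (Measurable.aestronglyMeasurable (by fun_prop))
    (ae_restrict_of_forall_mem measurableSet_Ioi fun y hy => ?_)
  rw [norm_smul, Real.norm_of_nonneg (Real.rpow_nonneg (le_of_lt hy) _), Complex.norm_exp,
    Complex.neg_re, Complex.re_mul_ofReal, Real.rpow_one, neg_mul]

theorem analyticOnNhd_integral_rpow_smul_cexp {s : ℝ} (hs : 0 < s) :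
    AnalyticOnNhd ℂ (fun t : ℂ => ∫ x : ℝ in Set.Ioi 0, x ^ (s - 1) • Complex.exp (-(t * x)))
      {t | 0 < t.re} := by
  let μ := (volume.restrict (Set.Ioi 0)).withDensity fun x : ℝ => ENNReal.ofReal (x ^ (s - 1))
  have hdensity : Measurable fun x : ℝ => ENNReal.ofReal (x ^ (s - 1)) := by fun_prop
  have htoReal (x : ℝ) (hx : x ∈ Set.Ioi 0) : (ENNReal.ofReal (x ^ (s - 1))).toReal = x ^ (s - 1) :=
    ENNReal.toReal_ofReal (Real.rpow_nonneg (le_of_lt hx) _)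
  have hmgf : complexMGF Neg.neg μ =
      fun t : ℂ => ∫ x : ℝ in Set.Ioi 0, x ^ (s - 1) • Complex.exp (-(t * x)) := by
    funext t
    rw [complexMGF, integral_withDensity_eq_integral_toReal_smul hdensity
      (ae_of_all _ fun x => ENNReal.ofReal_lt_top)]
    refine setIntegral_congr_fun measurableSet_Ioi fun x hx => ?_
    simp only [htoReal x hx, Complex.ofReal_neg, mul_neg]
  have hexpSet : Set.Ioi 0 ⊆ integrableExpSet Neg.neg μ := fun r hr => by
    refine (integrable_withDensity_iff_integrable_smul' hdensity
      (ae_of_all _ fun x => ENNReal.ofReal_lt_top)).2 ?_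
    refine (integrableOn_congr_fun (fun x hx => ?_) measurableSet_Ioi).1
      (integrableOn_rpow_mul_exp_neg_mul_rpow (s := s - 1) (p := 1) (b := r) (by linarith)
        one_pos hr)
    simp only [htoReal x hx, smul_eq_mul, Real.rpow_one, mul_neg, neg_mul]
  rw [← hmgf]
  exact analyticOnNhd_complexMGF.mono fun z hz => interior_maximal hexpSet isOpen_Ioi hz

theorem integral_rpow_smul_cexp {s : ℝ} (hs : 0 < s) (ht : 0 < t.re) :
    ∫ x : ℝ in Set.Ioi 0, x ^ (s - 1) • Complex.exp (-(t * x)) =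
      Real.Gamma s * t ^ (-(s : ℂ)) := by
  have hpow : AnalyticOnNhd ℂ (fun z : ℂ => (Real.Gamma s : ℂ) * z ^ (-(s : ℂ))) {z | 0 < z.re} :=
    DifferentiableOn.analyticOnNhd (fun z hz => ((differentiableAt_id.cpow_const
      (.inl hz)).const_mul _).differentiableWithinAt)
      (isOpen_lt continuous_const Complex.continuous_re)
  refine eqOn_re_pos_of_forall_ofReal (analyticOnNhd_integral_rpow_smul_cexp hs) hpow
    (fun r hr => ?_) ht
  calc ∫ x : ℝ in Set.Ioi 0, x ^ (s - 1) • Complex.exp (-(r * x))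
      = ((∫ x : ℝ in Set.Ioi 0, x ^ (s - 1) * Real.exp (-(r * x)) : ℝ) : ℂ) := by
        rw [← integral_complex_ofReal]
        simp only [Complex.real_smul, Complex.ofReal_mul, Complex.ofReal_exp, Complex.ofReal_neg]
    _ = Real.Gamma s * r ^ (-(s : ℂ)) := by
        rw [Real.integral_rpow_mul_exp_neg_mul_Ioi hs hr, one_div, Real.inv_rpow hr.le,
          ← Real.rpow_neg hr.le, mul_comm, Complex.ofReal_mul, Complex.ofReal_cpow hr.le,
          Complex.ofReal_neg]

variable {α : ℝ}

theorem Gamma_two_sub (hα0 : α ≠ 0) (hα1 : α ≠ 1) :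
    Real.Gamma (2 - α) = α * (α - 1) * Real.Gamma (-α) := by
  rw [show 2 - α = -α + 1 + 1 by ring, Real.Gamma_add_one fun h => hα1 (by linarith),
    Real.Gamma_add_one (neg_ne_zero.2 hα0)]
  ring

theorem integral_stableKernel_of_re_pos (h1 : 1 < α) (h2 : α < 2) (ht : 0 < t.re) :
    ∫ y : ℝ in Set.Ioi 0, y ^ (-(α + 1)) • stableKernel t y =
      Real.Gamma (-α) * t ^ (α : ℂ) := by
  have ht0 : t ≠ 0 := by rintro rfl; exact ht.ne rfl
  have hderivInt : IntegrableOn (fun y : ℝ => y ^ (-α) • (t * (1 - Complex.exp (-(t * y)))))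
      (Set.Ioi 0) :=
    integrableOn_rpow_neg_smul (by linarith) (by linarith)
      (Measurable.aestronglyMeasurable (by fun_prop))
      fun y hy => norm_mul_one_sub_exp_neg_le ht.le hy.le
  have hexpEq (y : ℝ) : y ^ (-(α - 1)) • (t ^ 2 * Complex.exp (-(t * y))) =
      t ^ 2 * (y ^ (2 - α - 1) • Complex.exp (-(t * y))) := by
    rw [mul_smul_comm, show -(α - 1) = 2 - α - 1 by ring]
  have hexpInt := (integrableOn_rpow_smul_cexp (s := 2 - α) (by linarith) ht).const_mul (t ^ 2)
  have hsecond := integral_rpow_neg_smul_of_hasDerivAt (s := α - 1) (by linarith) (by linarith)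
    (by linarith) (by positivity) (fun y _ => hasDerivAt_mul_one_sub_exp_neg t y)
    (fun y hy => norm_mul_one_sub_exp_neg_le ht.le hy.le)
    (by simp only [hexpEq]; exact hexpInt)
  rw [sub_add_cancel] at hsecond
  rw [integral_rpow_neg_smul_of_hasDerivAt (by linarith) h2 h1 (by positivity)
    (fun y _ => hasDerivAt_stableKernel t y) (fun y hy => norm_stableKernel_le ht.le hy.le)
    hderivInt, hsecond]
  simp only [hexpEq]
  rw [integral_const_mul, integral_rpow_smul_cexp (by linarith) ht,
    Gamma_two_sub (by linarith) h1.ne', show -((2 - α : ℝ) : ℂ) = (α : ℂ) - 2 by push_cast; ring,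
    Complex.cpow_sub _ _ ht0, Complex.cpow_ofNat]
  have hα : (α : ℂ) ≠ 0 := Complex.ofReal_ne_zero.2 (by linarith)
  have hα' : (α : ℂ) - 1 ≠ 0 := by exact_mod_cast (sub_pos.2 h1).ne'
  simp only [Complex.real_smul]
  push_cast
  field_simp

theorem continuousOn_integral_stableKernel (h1 : 1 < α) (h2 : α < 2) :
    ContinuousOn (fun t : ℂ => ∫ y : ℝ in Set.Ioi 0, y ^ (-(α + 1)) • stableKernel t y)
      {t | 0 ≤ t.re} := by
  intro t _
  have hbound : IntegrableOn (fun y : ℝ => 3 * ((‖t‖ + 1) + (‖t‖ + 1) ^ 2) *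
      min (y ^ (2 - (α + 1))) (y ^ (1 - (α + 1)))) (Set.Ioi 0) :=
    (integrableOn_Ioi_min_rpow (by linarith) (by linarith)).const_mul _
  refine continuousWithinAt_of_dominated
    (.of_forall fun z => Measurable.aestronglyMeasurable
      ((measurable_id.pow_const _).smul (continuous_stableKernel z).measurable)) ?_ hbound
    (ae_of_all _ fun y => by unfold stableKernel; fun_prop)
  have hnorm : ∀ᶠ z in 𝓝 t, ‖z‖ < ‖t‖ + 1 :=
    continuous_norm.continuousAt.eventually (gt_mem_nhds (lt_add_one _))
  filter_upwards [self_mem_nhdsWithin, hnorm.filter_mono nhdsWithin_le_nhds] with z hz hzt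
  refine ae_restrict_of_forall_mem measurableSet_Ioi fun y hy => ?_
  have : 0 ≤ min (y ^ (2 - (α + 1))) (y ^ (1 - (α + 1))) :=
    le_min (Real.rpow_nonneg (le_of_lt hy) _) (Real.rpow_nonneg (le_of_lt hy) _)
  refine (norm_rpow_neg_smul_le (fun y hy => norm_stableKernel_le hz hy.le) (α + 1) hy).trans ?_
  gcongr

theorem integral_stableKernel (h1 : 1 < α) (h2 : α < 2) (ht : 0 ≤ t.re) :
    ∫ y : ℝ in Set.Ioi 0, y ^ (-(α + 1)) • stableKernel t y =
      Real.Gamma (-α) * t ^ (α : ℂ) := by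
  have hcont : ContinuousOn (fun z : ℂ => (Real.Gamma (-α) : ℂ) * z ^ (α : ℂ)) {z | 0 ≤ z.re} :=
    fun z hz => ((Complex.continuousAt_cpow_const_of_re_pos (.inl hz)
      (by rw [Complex.ofReal_re]; linarith)).const_mul _).continuousWithinAt
  refine Set.EqOn.of_subset_closure (s := {z : ℂ | 0 < z.re})
    (fun z hz => integral_stableKernel_of_re_pos h1 h2 hz)
    (continuousOn_integral_stableKernel h1 h2) hcont
    (Set.ofPred_subset_ofPred.2 fun _ => le_of_lt) ?_ ht
  rw [Complex.closure_setOfPred_lt_re]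

end StableKernel

section StableLimit

theorem norm_one_sub_mul_exp_sub_one_le {z : ℂ} (hz : ‖z‖ ≤ 1) :
    ‖(1 - z) * Complex.exp z - 1‖ ≤ 3 * ‖z‖ ^ 2 := by
  have hsub : ‖1 - z‖ ≤ 2 := (norm_sub_le _ _).trans (by rw [norm_one]; linarith)
  calc ‖(1 - z) * Complex.exp z - 1‖
      = ‖(1 - z) * (Complex.exp z - 1 - z) - z ^ 2‖ := by ring_nf
    _ ≤ ‖1 - z‖ * ‖Complex.exp z - 1 - z‖ + ‖z‖ ^ 2 := by
        rw [← norm_mul, ← norm_pow]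
        exact norm_sub_le _ _
    _ ≤ 2 * ‖z‖ ^ 2 + ‖z‖ ^ 2 := by
        gcongr
        exact Complex.norm_exp_sub_one_sub_id_le hz
    _ = 3 * ‖z‖ ^ 2 := by ring

theorem tendsto_natCast_mul_one_sub_mul_exp_sub_one {z : ℕ → ℂ}
    (hz : Tendsto (fun n : ℕ => (n : ℝ) * ‖z n‖ ^ 2) atTop (𝓝 0)) :
    Tendsto (fun n : ℕ => (n : ℂ) * ((1 - z n) * Complex.exp (z n) - 1)) atTop (𝓝 0) := by
  refine squeeze_zero_norm' ?_ (by simpa only [mul_zero] using hz.const_mul 3)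
  filter_upwards [hz.eventually (gt_mem_nhds one_pos), eventually_ge_atTop 1] with n hn hn1
  have hle : ‖z n‖ ^ 2 ≤ n * ‖z n‖ ^ 2 :=
    le_mul_of_one_le_left (sq_nonneg _) (Nat.one_le_cast.2 hn1)
  have hz1 : ‖z n‖ ≤ 1 := (sq_le_one_iff₀ (norm_nonneg _)).1 (hle.trans hn.le)
  rw [norm_mul, Complex.norm_natCast, mul_left_comm]
  exact mul_le_mul_of_nonneg_left (norm_one_sub_mul_exp_sub_one_le hz1) n.cast_nonneg

theorem tendsto_zero_of_natCast_mul {u : ℕ → ℂ} {L : ℂ}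
    (hu : Tendsto (fun n : ℕ => (n : ℂ) * u n) atTop (𝓝 L)) : Tendsto u atTop (𝓝 0) := by
  have hinv : Tendsto (fun n : ℕ => (n : ℂ)⁻¹) atTop (𝓝 0) := tendsto_inv_atTop_nhds_zero_nat
  have hmul := hinv.mul hu
  rw [zero_mul] at hmul
  refine hmul.congr' ?_
  filter_upwards [eventually_ne_atTop 0] with n hn
  exact inv_mul_cancel_left₀ (Nat.cast_ne_zero.2 hn) _

theorem tendsto_one_add_pow_pred_exp {u : ℕ → ℂ} {L : ℂ}
    (hu : Tendsto (fun n : ℕ => (n : ℂ) * u n) atTop (𝓝 L)) :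
    Tendsto (fun n : ℕ => (1 + u n) ^ (n - 1)) atTop (𝓝 (Complex.exp L)) := by
  have hone : Tendsto (fun n => 1 + u n) atTop (𝓝 1) := by
    simpa only [add_zero] using (tendsto_zero_of_natCast_mul hu).const_add 1
  have hdiv := (Complex.tendsto_one_add_pow_exp_of_tendsto hu).div hone one_ne_zero
  rw [div_one] at hdiv
  refine hdiv.congr' ?_
  filter_upwards [hone.eventually_ne one_ne_zero, eventually_ne_atTop 0] with n hn hn0
  exact (div_eq_iff hn).2 (pow_sub_one_mul hn0 _).symm

variable {P : Measure ℕ} [IsProbabilityMeasure P] {c β : ℝ} {t : ℂ}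

theorem integral_exp_neg_eq_add_integral_stableKernel (hint : Integrable (fun k : ℕ => (k : ℝ)) P)
    {t : ℂ} (ht : 0 ≤ t.re) {a : ℝ} (ha : 0 ≤ a) :
    ∫ k : ℕ, Complex.exp (-(t * (a * k : ℝ))) ∂P =
      1 - t * (a * ∫ k : ℕ, (k : ℝ) ∂P : ℝ) + ∫ k : ℕ, stableKernel t (a * k) ∂P := by
  have hexp : Integrable (fun k : ℕ => Complex.exp (-(t * (a * k : ℝ)))) P :=
    .of_bound Measurable.of_discrete.aestronglyMeasurable 1 (ae_of_all _ fun k =>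
      norm_exp_neg_le_one (re_mul_ofReal_nonneg ht (mul_nonneg ha k.cast_nonneg)))
  have hexp' : Integrable (fun k : ℕ => Complex.exp (-(t * (a * k : ℝ))) - 1) P :=
    hexp.sub (integrable_const _)
  have hlin : Integrable (fun k : ℕ => t * ((a * k : ℝ) : ℂ)) P :=
    (hint.const_mul a).ofReal.const_mul t
  unfold stableKernel
  rw [integral_add hexp' hlin, integral_sub hexp (integrable_const _), integral_const_mul,
    integral_complex_ofReal, integral_const_mul, integral_const, probReal_univ, one_smul]
  ring

theorem tendsto_natCast_mul_integral_stableKernel (hβ : 2 < β) (hβ3 : β < 3)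
    (h : (fun k => P.real {k}) ~[atTop] fun k : ℕ => c * (k : ℝ) ^ (-β)) (ht : 0 ≤ t.re) :
    Tendsto (fun n : ℕ => (n : ℂ) * ∫ k : ℕ, stableKernel t ((n : ℝ) ^ (-(1 / (β - 1))) * k) ∂P)
      atTop (𝓝 (c * Real.Gamma (-(β - 1)) * t ^ ((β - 1 : ℝ) : ℂ))) := by
  have hlim := tendsto_natCast_smul_integral_rpow_mul (by linarith) h (g := stableKernel t)
    (D := fun y => 3 * (‖t‖ + ‖t‖ ^ 2) * min (y ^ (2 - β)) (y ^ (1 - β)))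
    (by simp [stableKernel])
    (fun x hx y hy hxy => mul_le_mul_of_nonneg_left
      (antitoneOn_Ioi_min_rpow (by linarith) (by linarith) hx hy hxy) (by positivity))
    ((integrableOn_Ioi_min_rpow (by linarith) (by linarith)).const_mul _)
    (fun y hy => rpow_neg_mul_norm_le (fun y hy => norm_stableKernel_le ht hy.le) β hy)
    (ae_of_all _ fun y => (continuous_stableKernel t).continuousAt)
  have hintegral := integral_stableKernel (α := β - 1) (by linarith) (by linarith) ht
  rw [sub_add_cancel] at hintegral
  simp only [mul_smul, integral_smul, hintegral] at hlim
  simpa only [Complex.real_smul, ← mul_assoc, Complex.ofReal_natCast] using hlim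

/-- The law of `n^(-1/(β-1)) (∑ᵢ xᵢ - ν n)` for `n - 1` independent variables `xᵢ` with law `P`
and mean `ν`. -/
noncomputable def normalizedSumLaw (P : Measure ℕ) [IsProbabilityMeasure P] (β : ℝ) (n : ℕ) :
    ProbabilityMeasure ℝ :=
  ⟨(Measure.pi fun _ : Fin (n - 1) => P).map fun x =>
    (n : ℝ) ^ (-(1 / (β - 1))) * (∑ i, (x i : ℝ) - (∫ k : ℕ, (k : ℝ) ∂P) * n),
    Measure.isProbabilityMeasure_map Measurable.of_discrete.aemeasurable⟩

theorem integrable_cexp_normalizedSumLaw (β : ℝ) (n : ℕ) (ht : 0 ≤ t.re) :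
    Integrable (fun x : ℝ => Complex.exp (-(t * x))) (normalizedSumLaw P β n : Measure ℝ) := by
  have hcont : Continuous fun x : ℝ => Complex.exp (-(t * x)) := by fun_prop
  rw [normalizedSumLaw, ProbabilityMeasure.coe_mk, integrable_map_measure
    hcont.aestronglyMeasurable Measurable.of_discrete.aemeasurable]
  refine .of_bound Measurable.of_discrete.aestronglyMeasurable
    (Real.exp (t.re * ((n : ℝ) ^ (-(1 / (β - 1))) * ((∫ k : ℕ, (k : ℝ) ∂P) * n))))
    (ae_of_all _ fun x => ?_)
  rw [Function.comp_apply, Complex.norm_exp, Complex.neg_re, Complex.re_mul_ofReal]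
  have hsum : 0 ≤ t.re * ((n : ℝ) ^ (-(1 / (β - 1))) * ∑ i, (x i : ℝ)) := by positivity
  exact Real.exp_le_exp.2 (by linarith)

theorem integral_cexp_normalizedSumLaw (β : ℝ) (n : ℕ) (t : ℂ) :
    ∫ x : ℝ, Complex.exp (-(t * x)) ∂(normalizedSumLaw P β n : Measure ℝ) =
      (∫ k : ℕ, Complex.exp (-(t * ((n : ℝ) ^ (-(1 / (β - 1))) * k : ℝ))) ∂P) ^ (n - 1) *
        Complex.exp (t * ((n : ℝ) ^ (-(1 / (β - 1))) * ∫ k : ℕ, (k : ℝ) ∂P : ℝ)) ^ n := by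
  have hcont : Continuous fun x : ℝ => Complex.exp (-(t * x)) := by fun_prop
  have hpow := integral_fintype_prod_eq_pow (ι := Fin (n - 1)) (μ := P)
    (fun k : ℕ => Complex.exp (-(t * ((n : ℝ) ^ (-(1 / (β - 1))) * k : ℝ))))
  rw [Fintype.card_fin] at hpow
  rw [normalizedSumLaw, ProbabilityMeasure.coe_mk, integral_map
    Measurable.of_discrete.aemeasurable hcont.aestronglyMeasurable, ← hpow,
    ← integral_mul_const (Complex.exp _ ^ n)]
  refine integral_congr_ae (ae_of_all _ fun x => ?_)
  dsimp only
  rw [← Complex.exp_sum, ← Complex.exp_nat_mul, ← Complex.exp_add]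
  congr 1
  push_cast
  rw [Finset.sum_neg_distrib, ← Finset.mul_sum, ← Finset.mul_sum]
  ring

theorem tendsto_natCast_mul_norm_sq_rpow (hβ : 1 < β) (hβ3 : β < 3) (s : ℝ) (t : ℂ) :
    Tendsto (fun n : ℕ => (n : ℝ) * ‖t * ((n : ℝ) ^ (-(1 / (β - 1))) * s : ℝ)‖ ^ 2) atTop
      (𝓝 0) := by
  have hexponent : 0 < 2 / (β - 1) - 1 := by
    rw [sub_pos, lt_div_iff₀ (by linarith)]
    linarith
  have hlim := ((tendsto_rpow_neg_atTop hexponent).comp tendsto_natCast_atTop_atTop).const_mul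
    ((‖t‖ * |s|) ^ 2)
  rw [mul_zero] at hlim
  refine hlim.congr' ?_
  filter_upwards [eventually_gt_atTop 0] with n hn
  have hn0 : (0 : ℝ) < n := Nat.cast_pos.2 hn
  have hpow : (n : ℝ) ^ (-(2 / (β - 1) - 1)) = n * ((n : ℝ) ^ (-(1 / (β - 1)))) ^ 2 := by
    rw [show -(2 / (β - 1) - 1) = 1 + (-(1 / (β - 1))) * (2 : ℕ) by push_cast; ring,
      Real.rpow_add hn0, Real.rpow_one, Real.rpow_mul_natCast hn0.le]
  rw [Function.comp_apply, hpow, norm_mul, Complex.norm_real, Real.norm_eq_abs, abs_mul,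
    abs_of_nonneg (Real.rpow_nonneg hn0.le _)]
  ring

theorem tendsto_integral_cexp_normalizedSumLaw (hβ : 2 < β) (hβ3 : β < 3)
    (h : (fun k => P.real {k}) ~[atTop] fun k : ℕ => c * (k : ℝ) ^ (-β)) (ht : 0 ≤ t.re) :
    Tendsto (fun n : ℕ => ∫ x : ℝ, Complex.exp (-(t * x)) ∂(normalizedSumLaw P β n : Measure ℝ))
      atTop (𝓝 (Complex.exp (c * Real.Gamma (-(β - 1)) * t ^ ((β - 1 : ℝ) : ℂ)))) := by
  let z (n : ℕ) : ℂ := t * ((n : ℝ) ^ (-(1 / (β - 1))) * ∫ k : ℕ, (k : ℝ) ∂P : ℝ)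
  let K (n : ℕ) : ℂ := ∫ k : ℕ, stableKernel t ((n : ℝ) ^ (-(1 / (β - 1))) * k) ∂P
  have hz2 : Tendsto (fun n : ℕ => (n : ℝ) * ‖z n‖ ^ 2) atTop (𝓝 0) :=
    tendsto_natCast_mul_norm_sq_rpow (by linarith) hβ3 _ t
  have hexp : Tendsto (fun n => Complex.exp (z n)) atTop (𝓝 1) := by
    have hz : Tendsto z atTop (𝓝 0) := by
      have hrpow := (tendsto_rpow_neg_atTop (one_div_pos.2 (show 0 < β - 1 by linarith))).comp
        tendsto_natCast_atTop_atTop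
      have hreal := (hrpow.mul_const (∫ k : ℕ, (k : ℝ) ∂P)).ofReal.const_mul t
      rwa [zero_mul, Complex.ofReal_zero, mul_zero] at hreal
    simpa only [Complex.exp_zero] using hz.cexp
  have hfactor (n : ℕ) : (1 - z n + K n) * Complex.exp (z n) =
      1 + (((1 - z n) * Complex.exp (z n) - 1) + K n * Complex.exp (z n)) := by ring
  have hu : Tendsto (fun n : ℕ => (n : ℂ) *
      (((1 - z n) * Complex.exp (z n) - 1) + K n * Complex.exp (z n))) atTop
      (𝓝 (c * Real.Gamma (-(β - 1)) * t ^ ((β - 1 : ℝ) : ℂ))) := by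
    simpa only [mul_add, ← mul_assoc, zero_add, mul_one] using
      (tendsto_natCast_mul_one_sub_mul_exp_sub_one hz2).add
        ((tendsto_natCast_mul_integral_stableKernel hβ hβ3 h ht).mul hexp)
  have hlim := (tendsto_one_add_pow_pred_exp hu).mul hexp
  rw [mul_one] at hlim
  refine hlim.congr' ?_
  filter_upwards [eventually_ne_atTop 0] with n hn
  rw [integral_cexp_normalizedSumLaw, integral_exp_neg_eq_add_integral_stableKernel
    (integrable_natCast hβ h) ht (Real.rpow_nonneg n.cast_nonneg _), ← hfactor, mul_pow, mul_assoc,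
    pow_sub_one_mul hn]

end StableLimit

section WeakConvergence

section Clip

variable {E : Type*} [NormedAddCommGroup E] [NormedSpace ℝ E] {K : ℝ}

theorem norm_div_max_smul_le (hK : 0 < K) (z : E) : ‖(K / max K ‖z‖) • z‖ ≤ K := by
  rw [norm_smul, Real.norm_of_nonneg (by positivity), div_mul_eq_mul_div]
  exact div_le_of_le_mul₀ (by positivity) hK.le
    (mul_le_mul_of_nonneg_left (le_max_right _ _) hK.le)

theorem norm_div_max_smul_sub_le (hK : 0 < K) (z : E) :
    ‖(K / max K ‖z‖) • z - z‖ ≤ K⁻¹ * ‖z‖ ^ 2 := by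
  rcases le_or_gt ‖z‖ K with hz | hz
  · rw [max_eq_left hz, div_self hK.ne', one_smul, sub_self, norm_zero]
    positivity
  · have hz0 : 0 < ‖z‖ := hK.trans hz
    have hsub : ‖K / ‖z‖ - 1‖ ≤ 1 := by
      rw [Real.norm_eq_abs, abs_le]
      constructor <;> linarith [div_pos hK hz0, (div_le_one hz0).2 hz.le]
    calc ‖(K / max K ‖z‖) • z - z‖ = ‖K / ‖z‖ - 1‖ * ‖z‖ := by
          rw [max_eq_right hz.le, ← norm_smul, sub_smul, one_smul]
      _ ≤ (K⁻¹ * ‖z‖) * ‖z‖ := by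
          gcongr
          exact hsub.trans ((one_le_inv_mul₀ hK).2 hz.le)
      _ = K⁻¹ * ‖z‖ ^ 2 := by ring

theorem continuous_div_max_smul {Ω : Type*} [TopologicalSpace Ω] {f : Ω → E} (hf : Continuous f)
    (hK : 0 < K) : Continuous fun x => (K / max K ‖f x‖) • f x :=
  (continuous_const.div (continuous_const.max hf.norm) fun _ =>
    (lt_max_of_lt_left hK).ne').smul hf

theorem norm_integral_div_max_smul_sub_le {Ω : Type*} [MeasurableSpace Ω]
    [TopologicalSpace Ω] [OpensMeasurableSpace Ω] {f : Ω → ℂ} {M : ℝ} {ρ : Measure Ω}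
    [IsFiniteMeasure ρ] (hf : Continuous f) (hf2 : Integrable (fun x => ‖f x‖ ^ 2) ρ)
    (hM : ∫ x, ‖f x‖ ^ 2 ∂ρ ≤ M) (hK : 0 < K) :
    ‖∫ x, (K / max K ‖f x‖) • f x ∂ρ - ∫ x, f x ∂ρ‖ ≤ K⁻¹ * M := by
  have hfint : Integrable f ρ :=
    ((memLp_two_iff_integrable_sq_norm hf.measurable.aestronglyMeasurable).2 hf2).integrable
      one_le_two
  have hclip : Integrable (fun x => (K / max K ‖f x‖) • f x) ρ :=
    .of_bound (continuous_div_max_smul hf hK).measurable.aestronglyMeasurable K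
      (ae_of_all _ fun x => norm_div_max_smul_le hK (f x))
  rw [← integral_sub hclip hfint]
  refine (norm_integral_le_of_norm_le (hf2.const_mul K⁻¹)
    (ae_of_all _ fun x => norm_div_max_smul_sub_le hK (f x))).trans ?_
  rw [integral_const_mul]
  gcongr

end Clip

section TestFunctions

variable {Ω : Type*} [MeasurableSpace Ω] [TopologicalSpace Ω] [OpensMeasurableSpace Ω]
  [HasOuterApproxClosed Ω] {μs : ℕ → ProbabilityMeasure Ω} {μ : ProbabilityMeasure Ω} {M : ℝ}

theorem integrable_and_integral_le_of_tendsto (h : Tendsto μs atTop (𝓝 μ)) {g : Ω → ℝ}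
    (hg : Continuous g) (hg0 : 0 ≤ g) (hint : ∀ n, Integrable g (μs n : Measure Ω))
    (hM : ∀ n, ∫ x, g x ∂(μs n : Measure Ω) ≤ M) :
    Integrable g (μ : Measure Ω) ∧ ∫ x, g x ∂(μ : Measure Ω) ≤ M := by
  have hlintegral : ∫⁻ x, ENNReal.ofReal (g x) ∂(μ : Measure Ω) ≤ ENNReal.ofReal M :=
    calc ∫⁻ x, ENNReal.ofReal (g x) ∂(μ : Measure Ω)
        ≤ liminf (fun n => ∫⁻ x, ENNReal.ofReal (g x) ∂(μs n : Measure Ω)) atTop :=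
          lintegral_le_liminf_lintegral_of_forall_isOpen_measure_le_liminf_measure hg hg0
            fun _ => ProbabilityMeasure.le_liminf_measure_open_of_tendsto h
      _ ≤ liminf (fun _ : ℕ => ENNReal.ofReal M) atTop :=
          liminf_le_liminf <| .of_forall fun n => by
            rw [← ofReal_integral_eq_lintegral_ofReal (hint n) (ae_of_all _ hg0)]
            exact ENNReal.ofReal_le_ofReal (hM n)
      _ = ENNReal.ofReal M := liminf_const _
  have hgint : Integrable g (μ : Measure Ω) :=
    ⟨hg.measurable.aestronglyMeasurable, (hasFiniteIntegral_iff_ofReal (ae_of_all _ hg0)).2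
      (hlintegral.trans_lt ENNReal.ofReal_lt_top)⟩
  refine ⟨hgint, ?_⟩
  rwa [← ofReal_integral_eq_lintegral_ofReal hgint (ae_of_all _ hg0),
    ENNReal.ofReal_le_ofReal_iff ((integral_nonneg hg0).trans (hM 0))] at hlintegral

theorem tendsto_integral_of_forall_integral_norm_sq_le (h : Tendsto μs atTop (𝓝 μ))
    {f : Ω → ℂ} (hf : Continuous f)
    (hint : ∀ n, Integrable (fun x => ‖f x‖ ^ 2) (μs n : Measure Ω))
    (hM : ∀ n, ∫ x, ‖f x‖ ^ 2 ∂(μs n : Measure Ω) ≤ M) :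
    Integrable f (μ : Measure Ω) ∧
      Tendsto (fun n => ∫ x, f x ∂(μs n : Measure Ω)) atTop (𝓝 (∫ x, f x ∂(μ : Measure Ω))) := by
  obtain ⟨hint', hM'⟩ := integrable_and_integral_le_of_tendsto h (hf.norm.pow 2)
    (fun x => sq_nonneg _) hint hM
  have hinv : Tendsto (fun K : ℝ => K⁻¹ * M) atTop (𝓝 0) := by
    simpa only [zero_mul] using tendsto_inv_atTop_zero.mul_const M
  refine ⟨((memLp_two_iff_integrable_sq_norm hf.measurable.aestronglyMeasurable).2
    hint').integrable one_le_two, ?_⟩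
  refine TendstoUniformly.tendsto_of_eventually_tendsto (p := atTop)
    (F := fun K n => ∫ x, (K / max K ‖f x‖) • f x ∂(μs n : Measure Ω))
    (L := fun K => ∫ x, (K / max K ‖f x‖) • f x ∂(μ : Measure Ω)) ?_ ?_ ?_
  · refine Metric.tendstoUniformly_iff.2 fun ε hε => ?_
    filter_upwards [hinv.eventually (gt_mem_nhds hε), eventually_gt_atTop 0] with K hK hK0 n
    rw [dist_comm, dist_eq_norm]
    exact (norm_integral_div_max_smul_sub_le hf (hint n) (hM n) hK0).trans_lt hK
  · filter_upwards [eventually_gt_atTop 0] with K hK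
    exact (ProbabilityMeasure.tendsto_iff_forall_integral_rclike_tendsto ℂ).1 h
      (.ofNormedAddCommGroup _ (continuous_div_max_smul hf hK) K
        fun x => norm_div_max_smul_le hK (f x))
  · refine tendsto_iff_norm_sub_tendsto_zero.2 (squeeze_zero' (.of_forall fun _ => norm_nonneg _)
      ?_ hinv)
    filter_upwards [eventually_gt_atTop 0] with K hK
    exact norm_integral_div_max_smul_sub_le hf hint' hM' hK

end TestFunctions

theorem exists_tendsto_of_tendsto_charFun {E : Type*} [NormedAddCommGroup E]
    [InnerProductSpace ℝ E] [FiniteDimensional ℝ E] [MeasurableSpace E] [BorelSpace E]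
    {μs : ℕ → ProbabilityMeasure E} {f : E → ℂ} (hf : ContinuousAt f 0)
    (h : ∀ u, Tendsto (fun n => charFun (μs n : Measure E) u) atTop (𝓝 (f u))) :
    ∃ μ : ProbabilityMeasure E, Tendsto μs atTop (𝓝 μ) := by
  have htight : IsTightMeasureSet {(μs n : Measure E) | n} :=
    isTightMeasureSet_of_tendsto_charFun hf h
  have hcomp : IsCompact (closure (Set.range μs)) :=
    isCompact_closure_of_isTightMeasureSet (by simpa using htight)
  obtain ⟨μ, -, hμ : Tendsto μs (hyperfilter ℕ) (𝓝 μ)⟩ :=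
    hcomp.ultrafilter_le_nhds ((hyperfilter ℕ).map μs)
      (.trans (by simp) (monotone_principal subset_closure))
  refine ⟨μ, ProbabilityMeasure.tendsto_of_tendsto_charFun fun u => ?_⟩
  have hchar : charFun (μ : Measure E) u = f u := by
    refine tendsto_nhds_unique ?_ ((h u).mono_left Nat.hyperfilter_le_atTop)
    rw [ProbabilityMeasure.tendsto_iff_forall_integral_rclike_tendsto ℂ] at hμ
    simp_rw [charFun_eq_integral_innerProbChar]
    exact hμ (BoundedContinuousFunction.innerProbChar u)
  rw [hchar]
  exact h u

end WeakConvergence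

section StableLaw

theorem ofReal_norm_cexp_neg_mul_ofReal_sq (t : ℂ) (x : ℝ) :
    ((‖Complex.exp (-(t * x))‖ ^ 2 : ℝ) : ℂ) = Complex.exp (-(((2 * t.re : ℝ) : ℂ) * x)) := by
  rw [Complex.norm_exp, Complex.neg_re, Complex.re_mul_ofReal, ← Real.exp_nat_mul]
  push_cast
  ring_nf

theorem integral_cexp_neg_mul_of_tendsto {μs : ℕ → ProbabilityMeasure ℝ}
    {μ : ProbabilityMeasure ℝ} (h : Tendsto μs atTop (𝓝 μ)) {f : ℂ → ℂ}
    (hint : ∀ n (t : ℂ), 0 ≤ t.re →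
      Integrable (fun x : ℝ => Complex.exp (-(t * x))) (μs n : Measure ℝ))
    (hlim : ∀ t : ℂ, 0 ≤ t.re →
      Tendsto (fun n => ∫ x : ℝ, Complex.exp (-(t * x)) ∂(μs n : Measure ℝ)) atTop (𝓝 (f t)))
    {t : ℂ} (ht : 0 ≤ t.re) :
    Integrable (fun x : ℝ => Complex.exp (-(t * x))) (μ : Measure ℝ) ∧
      ∫ x : ℝ, Complex.exp (-(t * x)) ∂(μ : Measure ℝ) = f t := by
  have ht2 : 0 ≤ ((2 * t.re : ℝ) : ℂ).re := by rw [Complex.ofReal_re]; positivity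
  obtain ⟨M, hM⟩ := (hlim _ ht2).norm.bddAbove_range
  have hsq : ∀ n, Integrable (fun x : ℝ => ‖Complex.exp (-(t * x))‖ ^ 2) (μs n : Measure ℝ) :=
    fun n => (hint n _ ht2).norm.congr <| ae_of_all _ fun x => by
      simp only [← ofReal_norm_cexp_neg_mul_ofReal_sq, Complex.norm_real, norm_pow, norm_norm]
  obtain ⟨hμ, htend⟩ := tendsto_integral_of_forall_integral_norm_sq_le h
    (f := fun x : ℝ => Complex.exp (-(t * x))) (M := M) (by fun_prop) hsq fun n => by
      refine (le_abs_self _).trans (le_of_eq_of_le ?_ (hM ⟨n, rfl⟩))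
      simp only [← ofReal_norm_cexp_neg_mul_ofReal_sq, integral_complex_ofReal,
        Complex.norm_real, Real.norm_eq_abs]
  exact ⟨hμ, tendsto_nhds_unique htend (hlim t ht)⟩

theorem charFun_eq_integral_cexp_neg_mul (σ : Measure ℝ) (u : ℝ) :
    charFun σ u = ∫ x : ℝ, Complex.exp (-(-(u * Complex.I) * x)) ∂σ := by
  rw [charFun_apply_real]
  exact integral_congr_ae (ae_of_all _ fun x => by ring_nf)

theorem ne_dirac_of_integral_cexp_neg_mul {α b : ℝ} (hα : 1 < α) (hb : b ≠ 0) {σ : Measure ℝ}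
    (h : ∀ r : ℝ, 0 ≤ r → ∫ x : ℝ, Complex.exp (-(r * x)) ∂σ =
      Complex.exp (b * (r : ℂ) ^ (α : ℂ))) (x : ℝ) : σ ≠ Measure.dirac x := by
  rintro rfl
  have hexp : ∀ r : ℝ, 0 ≤ r → -(r * x) = b * r ^ α := fun r hr => by
    have := h r hr
    rw [integral_dirac, ← Complex.ofReal_cpow hr] at this
    exact Real.exp_injective (by exact_mod_cast this)
  have htwo : b * (2 : ℝ) ^ α = b * 2 := by
    have hone := hexp 1 zero_le_one
    rw [Real.one_rpow] at hone
    linarith [hexp 2 zero_le_two]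
  have hlt : (2 : ℝ) ^ (1 : ℝ) < 2 ^ α := Real.rpow_lt_rpow_of_exponent_lt one_lt_two hα
  rw [Real.rpow_one, mul_left_cancel₀ hb htwo] at hlt
  exact lt_irrefl _ hlt

theorem mul_cpow_ofReal_of_pos {q : ℝ} (hq : 0 < q) (z : ℂ) (α : ℝ) :
    ((q : ℂ) * z) ^ (α : ℂ) = ((q ^ α : ℝ) : ℂ) * z ^ (α : ℂ) := by
  have hq' : (q : ℂ) ≠ 0 := Complex.ofReal_ne_zero.2 hq.ne'
  rcases eq_or_ne z 0 with rfl | hz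
  · rcases eq_or_ne α 0 with rfl | hα
    · simp
    · rw [mul_zero, Complex.zero_cpow (Complex.ofReal_ne_zero.2 hα), mul_zero]
  · rw [Complex.cpow_def_of_ne_zero (mul_ne_zero hq' hz), Complex.log_ofReal_mul hq hz, add_mul,
      Complex.exp_add, Complex.cpow_def_of_ne_zero hz, Complex.ofReal_cpow hq.le,
      Complex.cpow_def_of_ne_zero hq', Complex.ofReal_log hq.le]

theorem map_prod_mul_add_mul_of_charFun {α : ℝ} (hα : α ≠ 0) {b : ℂ} {σ : Measure ℝ}
    [IsProbabilityMeasure σ]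
    (h : ∀ u : ℝ, charFun σ u = Complex.exp (b * (-(u * Complex.I)) ^ (α : ℂ)))
    {a d : ℝ} (ha : 0 < a) (hd : 0 < d) :
    (σ.prod σ).map (fun p => a * p.1 + d * p.2) =
      σ.map (fun x => (a ^ α + d ^ α) ^ (1 / α) * x) := by
  have hs : 0 < a ^ α + d ^ α := by positivity
  have hscale : ∀ {q : ℝ} (u : ℝ), 0 < q → charFun (σ.map (q * ·)) u =
      Complex.exp (b * (((q ^ α : ℝ) : ℂ) * (-(u * Complex.I)) ^ (α : ℂ))) := fun {q} u hq => by
    rw [charFun_map_mul, h, ← mul_cpow_ofReal_of_pos hq, Complex.ofReal_mul, mul_assoc, mul_neg]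
  have hprob : ∀ q : ℝ, IsProbabilityMeasure (σ.map (q * ·)) := fun q =>
    Measure.isProbabilityMeasure_map (by fun_prop)
  have hprod : (σ.prod σ).map (fun p : ℝ × ℝ => a * p.1 + d * p.2) =
      ((σ.map (a * ·)).prod (σ.map (d * ·))).map (fun p => p.1 + p.2) := by
    rw [Measure.map_prod_map _ _ (by fun_prop) (by fun_prop),
      Measure.map_map (by fun_prop) (by fun_prop)]
    rfl
  refine Measure.ext_of_charFun ?_
  rw [hprod, charFun_map_add_prod_eq_mul]
  ext u
  rw [Pi.mul_apply, hscale u ha, hscale u hd, hscale u (Real.rpow_pos_of_pos hs _),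
    ← Complex.exp_add, ← Real.rpow_mul hs.le, one_div_mul_cancel hα, Real.rpow_one]
  push_cast
  ring_nf

theorem isStableLaw_of_integral_cexp_neg_mul {α b : ℝ} (hα : 1 < α) (hb : b ≠ 0)
    {σ : Measure ℝ} [IsProbabilityMeasure σ]
    (h : ∀ t : ℂ, 0 ≤ t.re → ∫ x : ℝ, Complex.exp (-(t * x)) ∂σ =
      Complex.exp (b * t ^ (α : ℂ))) : IsStableLaw α σ := by
  refine ⟨ne_dirac_of_integral_cexp_neg_mul hα hb fun r hr => h r hr, fun a d ha hd => ⟨0, ?_⟩⟩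
  simp only [add_zero]
  refine map_prod_mul_add_mul_of_charFun (by positivity) (b := b) (fun u => ?_) ha hd
  rw [charFun_eq_integral_cexp_neg_mul, h _ (by simp)]

theorem continuousAt_cexp_mul_cpow_neg_mul_I {α : ℝ} (hα : 0 < α) (b : ℂ) :
    ContinuousAt (fun u : ℝ => Complex.exp (b * (-(u * Complex.I)) ^ (α : ℂ))) 0 := by
  have hpow : ContinuousAt (fun z : ℂ => z ^ (α : ℂ)) (-(((0 : ℝ) : ℂ) * Complex.I)) :=
    Complex.continuousAt_cpow_const_of_re_pos (Or.inl (by simp)) (by simpa using hα)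
  have hlin : ContinuousAt (fun u : ℝ => -((u : ℂ) * Complex.I)) 0 := by fun_prop
  exact ((hpow.comp (f := fun u : ℝ => -((u : ℂ) * Complex.I)) hlin).const_mul b).cexp

theorem Gamma_neg_sub_one_ne_zero {β : ℝ} (hβ : 2 < β) (hβ3 : β < 3) :
    Real.Gamma (-(β - 1)) ≠ 0 := by
  refine Real.Gamma_ne_zero fun m hm => ?_
  have hm1 : (1 : ℝ) < m := by linarith
  have hm2 : (m : ℝ) < 2 := by linarith
  norm_cast at hm1 hm2
  lia

theorem exists_stable_limit {P : Measure ℕ} [IsProbabilityMeasure P] {c β : ℝ} (hc : 0 < c)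
    (hβ : 2 < β) (hβ3 : β < 3)
    (h : (fun k => P.real {k}) ~[atTop] fun k : ℕ => c * (k : ℝ) ^ (-β)) :
    ∃ X : ProbabilityMeasure ℝ, IsStableLaw (β - 1) (X : Measure ℝ) ∧
      (∀ t : ℂ, 0 ≤ t.re →
        Integrable (fun x : ℝ => Complex.exp (-(t * (x : ℂ)))) (X : Measure ℝ) ∧
        ∫ x : ℝ, Complex.exp (-(t * (x : ℂ))) ∂(X : Measure ℝ) =
          Complex.exp (c * Real.Gamma (-(β - 1)) * t ^ ((β - 1 : ℝ) : ℂ))) ∧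
      Tendsto (normalizedSumLaw P β) atTop (𝓝 X) := by
  have hlim := fun (t : ℂ) (ht : 0 ≤ t.re) => tendsto_integral_cexp_normalizedSumLaw hβ hβ3 h ht
  obtain ⟨X, hX⟩ := exists_tendsto_of_tendsto_charFun
    (continuousAt_cexp_mul_cpow_neg_mul_I (sub_pos.2 (one_lt_two.trans hβ))
      (c * Real.Gamma (-(β - 1))))
    fun u => by
      simpa only [charFun_eq_integral_cexp_neg_mul] using hlim (-(u * Complex.I)) (by simp)
  have hLaplace := fun (t : ℂ) (ht : 0 ≤ t.re) => integral_cexp_neg_mul_of_tendsto hX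
    (fun n _ => integrable_cexp_normalizedSumLaw β n) hlim ht
  refine ⟨X, ?_, hLaplace, hX⟩
  refine isStableLaw_of_integral_cexp_neg_mul (b := c * Real.Gamma (-(β - 1))) (by linarith)
    (mul_ne_zero hc.ne' (Gamma_neg_sub_one_ne_zero hβ hβ3)) fun t ht => ?_
  rw [(hLaplace t ht).2, Complex.ofReal_mul]

end StableLaw

section OrderLimit

theorem measureReal_Ioc_eq_sub (μ : Measure ℝ) [IsFiniteMeasure μ] {a b : ℝ} (hab : a ≤ b) :
    μ.real (Set.Ioc a b) = μ.real (Set.Iic b) - μ.real (Set.Iic a) := by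
  rw [← Set.Iic_sdiff_Iic, measureReal_sdiff (Set.Iic_subset_Iic.2 hab) measurableSet_Iic]

theorem tendsto_of_tendsto_measureReal_Iic {μs : ℕ → ProbabilityMeasure ℝ}
    {μ : ProbabilityMeasure ℝ} {D : Set ℝ} (hD : Dense D)
    (h : ∀ x ∈ D, Tendsto (fun n => (μs n : Measure ℝ).real (Set.Iic x)) atTop
      (𝓝 ((μ : Measure ℝ).real (Set.Iic x)))) : Tendsto μs atTop (𝓝 μ) := by
  refine (isPiSystem_Ioc_mem D D).tendsto_probabilityMeasure_of_tendsto_of_mem ?_ ?_ ?_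
  · rintro - ⟨a, -, b, -, -, rfl⟩
    exact measurableSet_Ioc
  · intro u hu x hx
    obtain ⟨ε, hε, hball⟩ := Metric.isOpen_iff.1 hu x hx
    obtain ⟨a, ha, hεa, hax⟩ := hD.exists_between (sub_lt_self x hε)
    obtain ⟨b, hb, hxb, hbε⟩ := hD.exists_between (lt_add_of_pos_right x hε)
    refine ⟨Set.Ioc a b, ⟨a, ha, b, hb, hax.trans hxb, rfl⟩, Ioc_mem_nhds hax hxb,
      fun y hy => hball ?_⟩
    rw [Real.ball_eq_Ioo]
    exact ⟨hεa.trans hy.1, hy.2.trans_lt hbε⟩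
  · rintro - ⟨a, ha, b, hb, hab, rfl⟩
    have hsub := (h b hb).sub (h a ha)
    simp only [← measureReal_Ioc_eq_sub _ hab.le] at hsub
    exact NNReal.tendsto_coe.1 hsub

theorem setLIntegral_eq_setLIntegral_inter {Ω : Type*} [MeasurableSpace Ω] {μ : Measure Ω}
    {f : Ω → ℝ≥0∞} {s : Set Ω} (hs : MeasurableSet s) (hf : ∀ᵐ x ∂μ, x ∉ s → f x = 0)
    (t : Set Ω) : ∫⁻ x in t, f x ∂μ = ∫⁻ x in s ∩ t, f x ∂μ := by
  rw [← setLIntegral_indicator hs]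
  refine lintegral_congr_ae (ae_restrict_of_ae ?_)
  filter_upwards [hf] with x hx
  by_cases hxs : x ∈ s
  · rw [Set.indicator_of_mem hxs]
  · rw [Set.indicator_of_notMem hxs, hx hxs]

theorem setLIntegral_densityW (c α : ℝ) (j : ℕ) (S : Set ℝ) :
    ∫⁻ x in S, ENNReal.ofReal (densityW c α j x) =
      ∫⁻ x in Set.Ioi 0 ∩ S, ENNReal.ofReal (densityW c α j x) :=
  setLIntegral_eq_setLIntegral_inter measurableSet_Ioi (ae_of_all _ fun x hx => by
    rw [densityW, if_neg (not_lt.2 (Set.notMem_Ioi.1 hx)), ENNReal.ofReal_zero]) S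

theorem setLIntegral_gammaPDF (a r : ℝ) (S : Set ℝ) :
    ∫⁻ x in S, gammaPDF a r x = ∫⁻ x in Set.Ioi 0 ∩ S, gammaPDF a r x := by
  refine setLIntegral_eq_setLIntegral_inter measurableSet_Ioi ?_ S
  filter_upwards [Measure.ae_ne volume (0 : ℝ)] with x hx0 hx
  exact gammaPDF_of_neg (lt_of_le_of_ne (not_lt.1 hx) hx0)

variable {c α : ℝ}

theorem hasDerivAt_const_mul_rpow_neg (hα : 0 < α) {x : ℝ} (hx : 0 < x) :
    HasDerivAt (fun x : ℝ => c * α⁻¹ * x ^ (-α)) (-(c * x ^ (-α - 1))) x := by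
  refine ((Real.hasDerivAt_rpow_const (p := -α) (Or.inl hx.ne')).const_mul
    (c * α⁻¹)).congr_deriv ?_
  field_simp

theorem injOn_const_mul_rpow_neg (hc : 0 < c) (hα : 0 < α) :
    Set.InjOn (fun x : ℝ => c * α⁻¹ * x ^ (-α)) (Set.Ioi 0) := by
  intro x hx y hy hxy
  have hpow : x ^ (-α) = y ^ (-α) := mul_left_cancel₀ (by positivity) hxy
  exact (Real.rpow_left_inj (le_of_lt hx) (le_of_lt hy) (neg_ne_zero.2 hα.ne')).1 hpow

theorem surjOn_const_mul_rpow_neg (hc : 0 < c) (hα : 0 < α) :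
    Set.SurjOn (fun x : ℝ => c * α⁻¹ * x ^ (-α)) (Set.Ioi 0) (Set.Ioi 0) := by
  intro y (hy : 0 < y)
  have hdiv : 0 < y / (c * α⁻¹) := by positivity
  refine ⟨(y / (c * α⁻¹)) ^ (-α)⁻¹, Real.rpow_pos_of_pos hdiv _, ?_⟩
  simp only [Real.rpow_inv_rpow hdiv.le (neg_ne_zero.2 hα.ne')]
  exact mul_div_cancel₀ y (by positivity)

theorem image_const_mul_rpow_neg (hc : 0 < c) (hα : 0 < α) (S : Set ℝ) :
    (fun x : ℝ => c * α⁻¹ * x ^ (-α)) '' (Set.Ioi 0 ∩ (fun x : ℝ => c * α⁻¹ * x ^ (-α)) ⁻¹' S) =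
      Set.Ioi 0 ∩ S := by
  have hmaps : Set.MapsTo (fun x : ℝ => c * α⁻¹ * x ^ (-α)) (Set.Ioi 0) (Set.Ioi 0) :=
    fun x (hx : 0 < x) => show 0 < c * α⁻¹ * x ^ (-α) by positivity
  rw [Set.image_inter_preimage, (surjOn_const_mul_rpow_neg hc hα).image_eq_of_mapsTo hmaps]

theorem map_withDensity_densityW (hc : 0 < c) (hα : 0 < α) {j : ℕ} (hj : 2 ≤ j) :
    (volume.withDensity fun x => ENNReal.ofReal (densityW c α j x)).map
      (fun x => c * α⁻¹ * x ^ (-α)) = gammaMeasure ((j : ℝ) - 1) 1 := by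
  obtain ⟨k, rfl⟩ := Nat.exists_eq_add_of_le' hj
  have hf : Measurable fun x : ℝ => c * α⁻¹ * x ^ (-α) := by fun_prop
  ext S hS
  have hmeas := measurableSet_Ioi (a := (0 : ℝ)).inter (hf hS)
  rw [Measure.map_apply hf hS, withDensity_apply _ (hf hS), setLIntegral_densityW,
    gammaMeasure, withDensity_apply _ hS, setLIntegral_gammaPDF,
    ← image_const_mul_rpow_neg hc hα S, lintegral_image_eq_lintegral_abs_deriv_mul hmeas
    (fun x hx => (hasDerivAt_const_mul_rpow_neg hα hx.1).hasDerivWithinAt)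
    ((injOn_const_mul_rpow_neg hc hα).mono Set.inter_subset_left)]
  refine setLIntegral_congr_fun hmeas fun x hx => ?_
  have hx0 : 0 < x := hx.1
  have hshape : ((k + 2 : ℕ) : ℝ) - 1 = k + 1 := by push_cast; ring
  rw [gammaPDF_of_nonneg (by positivity), ← ENNReal.ofReal_mul (abs_nonneg _), abs_neg,
    abs_of_nonneg (by positivity), densityW, if_pos hx0, hshape, Real.Gamma_nat_eq_factorial,
    Real.one_rpow, add_sub_cancel_right, Real.rpow_natCast, Nat.add_sub_cancel]
  congr 1
  ring_nf

theorem isProbabilityMeasure_densityW (hc : 0 < c) (hα : 0 < α) {j : ℕ} (hj : 2 ≤ j) :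
    IsProbabilityMeasure (volume.withDensity fun x => ENNReal.ofReal (densityW c α j x)) := by
  have hj' : 0 < (j : ℝ) - 1 := sub_pos.2 (by exact_mod_cast hj)
  have := isProbabilityMeasure_gammaMeasure hj' one_pos
  rw [← map_withDensity_densityW hc hα hj] at this
  exact Measure.isProbabilityMeasure_of_map (fun x : ℝ => c * α⁻¹ * x ^ (-α))

theorem hasDerivAt_sum_exp_neg_mul_pow (k : ℕ) (u : ℝ) :
    HasDerivAt (fun u : ℝ => ∑ i ∈ Finset.range (k + 1), Real.exp (-u) * u ^ i / (i.factorial : ℝ))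
      (-(Real.exp (-u) * u ^ k / (k.factorial : ℝ))) u := by
  have hexp : HasDerivAt (fun u : ℝ => Real.exp (-u)) (-Real.exp (-u)) u := by
    simpa using (hasDerivAt_neg u).exp
  induction k with
  | zero => simpa using hexp
  | succ k ih =>
    simp only [Finset.sum_range_succ _ (k + 1)]
    refine (ih.fun_add ((hexp.fun_mul (hasDerivAt_pow (k + 1) u)).div_const
      ((k + 1).factorial : ℝ))).congr_deriv ?_
    rw [Nat.factorial_succ, Nat.add_sub_cancel]
    push_cast
    field_simp
    ring

theorem hasDerivAt_limitCdf (hα : 0 < α) (k : ℕ) {x : ℝ} (hx : 0 < x) :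
    HasDerivAt (limitCdf c α (k + 1)) (densityW c α (k + 2) x) x := by
  have hcomp := (hasDerivAt_sum_exp_neg_mul_pow k (c * α⁻¹ * x ^ (-α))).comp x
    (hasDerivAt_const_mul_rpow_neg hα hx)
  refine hcomp.congr_deriv ?_
  rw [densityW, if_pos hx, Nat.add_sub_cancel]
  ring

theorem tendsto_limitCdf_atTop (c : ℝ) (hα : 0 < α) (k : ℕ) :
    Tendsto (limitCdf c α (k + 1)) atTop (𝓝 1) := by
  have hrate : Tendsto (fun x : ℝ => c / α * x ^ (-α)) atTop (𝓝 0) := by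
    simpa only [mul_zero] using (tendsto_rpow_neg_atTop hα).const_mul (c / α)
  have hcont : Continuous fun u : ℝ => ∑ i ∈ Finset.range (k + 1),
      Real.exp (-u) * u ^ i / (i.factorial : ℝ) := by fun_prop
  have hzero : ∑ i ∈ Finset.range (k + 1), Real.exp (-0) * (0 : ℝ) ^ i / (i.factorial : ℝ) = 1 := by
    rw [Finset.sum_range_succ']
    simp
  have hcomp := (hcont.tendsto 0).comp hrate
  rwa [hzero] at hcomp

theorem densityW_nonneg (hc : 0 ≤ c) (hα : 0 ≤ α) (j : ℕ) (x : ℝ) : 0 ≤ densityW c α j x := by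
  rw [densityW]
  split_ifs <;> positivity

theorem measureReal_densityW_Ioi (hc : 0 ≤ c) (hα : 0 < α) (k : ℕ) {x : ℝ} (hx : 0 < x) :
    (volume.withDensity fun x => ENNReal.ofReal (densityW c α (k + 2) x)).real (Set.Ioi x) =
      1 - limitCdf c α (k + 1) x := by
  have hderiv : ∀ y ∈ Set.Ici x, HasDerivAt (limitCdf c α (k + 1)) (densityW c α (k + 2) y) y :=
    fun y hy => hasDerivAt_limitCdf hα k (hx.trans_le hy)
  have hnonneg : ∀ y ∈ Set.Ioi x, 0 ≤ densityW c α (k + 2) y :=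
    fun y _ => densityW_nonneg hc hα.le _ y
  have hlim := tendsto_limitCdf_atTop c hα k
  rw [measureReal_def, withDensity_apply _ measurableSet_Ioi,
    ← ofReal_integral_eq_lintegral_ofReal
      (integrableOn_Ioi_deriv_of_nonneg' hderiv hnonneg hlim)
      ((ae_restrict_iff' measurableSet_Ioi).2 (ae_of_all _ hnonneg)),
    ENNReal.toReal_ofReal (setIntegral_nonneg measurableSet_Ioi hnonneg),
    integral_Ioi_of_hasDerivAt_of_nonneg' hderiv hnonneg hlim]

theorem measureReal_densityW_Iic (hc : 0 < c) (hα : 0 < α) {j : ℕ} (hj : 2 ≤ j) (x : ℝ) :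
    (volume.withDensity fun x => ENNReal.ofReal (densityW c α j x)).real (Set.Iic x) =
      if 0 < x then limitCdf c α (j - 1) x else 0 := by
  split_ifs with hx
  · have := isProbabilityMeasure_densityW hc hα hj
    obtain ⟨k, rfl⟩ := Nat.exists_eq_add_of_le' hj
    rw [← Set.compl_Ioi, probReal_compl_eq_one_sub measurableSet_Ioi,
      measureReal_densityW_Ioi hc.le hα k hx, sub_sub_cancel]
    rfl
  · rw [measureReal_def, withDensity_apply _ measurableSet_Iic, setLIntegral_densityW,
      Set.Ioi_inter_Iic, Set.Ioc_eq_empty hx, setLIntegral_empty, ENNReal.toReal_zero]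

/-- The law of `n^(-1/(β-1)) x_(k)` for `n - 1` independent variables `xᵢ` with law `P`. -/
noncomputable def normalizedOrderedLaw (P : Measure ℕ) [IsProbabilityMeasure P] (β : ℝ) (k n : ℕ) :
    ProbabilityMeasure ℝ :=
  ⟨(Measure.pi fun _ : Fin (n - 1) => P).map fun x =>
    (n : ℝ) ^ (-(1 / (β - 1))) * (ordered x k : ℝ),
    Measure.isProbabilityMeasure_map Measurable.of_discrete.aemeasurable⟩

theorem measureReal_normalizedOrderedLaw_Iic (P : Measure ℕ) [IsProbabilityMeasure P] (β : ℝ)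
    (k n : ℕ) (x : ℝ) : (normalizedOrderedLaw P β k n : Measure ℝ).real (Set.Iic x) =
      (Measure.pi fun _ : Fin (n - 1) => P).real
        {v | (n : ℝ) ^ (-(1 / (β - 1))) * (ordered v k : ℝ) ≤ x} := by
  rw [normalizedOrderedLaw, ProbabilityMeasure.coe_mk,
    map_measureReal_apply Measurable.of_discrete measurableSet_Iic]
  rfl

theorem exists_tendsto_normalizedOrderedLaw {P : Measure ℕ} [IsProbabilityMeasure P] {β : ℝ}
    (hc : 0 < c) (hβ : 1 < β)
    (h : (fun k => P.real {k}) ~[atTop] fun k : ℕ => c * (k : ℝ) ^ (-β)) {j : ℕ} (hj : 2 ≤ j) :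
    ∃ W : ProbabilityMeasure ℝ, (W : Measure ℝ) =
        volume.withDensity (fun x => ENNReal.ofReal (densityW c (β - 1) j x)) ∧
      Tendsto (normalizedOrderedLaw P β (j - 1)) atTop (𝓝 W) := by
  have hα : 0 < β - 1 := sub_pos.2 hβ
  refine ⟨⟨_, isProbabilityMeasure_densityW hc hα hj⟩, rfl,
    tendsto_of_tendsto_measureReal_Iic (dense_compl_singleton (0 : ℝ)) fun x hx => ?_⟩
  simp only [measureReal_normalizedOrderedLaw_Iic]
  rw [ProbabilityMeasure.coe_mk, measureReal_densityW_Iic hc hα hj]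
  split_ifs with hx0
  · exact tendsto_measureReal_ordered_le hβ h (by lia) hx0
  · have hneg : x < 0 := lt_of_le_of_ne (not_lt.1 hx0) hx
    have hempty (n : ℕ) : {v : Fin (n - 1) → ℕ |
        (n : ℝ) ^ (-(1 / (β - 1))) * (ordered v (j - 1) : ℝ) ≤ x} = ∅ :=
      Set.eq_empty_of_forall_notMem fun v => not_le.2 (hneg.trans_le (by positivity))
    simp only [hempty, measureReal_empty]
    exact tendsto_const_nhds

end OrderLimit

section Proportional

variable {E : Type*} [MeasurableSpace E] {f : E → ℝ≥0∞}

theorem toMeasure_proportional_singleton [Inhabited E] [MeasurableSingletonClass E]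
    (hf0 : ∑' x, f x ≠ 0) (hf : ∑' x, f x ≠ ⊤) (x : E) :
    (proportional f).toMeasure {x} = f x * (∑' x, f x)⁻¹ := by
  rw [proportional, dif_pos ⟨hf0, hf⟩,
    PMF.toMeasure_apply_singleton _ _ (measurableSet_singleton x), PMF.normalize_apply]

theorem measure_eq_tsum_mul_of_inter_singleton [Countable E] [DiscreteMeasurableSpace E]
    {μ : Measure E} {A : Set E} {a : ℝ≥0∞} (h : ∀ x, μ (A ∩ {x}) = f x * a) :
    μ A = (∑' x, f x) * a := by
  rw [← ENNReal.tsum_mul_right, ← Measure.tsum_indicator_apply_singleton _ _ .of_discrete]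
  refine tsum_congr fun x => ?_
  rw [← h]
  by_cases hx : x ∈ A
  · rw [Set.indicator_of_mem hx, Set.inter_eq_self_of_subset_right (Set.singleton_subset_iff.2 hx)]
  · rw [Set.indicator_of_notMem hx, Set.inter_singleton_eq_empty.2 hx, measure_empty]

theorem toMeasure_proportional_eq_cond [Inhabited E] [Countable E] [DiscreteMeasurableSpace E]
    {μ : Measure E} {A : Set E} {a : ℝ≥0∞} (ha0 : a ≠ 0) (ha : a ≠ ⊤) (hf0 : ∑' x, f x ≠ 0)
    (hf : ∑' x, f x ≠ ⊤) (h : ∀ x, μ (A ∩ {x}) = f x * a) :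
    (proportional f).toMeasure = ProbabilityTheory.cond μ A := by
  refine Measure.ext_of_singleton fun x => ?_
  rw [toMeasure_proportional_singleton hf0 hf, cond_apply .of_discrete, h,
    measure_eq_tsum_mul_of_inter_singleton h, ENNReal.mul_inv (Or.inl hf0) (Or.inl hf),
    mul_mul_mul_comm, ENNReal.inv_mul_cancel ha0 ha, mul_one, mul_comm]

end Proportional

section CanonicalLaw

variable {w : ℕ → ℝ}

theorem canonical_singleton (hΦ0 : Phi w (radius w) ≠ 0) (hΦ : Phi w (radius w) ≠ ⊤) (k : ℕ) :
    canonical w {k} = ENNReal.ofReal (w k) * radius w ^ k * (Phi w (radius w))⁻¹ :=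
  toMeasure_proportional_singleton hΦ0 hΦ k

theorem nu_eq_ofReal_integral_canonical (hΦ0 : Phi w (radius w) ≠ 0)
    (hΦ : Phi w (radius w) ≠ ⊤) (hint : Integrable (fun k : ℕ => (k : ℝ)) (canonical w)) :
    nu w = ENNReal.ofReal (∫ k : ℕ, (k : ℝ) ∂canonical w) := by
  rw [nu, if_pos hΦ.lt_top, Psi, ofReal_integral_eq_lintegral_ofReal hint
    (ae_of_all _ fun k => Nat.cast_nonneg k), lintegral_countable', div_eq_mul_inv,
    ← ENNReal.tsum_mul_right]
  refine tsum_congr fun k => ?_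
  rw [canonical_singleton hΦ0 hΦ, ENNReal.ofReal_natCast, mul_assoc]

/-- The unnormalized weight of `y` as an allocation of `m` balls in `n` boxes, which is `0` unless
`y` has `m` balls. -/
noncomputable def allocationWeight (w : ℕ → ℝ) (m n : ℕ) (y : Fin n → ℕ) : ℝ≥0∞ :=
  if ∑ i, y i = m then ENNReal.ofReal (∏ i, w (y i)) else 0

theorem Z_nonneg (hw : ∀ k, 0 ≤ w k) (m n : ℕ) : 0 ≤ Z w m n :=
  Finset.sum_nonneg fun _ _ => Finset.prod_nonneg fun _ _ => hw _

theorem tsum_allocationWeight (hw : ∀ k, 0 ≤ w k) (m n : ℕ) :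
    ∑' y, allocationWeight w m n y = ENNReal.ofReal (Z w m n) := by
  rw [Z, ENNReal.ofReal_sum_of_nonneg fun y _ => Finset.prod_nonneg fun i _ => hw _,
    tsum_eq_sum (f := allocationWeight w m n) (s := Finset.Nat.antidiagonalTuple n m)
      fun y hy => if_neg fun hsum => hy (Finset.Nat.mem_antidiagonalTuple.2 hsum)]
  exact Finset.sum_congr rfl fun y hy => if_pos (Finset.Nat.mem_antidiagonalTuple.1 hy)

theorem pi_canonical_inter_singleton (hΦ0 : Phi w (radius w) ≠ 0) (hΦ : Phi w (radius w) ≠ ⊤)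
    (hw : ∀ k, 0 ≤ w k) (m n : ℕ) (y : Fin n → ℕ) :
    (Measure.pi fun _ : Fin n => canonical w) ({y | ∑ l, y l = m} ∩ {y}) =
      allocationWeight w m n y * (radius w ^ m * (Phi w (radius w))⁻¹ ^ n) := by
  rw [allocationWeight]
  split_ifs with hy
  · rw [Set.inter_eq_self_of_subset_right (t := {y}) (Set.singleton_subset_iff.2 hy),
      Measure.pi_singleton]
    simp only [canonical_singleton hΦ0 hΦ]
    rw [Finset.prod_mul_distrib, Finset.prod_mul_distrib, Finset.prod_pow_eq_pow_sum, hy,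
      ENNReal.ofReal_prod_of_nonneg fun i _ => hw _, Finset.prod_const, Finset.card_univ,
      Fintype.card_fin, mul_assoc]
  · rw [Set.inter_singleton_eq_empty (s := {y : Fin n → ℕ | ∑ l, y l = m}).2 hy,
      measure_empty, zero_mul]

theorem measureReal_pi_canonical_sum_eq (hΦ0 : Phi w (radius w) ≠ 0)
    (hΦ : Phi w (radius w) ≠ ⊤) (hw : ∀ k, 0 ≤ w k) (m n : ℕ) :
    (Measure.pi fun _ : Fin n => canonical w).real {y | ∑ l, y l = m} =
      Z w m n * ((radius w).toReal ^ m / (Phi w (radius w)).toReal ^ n) := by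
  rw [measureReal_def, measure_eq_tsum_mul_of_inter_singleton
      (pi_canonical_inter_singleton hΦ0 hΦ hw m n), tsum_allocationWeight hw, ENNReal.toReal_mul,
    ENNReal.toReal_ofReal (Z_nonneg hw m n), ENNReal.toReal_mul, ENNReal.toReal_pow,
    ENNReal.toReal_pow, ENNReal.toReal_inv, inv_pow, div_eq_mul_inv]

theorem allocation_eq_cond (hΦ0 : Phi w (radius w) ≠ 0) (hΦ : Phi w (radius w) ≠ ⊤)
    (hρ0 : radius w ≠ 0) (hρ : radius w ≠ ⊤) (hw : ∀ k, 0 ≤ w k) {m n : ℕ}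
    (hZ : 0 < Z w m n) :
    allocation w m n =
      ProbabilityTheory.cond (Measure.pi fun _ : Fin n => canonical w) {y | ∑ l, y l = m} := by
  have hsum := tsum_allocationWeight hw m n
  refine toMeasure_proportional_eq_cond (f := allocationWeight w m n) ?_ ?_ ?_ ?_
    (pi_canonical_inter_singleton hΦ0 hΦ hw m n)
  · exact mul_ne_zero (pow_ne_zero _ hρ0) (pow_ne_zero _ (ENNReal.inv_ne_zero.2 hΦ))
  · exact ENNReal.mul_ne_top (ENNReal.pow_ne_top hρ) (ENNReal.pow_ne_top (ENNReal.inv_ne_top.2 hΦ0))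
  · exact hsum ▸ (ENNReal.ofReal_pos.2 hZ).ne'
  · exact hsum ▸ ENNReal.ofReal_ne_top

end CanonicalLaw

section PowerLawWeights

variable {w : ℕ → ℝ} {c β : ℝ}

theorem eventually_pos_of_isEquivalent_rpow (hc : 0 < c)
    (hwc : w ~[atTop] fun k : ℕ => c * (k : ℝ) ^ (-β)) : ∀ᶠ k in atTop, 0 < w k := by
  obtain ⟨u, hu, hwu⟩ := hwc.exists_eq_mul
  filter_upwards [hwu, hu.eventually (lt_mem_nhds one_pos), eventually_gt_atTop 0] with k hk hk1 hk0
  have : (0 : ℝ) < k := by exact_mod_cast hk0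
  rw [hk, Pi.mul_apply]
  positivity

theorem tendsto_rpow_one_div_of_isEquivalent_rpow (hc : 0 < c)
    (hwc : w ~[atTop] fun k : ℕ => c * (k : ℝ) ^ (-β)) :
    Tendsto (fun k : ℕ => w k ^ (1 / (k : ℝ))) atTop (𝓝 1) := by
  obtain ⟨u, hu, hwu⟩ := hwc.exists_eq_mul
  have hcoeff : Tendsto (fun k : ℕ => (u k * c) ^ (1 / (k : ℝ))) atTop (𝓝 1) := by
    simpa only [Real.rpow_zero] using (hu.mul_const c).rpow tendsto_one_div_atTop_nhds_zero_nat
      (Or.inl (by rw [one_mul]; exact hc.ne'))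
  have hpower : Tendsto (fun k : ℕ => ((k : ℝ) ^ (1 / (k : ℝ))) ^ (-β)) atTop (𝓝 1) := by
    simpa only [Real.one_rpow, Function.comp_apply] using
      (tendsto_rpow_div.comp tendsto_natCast_atTop_atTop).rpow_const (p := -β)
        (Or.inl one_ne_zero)
  have hmul := hcoeff.mul hpower
  rw [one_mul] at hmul
  refine hmul.congr' ?_
  filter_upwards [hwu, hu.eventually (lt_mem_nhds one_pos), eventually_gt_atTop 0] with k hk hk1 hk0
  rw [hk, Pi.mul_apply, ← mul_assoc, Real.mul_rpow (x := u k * c) (by positivity) (by positivity),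
    ← Real.rpow_mul k.cast_nonneg, ← Real.rpow_mul k.cast_nonneg, mul_comm (-β)]

theorem radius_eq_one (hc : 0 < c) (hwc : w ~[atTop] fun k : ℕ => c * (k : ℝ) ^ (-β)) :
    radius w = 1 := by
  have hroot : Tendsto (fun k : ℕ => ENNReal.ofReal (w k) ^ (1 / (k : ℝ))) atTop (𝓝 1) := by
    rw [← ENNReal.ofReal_one]
    refine (ENNReal.tendsto_ofReal (tendsto_rpow_one_div_of_isEquivalent_rpow hc hwc)).congr' ?_
    filter_upwards [eventually_pos_of_isEquivalent_rpow hc hwc] with k hk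
    rw [ENNReal.ofReal_rpow_of_pos hk]
  rw [radius, hroot.limsup_eq, inv_one]

theorem Phi_one_eq_tsum (w : ℕ → ℝ) : Phi w 1 = ∑' k : ℕ, ENNReal.ofReal (w k) := by
  simp only [Phi, one_pow, mul_one]

theorem Phi_one_ne_top (hβ : 1 < β) (hw : ∀ k, 0 ≤ w k)
    (hwc : w ~[atTop] fun k : ℕ => c * (k : ℝ) ^ (-β)) : Phi w 1 ≠ ⊤ := by
  have hsum : Summable w := summable_of_isBigO_nat
    ((Real.summable_nat_rpow.2 (neg_lt_neg hβ)).mul_left c) hwc.isBigO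
  rw [Phi_one_eq_tsum, ← ENNReal.ofReal_tsum_of_nonneg hw hsum]
  exact ENNReal.ofReal_ne_top

theorem Phi_one_ne_zero (hc : 0 < c) (hwc : w ~[atTop] fun k : ℕ => c * (k : ℝ) ^ (-β)) :
    Phi w 1 ≠ 0 := by
  obtain ⟨k, hk⟩ := (eventually_pos_of_isEquivalent_rpow hc hwc).exists
  rw [Phi_one_eq_tsum]
  exact fun hzero => (ENNReal.ofReal_pos.2 hk).ne' (ENNReal.tsum_eq_zero.1 hzero k)

theorem canonical_isEquivalent (hc : 0 < c) (hβ : 1 < β) (hw : ∀ k, 0 ≤ w k)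
    (hwc : w ~[atTop] fun k : ℕ => c * (k : ℝ) ^ (-β)) :
    (fun k => (canonical w).real {k}) ~[atTop]
      fun k : ℕ => c / (Phi w 1).toReal * (k : ℝ) ^ (-β) := by
  have hρ := radius_eq_one hc hwc
  have hreal : ∀ k, (canonical w).real {k} = w k * ((Phi w 1).toReal)⁻¹ := fun k => by
    rw [measureReal_def, canonical_singleton (hρ ▸ Phi_one_ne_zero hc hwc)
      (hρ ▸ Phi_one_ne_top hβ hw hwc), hρ, one_pow, mul_one, ENNReal.toReal_mul,
      ENNReal.toReal_ofReal (hw k), ENNReal.toReal_inv]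
  refine ((hwc.mul (.refl (u := fun _ => ((Phi w 1).toReal)⁻¹))).congr_left
    (.of_forall fun k => (hreal k).symm)).congr_right (.of_forall fun k => ?_)
  rw [Pi.mul_apply, div_eq_mul_inv, mul_right_comm]

end PowerLawWeights

section OrderedComponents

theorem orderedVector_apply {n : ℕ} (y : Fin n → ℕ) {j : ℕ} (hj : 1 ≤ j) (hjn : j ≤ n) :
    orderedVector y ⟨j - 1, by lia⟩ = (ordered y j : ℤ) := by
  simp only [orderedVector, Nat.sub_add_cancel hj]

theorem exists_ordered_one_eq {n : ℕ} (hn : 1 ≤ n) (y : Fin n → ℕ) : ∃ i, ordered y 1 = y i := by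
  rw [ordered, dif_pos ⟨le_rfl, hn⟩]
  exact ⟨_, rfl⟩

variable {P : Measure ℕ} {A : ∀ n : ℕ, Measure (Fin n → ℕ)} [∀ n, IsProbabilityMeasure (A n)]
  {m : ℕ → ℕ}

theorem asympEqualInLaw_ordered_one
    (h : ApproxEqualLaws (fun n => (A n).map orderedVector)
      (fun n => (Measure.pi fun _ : Fin (n - 1) => P).map (comparisonVector (m n)))) :
    AsympEqualInLaw A (fun _ y => (ordered y 1 : ℤ)) (fun n => Measure.pi fun _ : Fin (n - 1) => P)
      (fun n x => (m n : ℤ) - ∑ l, (x l : ℤ)) := by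
  refine h.asympEqualInLaw (fun _ => .of_discrete) (fun _ => .of_discrete) ?_
  filter_upwards [eventually_ge_atTop 1] with n hn
  exact ⟨fun v => v ⟨0, hn⟩, rfl, rfl⟩

theorem asympEqualInLaw_ordered
    (h : ApproxEqualLaws (fun n => (A n).map orderedVector)
      (fun n => (Measure.pi fun _ : Fin (n - 1) => P).map (comparisonVector (m n))))
    {j : ℕ} (hj : 2 ≤ j) :
    AsympEqualInLaw A (fun _ y => (ordered y j : ℤ)) (fun n => Measure.pi fun _ : Fin (n - 1) => P)
      (fun _ x => (ordered x (j - 1) : ℤ)) := by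
  refine h.asympEqualInLaw (fun _ => .of_discrete) (fun _ => .of_discrete) ?_
  filter_upwards [eventually_ge_atTop j] with n hn
  exact ⟨fun v => v ⟨j - 1, by lia⟩, funext fun y => (orderedVector_apply y (by lia) hn).symm,
    funext fun x => (if_neg (show j - 1 ≠ 0 by lia)).symm⟩

variable [IsProbabilityMeasure P]

theorem isLittleOp_pi_sub_sum (hint : Integrable (fun k : ℕ => (k : ℝ)) P) {lam : ℝ}
    (hm : Tendsto (fun n : ℕ => (m n : ℝ) / n) atTop (𝓝 lam)) :
    IsLittleOp (fun n => Measure.pi fun _ : Fin (n - 1) => P)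
      (fun n x => (m n : ℝ) - ∑ l, (x l : ℝ) - (lam - ∫ k : ℕ, (k : ℝ) ∂P) * n)
      (fun n => (n : ℝ)) := by
  intro ε hε
  have hdev := ENNReal.tendsto_ofReal
    (tendsto_measureReal_pi_pred_sum_deviation .of_discrete hint (half_pos hε))
  rw [ENNReal.ofReal_zero] at hdev
  refine tendsto_of_tendsto_of_tendsto_of_le_of_le' tendsto_const_nhds hdev
    (.of_forall fun n => zero_le) ?_
  filter_upwards [eventually_gt_atTop 0, Metric.tendsto_nhds.1 hm _ (half_pos hε)] with n hn hmn
  have hn0 : (0 : ℝ) < n := Nat.cast_pos.2 hn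
  rw [ofReal_measureReal]
  refine measure_mono fun x hx => ?_
  rw [Set.mem_ofPred_eq] at hx ⊢
  set D := ∑ l, (x l : ℝ) - (∫ k : ℕ, (k : ℝ) ∂P) * n
  have hsplit : ((m n : ℝ) - ∑ l, (x l : ℝ) - (lam - ∫ k : ℕ, (k : ℝ) ∂P) * n) / n =
      ((m n : ℝ) / n - lam) - D / n := by
    simp only [D]
    field_simp
    ring
  have hD : ε / 2 ≤ |D / n| := by
    rw [hsplit] at hx
    rw [Real.dist_eq] at hmn
    linarith [abs_sub ((m n : ℝ) / n - lam) (D / n)]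
  rwa [abs_div, abs_of_pos hn0, le_div_iff₀ hn0] at hD

theorem isLittleOp_pi_ordered_one (hint : Integrable (fun k : ℕ => (k : ℝ)) P) :
    IsLittleOp (fun n => Measure.pi fun _ : Fin (n - 1) => P) (fun _ x => (ordered x 1 : ℝ))
      (fun n => (n : ℝ)) := by
  intro ε hε
  have hmax := ENNReal.tendsto_ofReal (tendsto_measureReal_pi_pred_exists_le .of_discrete hint hε)
  rw [ENNReal.ofReal_zero] at hmax
  refine tendsto_of_tendsto_of_tendsto_of_le_of_le' tendsto_const_nhds hmax
    (.of_forall fun n => zero_le) ?_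
  filter_upwards [eventually_ge_atTop 2] with n hn
  rw [ofReal_measureReal]
  refine measure_mono fun x hx => ?_
  obtain ⟨i, hi⟩ := exists_ordered_one_eq (show 1 ≤ n - 1 by lia) x
  rw [Set.mem_ofPred_eq, hi, abs_of_nonneg (by positivity),
    le_div_iff₀ (Nat.cast_pos.2 (by lia : 0 < n))] at hx
  exact ⟨i, hx⟩

theorem isLittleOp_ordered_one
    (h : ApproxEqualLaws (fun n => (A n).map orderedVector)
      (fun n => (Measure.pi fun _ : Fin (n - 1) => P).map (comparisonVector (m n))))
    (hint : Integrable (fun k : ℕ => (k : ℝ)) P) {lam : ℝ}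
    (hm : Tendsto (fun n : ℕ => (m n : ℝ) / n) atTop (𝓝 lam)) :
    IsLittleOp A (fun n y => (ordered y 1 : ℝ) - (lam - ∫ k : ℕ, (k : ℝ) ∂P) * n)
      (fun n => (n : ℝ)) := by
  refine ((asympEqualInLaw_ordered_one h).comp
    fun n z => (z : ℝ) - (lam - ∫ k : ℕ, (k : ℝ) ∂P) * n).isLittleOp ?_
  simp only [Int.cast_sub, Int.cast_sum, Int.cast_natCast]
  exact isLittleOp_pi_sub_sum hint hm

theorem isLittleOp_ordered_two
    (h : ApproxEqualLaws (fun n => (A n).map orderedVector)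
      (fun n => (Measure.pi fun _ : Fin (n - 1) => P).map (comparisonVector (m n))))
    (hint : Integrable (fun k : ℕ => (k : ℝ)) P) :
    IsLittleOp A (fun _ y => (ordered y 2 : ℝ)) (fun n => (n : ℝ)) :=
  ((asympEqualInLaw_ordered h le_rfl).comp fun _ z => (z : ℝ)).isLittleOp
    (isLittleOp_pi_ordered_one hint)

theorem abs_div_rpow_eq (z s : ℝ) (n : ℕ) : |z / (n : ℝ) ^ s| = |(n : ℝ) ^ (-s) * z| := by
  rw [Real.rpow_neg n.cast_nonneg, div_eq_inv_mul]

variable {c β : ℝ}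

theorem exists_stable_tendstoInDistribution_ordered_one
    (h : ApproxEqualLaws (fun n => (A n).map orderedVector)
      (fun n => (Measure.pi fun _ : Fin (n - 1) => P).map (comparisonVector (m n))))
    (hc : 0 < c) (hβ : 2 < β) (hβ3 : β < 3)
    (hP : (fun k => P.real {k}) ~[atTop] fun k : ℕ => c * (k : ℝ) ^ (-β)) :
    IsBigOp A (fun n y => (ordered y 1 : ℝ) - ((m n : ℝ) - (∫ k : ℕ, (k : ℝ) ∂P) * n))
      (fun n => (n : ℝ) ^ (1 / (β - 1))) ∧
    ∃ X : ProbabilityMeasure ℝ, IsStableLaw (β - 1) (X : Measure ℝ) ∧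
      (∀ t : ℂ, 0 ≤ t.re →
        Integrable (fun x : ℝ => Complex.exp (-(t * (x : ℂ)))) (X : Measure ℝ) ∧
        ∫ x : ℝ, Complex.exp (-(t * (x : ℂ))) ∂(X : Measure ℝ) =
          Complex.exp (c * Real.Gamma (-(β - 1)) * t ^ ((β - 1 : ℝ) : ℂ))) ∧
      TendstoInDistribution
        (fun (n : ℕ) (y : Fin n → ℕ) => (n : ℝ) ^ (-(1 / (β - 1))) *
          ((m n : ℝ) - (∫ k : ℕ, (k : ℝ) ∂P) * n - (ordered y 1 : ℝ)))
        atTop (fun x : ℝ => x) A (X : Measure ℝ) := by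
  obtain ⟨X, hstable, hlaplace, hlim⟩ := exists_stable_limit hc hβ hβ3 hP
  have hX := ((asympEqualInLaw_ordered_one h).comp fun n z => (n : ℝ) ^ (-(1 / (β - 1))) *
    ((m n : ℝ) - (∫ k : ℕ, (k : ℝ) ∂P) * n - z)).tendstoInDistribution
      (fun n => .of_discrete) (fun n => .of_discrete) (νs := normalizedSumLaw P β) (fun n => by
        simp only [Int.cast_sub, Int.cast_sum, Int.cast_natCast,
          sub_sub_sub_cancel_left]
        rfl) hlim
  refine ⟨isBigOp_of_tendstoInDistribution (fun _ => .of_discrete) hX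
    (.of_forall fun n y => ?_), X, hstable, hlaplace, hX⟩
  rw [abs_div_rpow_eq, abs_mul, abs_mul, abs_sub_comm, Int.cast_natCast]

theorem exists_tendstoInDistribution_ordered
    (h : ApproxEqualLaws (fun n => (A n).map orderedVector)
      (fun n => (Measure.pi fun _ : Fin (n - 1) => P).map (comparisonVector (m n))))
    (hc : 0 < c) (hβ : 1 < β)
    (hP : (fun k => P.real {k}) ~[atTop] fun k : ℕ => c * (k : ℝ) ^ (-β)) {j : ℕ} (hj : 2 ≤ j) :
    IsBigOp A (fun _ y => (ordered y j : ℝ)) (fun n => (n : ℝ) ^ (1 / (β - 1))) ∧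
    ∃ W : ProbabilityMeasure ℝ,
      (W : Measure ℝ) =
        volume.withDensity (fun x => ENNReal.ofReal (densityW c (β - 1) j x)) ∧
      (W : Measure ℝ).map (fun x => c * (β - 1)⁻¹ * x ^ (-(β - 1))) =
        gammaMeasure ((j : ℝ) - 1) 1 ∧
      TendstoInDistribution
        (fun (n : ℕ) (y : Fin n → ℕ) => (n : ℝ) ^ (-(1 / (β - 1))) * (ordered y j : ℝ))
        atTop (fun x : ℝ => x) A (W : Measure ℝ) := by
  obtain ⟨W, hW, hlim⟩ := exists_tendsto_normalizedOrderedLaw hc hβ hP hj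
  have hdist := ((asympEqualInLaw_ordered h hj).comp
    fun n z => (n : ℝ) ^ (-(1 / (β - 1))) * (z : ℝ)).tendstoInDistribution
      (fun n => .of_discrete) (fun n => .of_discrete)
      (νs := normalizedOrderedLaw P β (j - 1)) (fun n => rfl) hlim
  refine ⟨isBigOp_of_tendstoInDistribution (fun _ => .of_discrete) hdist
    (.of_forall fun n y => abs_div_rpow_eq _ _ _), W, hW, ?_, hdist⟩
  rw [hW]
  exact map_withDensity_densityW hc (sub_pos.2 hβ) hj

theorem cdf_densityW_two (hc : 0 < c) {α : ℝ} (hα : 0 < α) {W : ProbabilityMeasure ℝ}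
    (hW : (W : Measure ℝ) = volume.withDensity fun x => ENNReal.ofReal (densityW c α 2 x))
    (x : ℝ) :
    cdf (W : Measure ℝ) x = if 0 < x then Real.exp (-(c / α * x ^ (-α))) else 0 := by
  rw [cdf_eq_real, hW, measureReal_densityW_Iic hc hα le_rfl]
  simp [limitCdf]

end OrderedComponents

section PartitionFunction

variable {w : ℕ → ℝ} {c β lam : ℝ} {m : ℕ → ℕ}

theorem tendsto_rpow_mul_Z_div (hc : 0 < c) (hβ : 2 < β) (hw : ∀ k, 0 ≤ w k)
    (hwc : w ~[atTop] fun k : ℕ => c * (k : ℝ) ^ (-β))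
    (hm : Tendsto (fun n : ℕ => (m n : ℝ) / n) atTop (𝓝 lam))
    (hlam : ∫ k : ℕ, (k : ℝ) ∂canonical w < lam) :
    Tendsto (fun n : ℕ => (n : ℝ) ^ (β - 1) * (Z w (m n) n / (Phi w 1).toReal ^ n)) atTop
      (𝓝 (c / (Phi w 1).toReal * (lam - ∫ k : ℕ, (k : ℝ) ∂canonical w) ^ (-β))) := by
  have hβ1 : 1 < β := one_lt_two.trans hβ
  have hρ := radius_eq_one hc hwc
  refine (tendsto_measureReal_sum_eq (by positivity) hβ (canonical_isEquivalent hc hβ1 hw hwc)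
    hm hlam).congr fun n => ?_
  rw [measureReal_pi_canonical_sum_eq (hρ ▸ Phi_one_ne_zero hc hwc)
    (hρ ▸ Phi_one_ne_top hβ1 hw hwc) hw, hρ, ENNReal.toReal_one, one_pow, mul_one_div]

theorem isEquivalent_Z (hc : 0 < c) (hβ : 2 < β) (hw : ∀ k, 0 ≤ w k)
    (hwc : w ~[atTop] fun k : ℕ => c * (k : ℝ) ^ (-β))
    (hm : Tendsto (fun n : ℕ => (m n : ℝ) / n) atTop (𝓝 lam))
    (hlam : ∫ k : ℕ, (k : ℝ) ∂canonical w < lam) :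
    (fun n : ℕ => Z w (m n) n) ~[atTop] fun n : ℕ =>
      c * (lam - ∫ k : ℕ, (k : ℝ) ∂canonical w) ^ (-β) * (Phi w 1).toReal ^ (n - 1) *
        (n : ℝ) ^ (1 - β) := by
  have hlim := tendsto_rpow_mul_Z_div hc hβ hw hwc hm hlam
  have hΦ : 0 < (Phi w 1).toReal :=
    ENNReal.toReal_pos (Phi_one_ne_zero hc hwc) (Phi_one_ne_top (one_lt_two.trans hβ) hw hwc)
  have hL : 0 < (lam - ∫ k : ℕ, (k : ℝ) ∂canonical w) ^ (-β) :=
    Real.rpow_pos_of_pos (sub_pos.2 hlam) _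
  have hratio := hlim.div_const
    (c / (Phi w 1).toReal * (lam - ∫ k : ℕ, (k : ℝ) ∂canonical w) ^ (-β))
  rw [div_self (by positivity)] at hratio
  refine isEquivalent_of_tendsto_one (hratio.congr' ?_)
  filter_upwards [eventually_gt_atTop 0] with n hn
  have : (0 : ℝ) < n := Nat.cast_pos.2 hn
  rw [Pi.div_apply, ← neg_sub, Real.rpow_neg n.cast_nonneg, ← mul_pow_sub_one hn.ne']
  field_simp

theorem eventually_allocation_eq_cond (hc : 0 < c) (hβ : 2 < β) (hw : ∀ k, 0 ≤ w k)
    (hwc : w ~[atTop] fun k : ℕ => c * (k : ℝ) ^ (-β))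
    (hm : Tendsto (fun n : ℕ => (m n : ℝ) / n) atTop (𝓝 lam))
    (hlam : ∫ k : ℕ, (k : ℝ) ∂canonical w < lam) :
    ∀ᶠ n in atTop, allocation w (m n) n = ProbabilityTheory.cond
      (Measure.pi fun _ : Fin n => canonical w) {y | ∑ l, y l = m n} := by
  have hβ1 : 1 < β := one_lt_two.trans hβ
  have hρ := radius_eq_one hc hwc
  have hL : 0 < c / (Phi w 1).toReal * (lam - ∫ k : ℕ, (k : ℝ) ∂canonical w) ^ (-β) :=
    mul_pos (div_pos hc (ENNReal.toReal_pos (Phi_one_ne_zero hc hwc) (Phi_one_ne_top hβ1 hw hwc)))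
      (Real.rpow_pos_of_pos (sub_pos.2 hlam) _)
  filter_upwards [(tendsto_rpow_mul_Z_div hc hβ hw hwc hm hlam).eventually (lt_mem_nhds hL)]
    with n hn
  have hZ : Z w (m n) n ≠ 0 := fun hZ => by simp only [hZ, zero_div, mul_zero, lt_irrefl] at hn
  exact allocation_eq_cond (hρ ▸ Phi_one_ne_zero hc hwc) (hρ ▸ Phi_one_ne_top hβ1 hw hwc)
    (hρ ▸ one_ne_zero) (hρ ▸ ENNReal.one_ne_top) hw ((Z_nonneg hw _ _).lt_of_ne hZ.symm)

end PartitionFunction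

end BallsInBoxes

theorem mainTheorem10 (w : ℕ → ℝ) (hw : ∀ k, 0 ≤ w k) (c β : ℝ) (hc : 0 < c) (hβ : 2 < β)
    (hwc : w ~[atTop] fun k : ℕ => c * (k : ℝ) ^ (-β)) :
    BallsInBoxes.nu w < ⊤ ∧
    ∀ (ν Φ₁ α c' lam : ℝ) (m : ℕ → ℕ),
      ν = (BallsInBoxes.nu w).toReal →
      Φ₁ = (BallsInBoxes.Phi w 1).toReal →
      α = β - 1 →
      c' = c / Φ₁ →
      ν < lam →
      Tendsto (fun n : ℕ => (m n : ℝ) / n) atTop (𝓝 lam) →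
      -- (i)
      (BallsInBoxes.IsLittleOp (fun n => BallsInBoxes.allocation w (m n) n)
          (fun n y => (BallsInBoxes.ordered y 1 : ℝ) - (lam - ν) * n) (fun n => (n : ℝ)) ∧
        BallsInBoxes.IsLittleOp (fun n => BallsInBoxes.allocation w (m n) n)
          (fun _ y => (BallsInBoxes.ordered y 2 : ℝ)) (fun n => (n : ℝ))) ∧
      -- (ii)
      ((fun n : ℕ => BallsInBoxes.Z w (m n) n) ~[atTop]
        fun n : ℕ => c * (lam - ν) ^ (-β) * Φ₁ ^ (n - 1) * (n : ℝ) ^ (1 - β)) ∧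
      -- (iii)
      BallsInBoxes.ApproxEqualLaws
        (fun n => (BallsInBoxes.allocation w (m n) n).map BallsInBoxes.orderedVector)
        (fun n => (Measure.pi fun _ : Fin (n - 1) => BallsInBoxes.canonical w).map
          (BallsInBoxes.comparisonVector (m n))) ∧
      -- (iv)
      (β < 3 →
        BallsInBoxes.IsBigOp (fun n => BallsInBoxes.allocation w (m n) n)
          (fun n y => (BallsInBoxes.ordered y 1 : ℝ) - ((m n : ℝ) - ν * n))
          (fun n => (n : ℝ) ^ (1 / α)) ∧
        ∃ X : ProbabilityMeasure ℝ,
          BallsInBoxes.IsStableLaw α (X : Measure ℝ) ∧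
          (∀ t : ℂ, 0 ≤ t.re →
            Integrable (fun x : ℝ => Complex.exp (-(t * (x : ℂ)))) (X : Measure ℝ) ∧
            ∫ x : ℝ, Complex.exp (-(t * (x : ℂ))) ∂(X : Measure ℝ) =
              Complex.exp ((c' : ℂ) * (Real.Gamma (-α) : ℂ) * t ^ (α : ℂ))) ∧
          TendstoInDistribution
            (fun (n : ℕ) (y : Fin n → ℕ) =>
              (n : ℝ) ^ (-(1 / α)) * ((m n : ℝ) - ν * n - (BallsInBoxes.ordered y 1 : ℝ)))
            atTop (fun x : ℝ => x)
            (fun n => BallsInBoxes.allocation w (m n) n) (X : Measure ℝ)) ∧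
      -- (v)
      (BallsInBoxes.IsBigOp (fun n => BallsInBoxes.allocation w (m n) n)
          (fun _ y => (BallsInBoxes.ordered y 2 : ℝ)) (fun n => (n : ℝ) ^ (1 / α)) ∧
        ∃ W : ProbabilityMeasure ℝ,
          (∀ x : ℝ, cdf (W : Measure ℝ) x =
            if 0 < x then Real.exp (-(c' / α * x ^ (-α))) else 0) ∧
          TendstoInDistribution
            (fun (n : ℕ) (y : Fin n → ℕ) =>
              (n : ℝ) ^ (-(1 / α)) * (BallsInBoxes.ordered y 2 : ℝ))
            atTop (fun x : ℝ => x)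
            (fun n => BallsInBoxes.allocation w (m n) n) (W : Measure ℝ)) ∧
      -- (vi)
      (∀ j : ℕ, 2 ≤ j →
        BallsInBoxes.IsBigOp (fun n => BallsInBoxes.allocation w (m n) n)
          (fun _ y => (BallsInBoxes.ordered y j : ℝ)) (fun n => (n : ℝ) ^ (1 / α)) ∧
        ∃ W : ProbabilityMeasure ℝ,
          (W : Measure ℝ) =
            volume.withDensity (fun x => ENNReal.ofReal (BallsInBoxes.densityW c' α j x)) ∧
          (W : Measure ℝ).map (fun x => c' * α⁻¹ * x ^ (-α)) = gammaMeasure ((j : ℝ) - 1) 1 ∧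
          TendstoInDistribution
            (fun (n : ℕ) (y : Fin n → ℕ) =>
              (n : ℝ) ^ (-(1 / α)) * (BallsInBoxes.ordered y j : ℝ))
            atTop (fun x : ℝ => x)
            (fun n => BallsInBoxes.allocation w (m n) n) (W : Measure ℝ)) := by
  have hβ1 : 1 < β := one_lt_two.trans hβ
  have hΦ0 := BallsInBoxes.Phi_one_ne_zero hc hwc
  have hΦ := BallsInBoxes.Phi_one_ne_top hβ1 hw hwc
  have hP := BallsInBoxes.canonical_isEquivalent hc hβ1 hw hwc
  have hint := BallsInBoxes.integrable_natCast hβ hP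
  have hρ := BallsInBoxes.radius_eq_one hc hwc
  have hnu := BallsInBoxes.nu_eq_ofReal_integral_canonical (hρ ▸ hΦ0) (hρ ▸ hΦ) hint
  refine ⟨hnu ▸ ENNReal.ofReal_lt_top, ?_⟩
  rintro ν Φ₁ α c' lam m hν rfl rfl rfl hlam hm
  rw [hnu, ENNReal.toReal_ofReal (integral_nonneg fun k => k.cast_nonneg)] at hν
  subst hν
  have hc' := div_pos hc (ENNReal.toReal_pos hΦ0 hΦ)
  have hcoupling := BallsInBoxes.approxEqualLaws_orderedVector hc' hβ hP hm hlam
    (fun n => BallsInBoxes.allocation w (m n) n)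
    (BallsInBoxes.eventually_allocation_eq_cond hc hβ hw hwc hm hlam)
  refine ⟨⟨BallsInBoxes.isLittleOp_ordered_one hcoupling hint hm,
      BallsInBoxes.isLittleOp_ordered_two hcoupling hint⟩,
    BallsInBoxes.isEquivalent_Z hc hβ hw hwc hm hlam, hcoupling,
    fun hβ3 => BallsInBoxes.exists_stable_tendstoInDistribution_ordered_one hcoupling hc' hβ hβ3 hP,
    ?_, fun j hj =>
      BallsInBoxes.exists_tendstoInDistribution_ordered hcoupling hc' hβ1 hP hj⟩
  obtain ⟨hbig, W, hW, -, hlim⟩ :=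
    BallsInBoxes.exists_tendstoInDistribution_ordered hcoupling hc' hβ1 hP le_rfl
  exact ⟨hbig, W, BallsInBoxes.cdf_densityW_two hc' (sub_pos.2 hβ1) hW, hlim⟩
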